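/- Let $V$ be a set and let $L$ be an abstract simplicial complex with vertex set contained in $V$: a non-empty set of finite subsets of $V$ closed under taking subsets (so $\emptyset\in L$; the case $L=\{\emptyset\}$ is allowed). Let $\mathbb T$ be the unit circle and put $$T_L=\bigcup_{\sigma\in L}T(\sigma)\subseteq\bigoplus_{v\in V}\mathbb T,\qquad T(\sigma)=\{(t_v): t_v=1 \text{ for } v\notin\sigma\},$$ with the CW topology (a set is open if and only if its intersection with each torus $T(\sigma)\cong\mathbb T^{\sigma}$ is open). Let $\mu_L:T_L\to\mathbb T$, $(t_v)\mapsto\prod_v t_v$, and let $\pi:\widetilde T_L\to T_L$ be the infinite cyclic cover obtained by pulling back the universal cover $\mathbb R\to\mathbb T$ along $\mu_L$; the group $Z\cong\mathbb Z$ acts on $\widetilde T_L$ by deck transformations. Let $R$ be a ring (associative with unit, not necessarily commutative), and let $H^*(\,\cdot\,;R)$ denote the singular cohomology ring. Let $\beta_L\in H^1(T_L;R)$ be the image under $\mathbb Z\to R$ of the class in $H^1(T_L;\mathbb Z)$ whose value on each loop $\gamma$ is the degree of $\mu_L\circ\gamma$, and let $(\beta_L)$ be the two-sided ideal of $H^*(T_L;R)$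 generated by $\beta_L$. Let $\overline H^{i}(L;R)$, $i\ge -1$, be the reduced simplicial cohomology of $L$, that is, the cohomology of the augmented simplicial cochain complex $C_+^*(L;R)$, and call $L$ $R$-acyclic if $\overline H^{i}(L;R)=0$ for all $i\ge -1$. Then: 1. The image of the ring homomorphism $\pi^*:H^*(T_L;R)\to H^*(\widetilde T_L;R)$ is equal to the subring of $Z$-fixed points of $H^*(\widetilde T_L;R)$. 2. The map $\pi^*$ induces a ring isomorphism from $H^*(T_L;R)/(\beta_L)$ onto its image. 3. For every $n\ge 0$ the cokernel of $\pi^*:H^n(T_L;R)\to H^n(\widetilde T_L;R)$ is isomorphic, as a left $R$-module, to the product $\prod_{i\in\mathbb Z}\overline H^{n-1}(L;R)$ of countably infinitely many copies of $\overline H^{n-1}(L;R)$. 4. The induced ring homomorphism $H^*(T_L;R)/(\beta_L)\to H^*(\widetilde T_L;R)$ is an isomorphism if and only if $L$ is $R$-acyclic. -/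

import Mathlib

universe u w

namespace TorusCover

noncomputable section

open CategoryTheory Simplicial Opposite DirectSum

/-- The front face `[p] → [n]`, `i ↦ i`. -/
def frontFace {p n : ℕ} (h : p ≤ n) : ⦋p⦌ ⟶ ⦋n⦌ :=
  SimplexCategory.mkHom
    { toFun := fun i : Fin (p + 1) => (⟨i.1, by omega⟩ : Fin (n + 1))
      monotone' := fun _ _ hij => Fin.mk_le_mk.2 (Fin.le_def.1 hij) }

/-- The back face `[q] → [n]`, `i ↦ p + i`, where `p + q = n`. -/
def backFace {q n : ℕ} (p : ℕ) (h : p + q = n) : ⦋q⦌ ⟶ ⦋n⦌ :=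
  SimplexCategory.mkHom
    { toFun := fun i : Fin (q + 1) => (⟨p + i.1, by omega⟩ : Fin (n + 1))
      monotone' := fun _ _ hij => Fin.mk_le_mk.2 (Nat.add_le_add_left (Fin.le_def.1 hij) p) }

/-- The `R`-valued cochains of degree `n` on a simplicial set. -/
abbrev Cochain (X : SSet.{u}) (R : Type w) (n : ℕ) : Type (max u w) := X _⦋n⦌ → R

/-- The coboundary `(δ f)(x) = ∑ i, (-1) ^ i f(dᵢ x)`. -/
def coboundary (X : SSet.{u}) (R : Type w) [Ring R] (n : ℕ) :
    Cochain X R n →ₗ[R] Cochain X R (n + 1) where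
  toFun f x := ∑ i : Fin (n + 2), ((-1 : ℤ) ^ (i : ℕ)) • f (X.δ i x)
  map_add' f g := by
    funext x
    simp only [Pi.add_apply, smul_add, Finset.sum_add_distrib]
  map_smul' r f := by
    funext x
    simp only [Pi.smul_apply, Finset.smul_sum, RingHom.id_apply]
    exact Finset.sum_congr rfl fun i _ => smul_comm _ _ _

theorem coboundary_apply {X : SSet.{u}} {R : Type w} [Ring R] {n : ℕ} (f : Cochain X R n)
    (x : X _⦋n + 1⦌) :
    coboundary X R n f x = ∑ i : Fin (n + 2), ((-1 : ℤ) ^ (i : ℕ)) • f (X.δ i x) := rfl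

/-- The Alexander-Whitney cup product of cochains: value of `f` on the front face times value
of `g` on the back face. -/
def cup {X : SSet.{u}} {R : Type w} [Ring R] {p q n : ℕ} (h : p + q = n)
    (f : Cochain X R p) (g : Cochain X R q) : Cochain X R n := fun x =>
  f (X.map (frontFace (by omega : p ≤ n)).op x) * g (X.map (backFace p h).op x)

section lemmas
variable {X : SSet.{u}} {R : Type w} [Ring R]

theorem map_op_map_op {a b c : SimplexCategory} (f : a ⟶ b) (g : b ⟶ c) (x : X.obj (op c)) :
    X.map f.op (X.map g.op x) = X.map (f ≫ g).op x := by
  rw [op_comp, X.map_comp]; rfl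

theorem face_ext {p n : ℕ} {f g : ⦋p⦌ ⟶ ⦋n⦌}
    (h : ∀ i : Fin (p + 1), ((f i : Fin (n + 1)) : ℕ) = ((g i : Fin (n + 1)) : ℕ)) : f = g := by
  ext i
  exact h i

@[simp] theorem frontFace_val {p n : ℕ} (h : p ≤ n) (i : Fin (p + 1)) :
    ((frontFace h i : Fin (n + 1)) : ℕ) = i := rfl

@[simp] theorem backFace_val {q n : ℕ} (p : ℕ) (h : p + q = n) (i : Fin (q + 1)) :
    ((backFace p h i : Fin (n + 1)) : ℕ) = p + i := rfl

theorem comp_val {a b c : ℕ} (f : ⦋a⦌ ⟶ ⦋b⦌) (g : ⦋b⦌ ⟶ ⦋c⦌) (i : Fin (a + 1)) :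
    (((f ≫ g) i : Fin (c + 1)) : ℕ) = (g (f i : Fin (b + 1)) : Fin (c + 1)) := rfl

theorem δ_val {n : ℕ} (i : Fin (n + 2)) (j : Fin (n + 1)) :
    ((j : ℕ) < i ∧ ((SimplexCategory.δ i j : Fin (n + 2)) : ℕ) = j) ∨
      ((i : ℕ) ≤ j ∧ ((SimplexCategory.δ i j : Fin (n + 2)) : ℕ) = j + 1) := by
  change ((j : ℕ) < i ∧ ((i.succAbove j : Fin (n + 2)) : ℕ) = j) ∨
      ((i : ℕ) ≤ j ∧ ((i.succAbove j : Fin (n + 2)) : ℕ) = j + 1)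
  by_cases h : (j : ℕ) < i
  · rw [Fin.succAbove_of_castSucc_lt _ _ (by simpa [Fin.lt_def] using h)]
    exact Or.inl ⟨h, rfl⟩
  · rw [Fin.succAbove_of_le_castSucc _ _ (by simpa [Fin.le_def] using h)]
    exact Or.inr ⟨not_lt.1 h, rfl⟩

/-- Leibniz rule `δ(f ∪ g) = δf ∪ g + (-1) ^ p f ∪ δg`. -/
theorem coboundary_cup {p q n : ℕ} (h : p + q = n) (f : Cochain X R p) (g : Cochain X R q) :
    coboundary X R n (cup h f g) =
      cup (by omega : (p + 1) + q = n + 1) (coboundary X R p f) g +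
        ((-1 : ℤ) ^ p) • cup (by omega : p + (q + 1) = n + 1) f (coboundary X R q g) := by
  subst h
  funext x
  have h1 : p + q + 2 = (p + 1) + (q + 1) := by omega
  simp only [coboundary, LinearMap.coe_mk, AddHom.coe_mk, Pi.add_apply, Pi.smul_apply, cup,
    SimplicialObject.δ]
  have e1 (i : Fin (p + 1)) : frontFace (by omega : p ≤ p + q) ≫
      SimplexCategory.δ (finCongr h1.symm (Fin.castAdd (q + 1) i)) =
        SimplexCategory.δ i.castSucc ≫ frontFace (by omega : p + 1 ≤ p + q + 1) := by
    refine face_ext fun j => ?_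
    have a := δ_val (finCongr h1.symm (Fin.castAdd (q + 1) i))
      (frontFace (by omega : p ≤ p + q) j)
    have b := δ_val i.castSucc j
    simp only [frontFace_val, finCongr_apply, Fin.val_cast, Fin.val_castAdd,
      Fin.val_castSucc] at a b
    simp only [comp_val, frontFace_val, finCongr_apply]
    omega
  have e2 (i : Fin (p + 1)) : backFace p rfl ≫
      SimplexCategory.δ (finCongr h1.symm (Fin.castAdd (q + 1) i)) =
        backFace (p + 1) (by omega : (p + 1) + q = p + q + 1) := by
    refine face_ext fun j => ?_
    have a := δ_val (finCongr h1.symm (Fin.castAdd (q + 1) i))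
      (backFace p (rfl : p + q = p + q) j)
    simp only [backFace_val, finCongr_apply, Fin.val_cast, Fin.val_castAdd] at a
    simp only [comp_val, backFace_val, finCongr_apply]
    omega
  have e3 (i : Fin (q + 1)) : frontFace (by omega : p ≤ p + q) ≫
      SimplexCategory.δ (finCongr h1.symm (Fin.natAdd (p + 1) i)) =
        frontFace (by omega : p ≤ p + q + 1) := by
    refine face_ext fun j => ?_
    have a := δ_val (finCongr h1.symm (Fin.natAdd (p + 1) i))
      (frontFace (by omega : p ≤ p + q) j)
    simp only [frontFace_val, finCongr_apply, Fin.val_cast, Fin.val_natAdd] at a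
    simp only [comp_val, frontFace_val, finCongr_apply]
    omega
  have e4 (i : Fin (q + 1)) : backFace p rfl ≫
      SimplexCategory.δ (finCongr h1.symm (Fin.natAdd (p + 1) i)) =
        SimplexCategory.δ i.succ ≫ backFace p (by omega : p + (q + 1) = p + q + 1) := by
    refine face_ext fun j => ?_
    have a := δ_val (finCongr h1.symm (Fin.natAdd (p + 1) i))
      (backFace p (rfl : p + q = p + q) j)
    have b := δ_val i.succ j
    simp only [backFace_val, finCongr_apply, Fin.val_cast, Fin.val_natAdd, Fin.val_succ] at a b
    simp only [comp_val, backFace_val, finCongr_apply]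
    omega
  have e5 : SimplexCategory.δ (Fin.last (p + 1)) ≫ frontFace (by omega : p + 1 ≤ p + q + 1) =
      frontFace (by omega : p ≤ p + q + 1) := by
    refine face_ext fun j => ?_
    have a := δ_val (Fin.last (p + 1)) j
    simp only [Fin.val_last] at a
    simp only [comp_val, frontFace_val]
    omega
  have e6 : SimplexCategory.δ 0 ≫ backFace p (by omega : p + (q + 1) = p + q + 1) =
      backFace (p + 1) (by omega : (p + 1) + q = p + q + 1) := by
    refine face_ext fun j => ?_
    have a := δ_val 0 j
    simp only [Fin.val_zero] at a
    simp only [comp_val, backFace_val]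
    omega
  rw [← Equiv.sum_comp (finCongr h1.symm), Fin.sum_univ_add, Fin.sum_univ_castSucc (n := p + 1),
    Fin.sum_univ_succ (n := q + 1)]
  simp only [map_op_map_op, e1, e2, e3, e4, e5, e6, add_mul, mul_add, Finset.sum_mul,
    Finset.mul_sum, smul_add, Finset.smul_sum, smul_mul_assoc, mul_smul_comm, smul_smul]
  simp only [finCongr_apply, Fin.val_cast, Fin.val_castAdd, Fin.val_natAdd, Fin.val_castSucc,
    Fin.val_succ, Fin.val_last, Fin.val_zero, pow_zero, mul_one]
  have h2 (i : Fin (q + 1)) : ((-1 : ℤ)) ^ (p + 1 + (i : ℕ)) = (-1) ^ p * (-1) ^ ((i : ℕ) + 1) := by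
    ring
  simp only [h2, pow_succ (-1 : ℤ) p, mul_neg, mul_one, neg_smul]
  abel

theorem cup_add {p q n : ℕ} (h : p + q = n) (f : Cochain X R p) (g g' : Cochain X R q) :
    cup h f (g + g') = cup h f g + cup h f g' := by
  funext x; simp [cup, mul_add]

theorem add_cup {p q n : ℕ} (h : p + q = n) (f f' : Cochain X R p) (g : Cochain X R q) :
    cup h (f + f') g = cup h f g + cup h f' g := by
  funext x; simp [cup, add_mul]

theorem cup_zero {p q n : ℕ} (h : p + q = n) (f : Cochain X R p) :
    cup h f (0 : Cochain X R q) = 0 := by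
  funext x; simp [cup]

theorem zero_cup {p q n : ℕ} (h : p + q = n) (g : Cochain X R q) :
    cup h (0 : Cochain X R p) g = 0 := by
  funext x; simp [cup]

theorem cup_assoc {p q r m k n : ℕ} (h₁ : p + q = m) (h₂ : m + r = n) (h₃ : q + r = k)
    (h₄ : p + k = n) (f : Cochain X R p) (g : Cochain X R q) (e : Cochain X R r) :
    cup h₂ (cup h₁ f g) e = cup h₄ f (cup h₃ g e) := by
  subst h₁ h₂ h₃
  have e1 : frontFace (by omega : p ≤ p + q) ≫ frontFace (by omega : p + q ≤ p + q + r) =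
      frontFace (by omega : p ≤ p + q + r) := rfl
  have e2 : backFace p rfl ≫ frontFace (by omega : p + q ≤ p + q + r) =
      frontFace (by omega : q ≤ q + r) ≫ backFace p h₄ := rfl
  have e3 : backFace q rfl ≫ backFace p h₄ = backFace (p + q) (rfl : _ = p + q + r) := by
    refine face_ext fun j => ?_
    simp [Nat.add_assoc]
  funext x
  simp only [cup, map_op_map_op, e1, e2, e3, mul_assoc]

/-- The constant cochain `1` in degree `0`. -/
def unitCochain (X : SSet.{u}) (R : Type w) [Ring R] : Cochain X R 0 := fun _ => 1

theorem one_cup {n : ℕ} (h : 0 + n = n) (f : Cochain X R n) : cup h (unitCochain X R) f = f := by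
  have e1 : backFace 0 h = 𝟙 ⦋n⦌ := by
    refine face_ext fun j => ?_
    simp
  funext x
  simp [cup, unitCochain, e1]

theorem cup_one {n : ℕ} (h : n + 0 = n) (f : Cochain X R n) : cup h f (unitCochain X R) = f := by
  have e1 : frontFace (le_refl n) = 𝟙 ⦋n⦌ := rfl
  funext x
  simp [cup, unitCochain, e1]

theorem coboundary_unit (c : ℤ) : coboundary X R 0 (c • unitCochain X R) = 0 := by
  funext x
  simp [coboundary, unitCochain, Fin.sum_univ_two]

end lemmas

section coh
variable (X : SSet.{u}) (R : Type w) [Ring R]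

/-- Cocycles of degree `n`. -/
def cocycles (n : ℕ) : Submodule R (Cochain X R n) := LinearMap.ker (coboundary X R n)

/-- Coboundaries of degree `n`; there are none but `0` in degree `0`. -/
def coboundaries (n : ℕ) : Submodule R (Cochain X R n) :=
  match n with
  | 0 => ⊥
  | n + 1 => LinearMap.range (coboundary X R n)

/-- The cohomology `Hⁿ(X; R)` of a simplicial set, as a left `R`-module. -/
def Cohomology (n : ℕ) : Type (max u w) :=
  cocycles X R n ⧸ (coboundaries X R n).submoduleOf (cocycles X R n)

instance (n : ℕ) : AddCommGroup (Cohomology X R n) :=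
  inferInstanceAs (AddCommGroup (_ ⧸ (coboundaries X R n).submoduleOf (cocycles X R n)))

instance (n : ℕ) : Module R (Cohomology X R n) :=
  inferInstanceAs (Module R (_ ⧸ (coboundaries X R n).submoduleOf (cocycles X R n)))

variable {X R}

/-- The class of a cocycle. -/
def Cohomology.mk {n : ℕ} : cocycles X R n →ₗ[R] Cohomology X R n :=
  Submodule.mkQ ((coboundaries X R n).submoduleOf (cocycles X R n))

theorem Cohomology.ind {n : ℕ} {P : Cohomology X R n → Prop}
    (h : ∀ z, P (Cohomology.mk z)) (x : Cohomology X R n) : P x := by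
  obtain ⟨z, rfl⟩ := Submodule.mkQ_surjective ((coboundaries X R n).submoduleOf (cocycles X R n)) x
  exact h z

theorem Cohomology.mk_eq {n : ℕ} {z z' : cocycles X R n} :
    Cohomology.mk z = Cohomology.mk z' ↔
      (z : Cochain X R n) - z' ∈ coboundaries X R n := by
  exact Submodule.Quotient.eq _

theorem cup_mem_cocycles {p q n : ℕ} (h : p + q = n) {f : Cochain X R p} {g : Cochain X R q}
    (hf : f ∈ cocycles X R p) (hg : g ∈ cocycles X R q) : cup h f g ∈ cocycles X R n := by
  have hf' : coboundary X R p f = 0 := hf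
  have hg' : coboundary X R q g = 0 := hg
  change coboundary X R n _ = 0
  rw [coboundary_cup, hf', hg', cup_zero, zero_cup, smul_zero, add_zero]

theorem cup_mem_coboundaries_left {p q n : ℕ} (h : p + q = n) {f : Cochain X R p}
    {g : Cochain X R q} (hf : f ∈ coboundaries X R p) (hg : g ∈ cocycles X R q) :
    cup h f g ∈ coboundaries X R n := by
  have hg' : coboundary X R q g = 0 := hg
  cases p with
  | zero =>
    have : f = 0 := hf
    rw [this, zero_cup]; exact zero_mem _
  | succ p =>
    obtain ⟨e, rfl⟩ := hf
    obtain ⟨n, rfl⟩ : ∃ m, n = m + 1 := ⟨p + q, by omega⟩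
    refine ⟨cup (by omega : p + q = n) e g, ?_⟩
    rw [coboundary_cup, hg', cup_zero, smul_zero, add_zero]

theorem cup_mem_coboundaries_right {p q n : ℕ} (h : p + q = n) {f : Cochain X R p}
    {g : Cochain X R q} (hf : f ∈ cocycles X R p) (hg : g ∈ coboundaries X R q) :
    cup h f g ∈ coboundaries X R n := by
  have hf' : coboundary X R p f = 0 := hf
  cases q with
  | zero =>
    have : g = 0 := hg
    rw [this, cup_zero]; exact zero_mem _
  | succ q =>
    obtain ⟨e, rfl⟩ := hg
    obtain ⟨n, rfl⟩ : ∃ m, n = m + 1 := ⟨p + q, by omega⟩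
    have key := coboundary_cup (by omega : p + q = n) f e
    rw [hf', zero_cup, zero_add] at key
    have : cup h f (coboundary X R q e) =
        ((-1 : ℤ) ^ p) • coboundary X R n (cup (by omega : p + q = n) f e) := by
      rw [key, smul_smul, ← mul_pow]; simp
    rw [this]
    exact zsmul_mem (LinearMap.mem_range_self _ _) _

/-- The cup product `Hᵖ × H^q → H^(p+q)`. -/
def Cohomology.cupProduct {p q : ℕ} (a : Cohomology X R p) (b : Cohomology X R q) :
    Cohomology X R (p + q) :=
  Quotient.liftOn₂' a b
    (fun z y => Cohomology.mk ⟨cup rfl z.1 y.1, cup_mem_cocycles rfl z.2 y.2⟩) <| by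
      intro z y z' y' hz hy
      have hz' : z.1 - z'.1 ∈ coboundaries X R p := 
        (Submodule.quotientRel_def
          ((coboundaries X R p).submoduleOf (cocycles X R p))).1 hz
      have hy' : y.1 - y'.1 ∈ coboundaries X R q := 
        (Submodule.quotientRel_def
          ((coboundaries X R q).submoduleOf (cocycles X R q))).1 hy
      refine Cohomology.mk_eq.2 ?_
      have key : cup (rfl : p + q = p + q) z.1 y.1 - cup rfl z'.1 y'.1 =
          cup rfl (z.1 - z'.1) y.1 + cup rfl z'.1 (y.1 - y'.1) := by
        funext x
        simp only [cup, Pi.sub_apply, Pi.add_apply, sub_mul, mul_sub]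
        abel
      rw [key]
      exact add_mem (cup_mem_coboundaries_left rfl hz' y.2)
        (cup_mem_coboundaries_right rfl z'.2 hy')

theorem Cohomology.cupProduct_mk {p q : ℕ} (z : cocycles X R p) (y : cocycles X R q) :
    Cohomology.cupProduct (Cohomology.mk z) (Cohomology.mk y) =
      Cohomology.mk ⟨cup rfl z.1 y.1, cup_mem_cocycles rfl z.2 y.2⟩ := rfl

theorem Cohomology.mk_sigma_eq {m n : ℕ} (h : m = n) {z : cocycles X R m} {y : cocycles X R n}
    (hzy : ∀ x : X _⦋n⦌, z.1 (h ▸ x) = y.1 x) :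
    (⟨m, Cohomology.mk z⟩ : GradedMonoid (Cohomology X R)) = ⟨n, Cohomology.mk y⟩ := by
  subst h
  rw [show z = y from Subtype.ext (funext hzy)]

theorem cup_cast {p q m n : ℕ} (h : m = n) (h₁ : p + q = m) (h₂ : p + q = n)
    (f : Cochain X R p) (g : Cochain X R q) (x : X _⦋n⦌) :
    cup h₁ f g (h ▸ x) = cup h₂ f g x := by
  subst h; rfl

/-- The constant cocycle with integer value `c` in degree `0`. -/
def unitCocycle (X : SSet.{u}) (R : Type w) [Ring R] (c : ℤ) : cocycles X R 0 :=
  ⟨c • unitCochain X R, coboundary_unit c⟩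

instance : GradedMonoid.GMul (Cohomology X R) where
  mul := Cohomology.cupProduct

instance : GradedMonoid.GOne (Cohomology X R) where
  one := Cohomology.mk (unitCocycle X R 1)

/-- The cohomology is a graded ring under cup product; `⨁ n, Cohomology X R n` is thus a ring. -/
instance : DirectSum.GRing (Cohomology X R) where
  mul_zero a := by
    induction a using Cohomology.ind with | h z =>
    exact congrArg Cohomology.mk (Subtype.ext (cup_zero rfl z.1))
  zero_mul b := by
    induction b using Cohomology.ind with | h z =>
    exact congrArg Cohomology.mk (Subtype.ext (zero_cup rfl z.1))
  mul_add a b c := by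
    induction a using Cohomology.ind with | h a =>
    induction b using Cohomology.ind with | h b =>
    induction c using Cohomology.ind with | h c =>
    exact congrArg Cohomology.mk (Subtype.ext (cup_add rfl a.1 b.1 c.1))
  add_mul a b c := by
    induction a using Cohomology.ind with | h a =>
    induction b using Cohomology.ind with | h b =>
    induction c using Cohomology.ind with | h c =>
    exact congrArg Cohomology.mk (Subtype.ext (add_cup rfl a.1 b.1 c.1))
  one_mul := by
    rintro ⟨n, a⟩
    induction a using Cohomology.ind with | h a =>
    refine Cohomology.mk_sigma_eq (Nat.zero_add n) fun x => ?_
    change cup rfl ((1 : ℤ) • unitCochain X R) a.1 _ = _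
    rw [one_smul, cup_cast (Nat.zero_add n) rfl (Nat.zero_add n), one_cup]
  mul_one := by
    rintro ⟨n, a⟩
    induction a using Cohomology.ind with | h a =>
    refine Cohomology.mk_sigma_eq (Nat.add_zero n) fun x => ?_
    change cup rfl a.1 ((1 : ℤ) • unitCochain X R) _ = _
    rw [one_smul, cup_one]
  mul_assoc := by
    rintro ⟨p, a⟩ ⟨q, b⟩ ⟨r, c⟩
    induction a using Cohomology.ind with | h a =>
    induction b using Cohomology.ind with | h b =>
    induction c using Cohomology.ind with | h c =>
    refine Cohomology.mk_sigma_eq (Nat.add_assoc p q r) fun x => ?_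
    change cup rfl (cup rfl a.1 b.1) c.1 _ = cup rfl a.1 (cup rfl b.1 c.1) x
    rw [cup_cast (Nat.add_assoc p q r) rfl (Nat.add_assoc p q r),
      cup_assoc rfl (Nat.add_assoc p q r) rfl rfl]
  natCast n := Cohomology.mk (unitCocycle X R n)
  natCast_zero := by
    refine Eq.trans ?_ (map_zero (Cohomology.mk (X := X) (R := R) (n := 0)))
    exact congrArg Cohomology.mk (Subtype.ext (zero_smul ℤ _))
  natCast_succ n := by
    refine Eq.trans ?_ (map_add (Cohomology.mk (X := X) (R := R) (n := 0))
      (unitCocycle X R n) (unitCocycle X R 1))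
    refine congrArg Cohomology.mk (Subtype.ext ?_)
    change ((n + 1 : ℕ) : ℤ) • unitCochain X R = (n : ℤ) • _ + (1 : ℤ) • _
    rw [← add_smul]; norm_cast
  intCast n := Cohomology.mk (unitCocycle X R n)
  intCast_ofNat n := rfl
  intCast_negSucc_ofNat n := by
    refine Eq.trans ?_ (map_neg (Cohomology.mk (X := X) (R := R) (n := 0))
      (unitCocycle X R (n + 1 : ℕ)))
    refine congrArg Cohomology.mk (Subtype.ext ?_)
    change (Int.negSucc n) • unitCochain X R = -(((n + 1 : ℕ) : ℤ) • unitCochain X R)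
    rw [← neg_smul, Int.negSucc_eq]; norm_cast

end coh

section maps
variable {X Y : SSet.{u}} (R : Type w) [Ring R]

/-- Pull-back of cochains. -/
def cochainMap (f : X ⟶ Y) (n : ℕ) : Cochain Y R n →ₗ[R] Cochain X R n :=
  LinearMap.funLeft R R (f.app (op ⦋n⦌))

theorem coboundary_cochainMap (f : X ⟶ Y) (n : ℕ) (c : Cochain Y R n) :
    coboundary X R n (cochainMap R f n c) = cochainMap R f (n + 1) (coboundary Y R n c) := by
  funext x
  change coboundary X R n (cochainMap R f n c) x = coboundary Y R n c (f.app _ x)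
  rw [coboundary_apply, coboundary_apply]
  refine Finset.sum_congr rfl fun i _ => ?_
  change _ • c (f.app _ (X.δ i x)) = _ • c (Y.δ i (f.app _ x))
  rw [SSet.δ_naturality_apply]

/-- Pull-back of cocycles. -/
def cocycleMap (f : X ⟶ Y) (n : ℕ) : cocycles Y R n →ₗ[R] cocycles X R n :=
  (cochainMap R f n).restrict fun c hc => by
    have hc' : coboundary Y R n c = 0 := hc
    change coboundary X R n _ = 0
    rw [coboundary_cochainMap, hc', map_zero]

/-- The map induced in degree `n` cohomology. -/
def cohomologyMap (f : X ⟶ Y) (n : ℕ) : Cohomology Y R n →ₗ[R] Cohomology X R n :=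
  Submodule.mapQ ((coboundaries Y R n).submoduleOf (cocycles Y R n))
    ((coboundaries X R n).submoduleOf (cocycles X R n)) (cocycleMap R f n) <| by
    intro c hc
    have hc' : c.1 ∈ coboundaries Y R n := hc
    change cochainMap R f n c.1 ∈ coboundaries X R n
    cases n with
    | zero =>
      have : c.1 = 0 := hc'
      rw [this, map_zero]; exact zero_mem _
    | succ n =>
      obtain ⟨e, he⟩ := hc'
      exact ⟨cochainMap R f n e, by rw [coboundary_cochainMap, he]⟩

theorem cup_cochainMap (f : X ⟶ Y) {p q n : ℕ} (h : p + q = n) (a : Cochain Y R p)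
    (b : Cochain Y R q) :
    cup h (cochainMap R f p a) (cochainMap R f q b) = cochainMap R f n (cup h a b) := by
  funext x
  change a (f.app _ (X.map _ x)) * b (f.app _ (X.map _ x)) =
    a (Y.map _ (f.app _ x)) * b (Y.map _ (f.app _ x))
  rw [NatTrans.naturality_apply, NatTrans.naturality_apply]

/-- The ring homomorphism induced on cohomology rings. -/
def cohomologyRingMap (f : X ⟶ Y) :
    (⨁ n, Cohomology Y R n) →+* (⨁ n, Cohomology X R n) :=
  DirectSum.toSemiring
    (fun n => (DirectSum.of (Cohomology X R) n).comp (cohomologyMap R f n).toAddMonoidHom)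
    (by rfl)
    (by
      intro p q a b
      induction a using Cohomology.ind with | h a =>
      induction b using Cohomology.ind with | h b =>
      simp only [AddMonoidHom.comp_apply, DirectSum.of_mul_of]
      refine congrArg _ (congrArg Cohomology.mk (Subtype.ext ?_))
      exact (cup_cochainMap R f rfl a.1 b.1).symm)
theorem cohomologyRingMap_of (f : X ⟶ Y) (n : ℕ) (a : Cohomology Y R n) :
    cohomologyRingMap R f (DirectSum.of (Cohomology Y R) n a) =
      DirectSum.of (Cohomology X R) n (cohomologyMap R f n a) := by
  exact DirectSum.toSemiring_of
    (fun n => (DirectSum.of (Cohomology X R) n).comp (cohomologyMap R f n).toAddMonoidHom)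
    _ _ n a

end maps

section sing
variable (X : Type u) {Y : Type u} [TopologicalSpace X] [TopologicalSpace Y]
  (R : Type w) [Ring R]

/-- The singular simplicial set of a topological space. -/
abbrev singularSet : SSet.{u} := TopCat.toSSet.obj (TopCat.of X)

/-- Singular cohomology `Hⁿ(X; R)`. -/
abbrev SingularCohomology (n : ℕ) : Type (max u w) := Cohomology (singularSet X) R n

/-- The singular cohomology ring `H^*(X; R)`. -/
abbrev SingularCohomologyRing : Type (max u w) := ⨁ n, SingularCohomology X R n

variable {X}

/-- The map `f^*` on singular cohomology of degree `n`. -/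
def pullback (f : C(X, Y)) (n : ℕ) : SingularCohomology Y R n →ₗ[R] SingularCohomology X R n :=
  cohomologyMap R (TopCat.toSSet.map (TopCat.ofHom f)) n

/-- The ring homomorphism `f^*` on singular cohomology rings. -/
def pullbackRing (f : C(X, Y)) : SingularCohomologyRing Y R →+* SingularCohomologyRing X R :=
  cohomologyRingMap R (TopCat.toSSet.map (TopCat.ofHom f))

theorem pullbackRing_of (f : C(X, Y)) (n : ℕ) (a : SingularCohomology Y R n) :
    pullbackRing R f (DirectSum.of (SingularCohomology Y R) n a) =
      DirectSum.of (SingularCohomology X R) n (pullback R f n a) :=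
  cohomologyRingMap_of R _ n a

/-- A singular simplex as a continuous map on the standard simplex. -/
def simplexMap {n : ℕ} (s : singularSet X _⦋n⦌) : C(stdSimplex ℝ (Fin (n + 1)), X) :=
  TopCat.toSSetObjEquiv (TopCat.of X) (op ⦋n⦌) s

theorem simplexMap_δ {n : ℕ} (s : singularSet X _⦋n + 1⦌) (i : Fin (n + 2))
    (z : stdSimplex ℝ (Fin (n + 1))) :
    simplexMap ((singularSet X).δ i s) z = simplexMap s (stdSimplex.map i.succAbove z) := rfl

theorem exists_lift {n : ℕ} (f : C(stdSimplex ℝ (Fin (n + 1)), Circle)) :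
    ∃ θ : C(stdSimplex ℝ (Fin (n + 1)), ℝ), ∀ x, Circle.exp (θ x) = f x := by
  have : LocallyPathConnectedSpace (stdSimplex ℝ (Fin (n + 1))) :=
    (convex_stdSimplex ℝ (Fin (n + 1))).locallyPathConnectedSpace
  have : ContractibleSpace (stdSimplex ℝ (Fin (n + 1))) :=
    (convex_stdSimplex ℝ (Fin (n + 1))).contractibleSpace ⟨_, (stdSimplex.vertex 0).2⟩
  obtain ⟨F, hF, -⟩ := Circle.isCoveringMap_exp.existsUnique_continuousMap_lifts f
    (stdSimplex.vertex 0) (Complex.arg (f (stdSimplex.vertex 0))) (Circle.exp_arg _)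
  exact ⟨F, fun x => congrFun hF.2 x⟩

theorem lift_sub_eq {n : ℕ} {θ θ' : C(stdSimplex ℝ (Fin (n + 1)), ℝ)}
    (h : ∀ x, Circle.exp (θ x) = Circle.exp (θ' x)) (x y : stdSimplex ℝ (Fin (n + 1))) :
    θ x - θ y = θ' x - θ' y := by
  obtain ⟨m, hm⟩ := Circle.exp_eq_exp.1 (h y)
  have key : (θ : stdSimplex ℝ (Fin (n + 1)) → ℝ) = fun z => θ' z + m * (2 * Real.pi) := by
    refine Circle.isCoveringMap_exp.eq_of_comp_eq θ.continuous (by fun_prop) ?_ y hm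
    funext z
    exact (h z).trans (Circle.exp_eq_exp.2 ⟨-m, by push_cast; ring⟩)
  have hx : θ x = θ' x + m * (2 * Real.pi) := congrFun key x
  linarith

theorem exists_turning (γ : C(stdSimplex ℝ (Fin 2), Circle)) :
    ∃ m : ℤ, ∀ θ : C(stdSimplex ℝ (Fin 2), ℝ), (∀ x, Circle.exp (θ x) = γ x) →
      θ (stdSimplex.vertex 1) - θ (stdSimplex.vertex 0) =
        Complex.arg (γ (stdSimplex.vertex 1)) - Complex.arg (γ (stdSimplex.vertex 0)) +
          m * (2 * Real.pi) := by
  obtain ⟨θ₀, h₀⟩ := exists_lift γ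
  obtain ⟨a, ha⟩ := Circle.exp_eq_exp.1
    ((h₀ (stdSimplex.vertex 1)).trans (Circle.exp_arg (γ (stdSimplex.vertex 1))).symm)
  obtain ⟨b, hb⟩ := Circle.exp_eq_exp.1
    ((h₀ (stdSimplex.vertex 0)).trans (Circle.exp_arg (γ (stdSimplex.vertex 0))).symm)
  refine ⟨a - b, fun θ h => ?_⟩
  rw [lift_sub_eq (fun x => (h x).trans (h₀ x).symm), ha, hb]
  push_cast
  ring

/-- For a path `γ` in the circle, with any continuous argument `θ`, the integer `m` with
`θ(1) - θ(0) = arg γ(1) - arg γ(0) + 2πm`. For a loop this is the winding number (degree). -/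
def turning (γ : C(stdSimplex ℝ (Fin 2), Circle)) : ℤ := (exists_turning γ).choose

theorem turning_spec (γ : C(stdSimplex ℝ (Fin 2), Circle)) (θ : C(stdSimplex ℝ (Fin 2), ℝ))
    (h : ∀ x, Circle.exp (θ x) = γ x) :
    θ (stdSimplex.vertex 1) - θ (stdSimplex.vertex 0) =
      Complex.arg (γ (stdSimplex.vertex 1)) - Complex.arg (γ (stdSimplex.vertex 0)) +
        turning γ * (2 * Real.pi) :=
  (exists_turning γ).choose_spec θ h

/-- On loops, `turning` is the winding number. -/
theorem turning_loop (γ : C(stdSimplex ℝ (Fin 2), Circle)) (θ : C(stdSimplex ℝ (Fin 2), ℝ))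
    (h : ∀ x, Circle.exp (θ x) = γ x)
    (hγ : γ (stdSimplex.vertex 1) = γ (stdSimplex.vertex 0)) :
    θ (stdSimplex.vertex 1) - θ (stdSimplex.vertex 0) = turning γ * (2 * Real.pi) := by
  rw [turning_spec γ θ h, hγ]; ring

/-- The 1-cochain `s ↦ turning (f ∘ s)`; on a singular 1-simplex that is a loop its value is
the degree of `f ∘ s`. -/
def turningCochain (f : C(X, Circle)) : Cochain (singularSet X) R 1 := fun s =>
  ((turning (f.comp (simplexMap s)) : ℤ) : R)

theorem turningCochain_mem (f : C(X, Circle)) :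
    turningCochain R f ∈ cocycles (singularSet X) R 1 := by
  change coboundary (singularSet X) R 1 _ = 0
  funext s
  obtain ⟨Θ, hΘ⟩ := exists_lift (f.comp (simplexMap s))
  have h (i : Fin 3) := turning_spec (f.comp (simplexMap ((singularSet X).δ i s)))
    (Θ.comp ⟨stdSimplex.map i.succAbove, stdSimplex.continuous_map _⟩) fun x => hΘ _
  have h0 := h 0
  have h1 := h 1
  have h2 := h 2
  simp only [ContinuousMap.comp_apply, ContinuousMap.coe_mk, simplexMap_δ,
    stdSimplex.map_vertex] at h0 h1 h2
  have e00 : (0 : Fin 3).succAbove (0 : Fin 2) = 1 := rfl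
  have e01 : (0 : Fin 3).succAbove (1 : Fin 2) = 2 := rfl
  have e10 : (1 : Fin 3).succAbove (0 : Fin 2) = 0 := rfl
  have e11 : (1 : Fin 3).succAbove (1 : Fin 2) = 2 := rfl
  have e20 : (2 : Fin 3).succAbove (0 : Fin 2) = 0 := rfl
  have e21 : (2 : Fin 3).succAbove (1 : Fin 2) = 1 := rfl
  rw [e00, e01] at h0
  rw [e10, e11] at h1
  rw [e20, e21] at h2
  have key : (turning (f.comp (simplexMap ((singularSet X).δ 0 s))) : ℤ) -
      turning (f.comp (simplexMap ((singularSet X).δ 1 s))) +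
      turning (f.comp (simplexMap ((singularSet X).δ 2 s))) = 0 := by
    have hpi : (2 * Real.pi) ≠ 0 := by positivity
    have : ((turning (f.comp (simplexMap ((singularSet X).δ 0 s))) : ℝ) -
      turning (f.comp (simplexMap ((singularSet X).δ 1 s))) +
      turning (f.comp (simplexMap ((singularSet X).δ 2 s)))) * (2 * Real.pi) = 0 := by
      linarith
    exact_mod_cast (mul_eq_zero.1 this).resolve_right hpi
  rw [coboundary_apply, Fin.sum_univ_three]
  simp only [turningCochain, Fin.val_zero, pow_zero, Fin.val_one, pow_one, Fin.val_two, one_smul,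
    neg_smul, even_two, Even.neg_pow, one_pow]
  have := congrArg (Int.cast : ℤ → R) key
  push_cast at this
  rw [← sub_eq_add_neg]
  exact this

/-- The class in `H¹(X; R)` of a map `f` from `X` to the circle: the image under `ℤ → R` of the
class in `H¹(X; ℤ)` whose value on every loop `γ` is the degree of `f ∘ γ`, in other words the
class that corresponds to `f_* : π₁(X) → π₁(S¹) = ℤ`. -/
def turningClass (f : C(X, Circle)) : SingularCohomology X R 1 :=
  Cohomology.mk ⟨turningCochain R f, turningCochain_mem R f⟩

end sing

section red
variable {V : Type u} (L : PreAbstractSimplicialComplex V)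

/-- The simplices of `L`, among them the empty simplex of dimension `-1`. (Mathlib lists only the
non-empty ones as faces; points of `V` need not be vertices of `L`.) -/
def IsSimplex (s : Finset V) : Prop := s = ∅ ∨ s ∈ L

theorem IsSimplex.subset {L : PreAbstractSimplicialComplex V} {s t : Finset V}
    (hs : IsSimplex L s) (h : t ⊆ s) : IsSimplex L t := by
  rcases hs with rfl | hs
  · exact Or.inl (Finset.subset_empty.1 h)
  · rcases t.eq_empty_or_nonempty with ht | ht
    · exact Or.inl ht
    · exact Or.inr ((L.isRelLowerSet_faces hs).2 h ht)

open Classical in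
/-- The tuple `v` spans a simplex of `L`. -/
def Spans {n : ℕ} (v : Fin n → V) : Prop := IsSimplex L (Finset.univ.image v)

variable (R : Type w) [Ring R]

/-- Alternating functions of `n` vertices that vanish on tuples which do not span a simplex, i.e.
functions on oriented `(n-1)`-simplices that change sign with the orientation. -/
def alternatingCochains (n : ℕ) : Submodule R ((Fin n → V) → R) where
  carrier := {f | (∀ v : Fin n → V, ¬ Spans L v → f v = 0) ∧
    (∀ (v : Fin n → V) (i j : Fin n), i < j → v i = v j → f v = 0) ∧
    (∀ (v : Fin n → V) (i j : Fin n), (j : ℕ) = i + 1 → f (v ∘ Equiv.swap i j) = -f v)}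
  zero_mem' := ⟨fun _ _ => rfl, fun _ _ _ _ _ => rfl, fun _ _ _ _ => neg_zero.symm⟩
  add_mem' {f g} hf hg := by
    refine ⟨fun v h => ?_, fun v i j h h' => ?_, fun v i j h => ?_⟩
    · simp [hf.1 v h, hg.1 v h]
    · simp [hf.2.1 v i j h h', hg.2.1 v i j h h']
    · simp only [Pi.add_apply, hf.2.2 v i j h, hg.2.2 v i j h]; abel
  smul_mem' r f hf := by
    refine ⟨fun v h => ?_, fun v i j h h' => ?_, fun v i j h => ?_⟩
    · simp [hf.1 v h]
    · simp [hf.2.1 v i j h h']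
    · simp only [Pi.smul_apply, hf.2.2 v i j h, smul_neg]

open Classical in
/-- The simplicial coboundary
`(δ f)(v₀, …, vₙ) = ∑ i, (-1) ^ i f(v₀, …, vᵢ omitted, …, vₙ)` on tuples that span a simplex. -/
def rawCoboundary (n : ℕ) : ((Fin n → V) → R) →ₗ[R] ((Fin (n + 1) → V) → R) where
  toFun f v := if Spans L v then
    ∑ i : Fin (n + 1), ((-1 : ℤ) ^ (i : ℕ)) • f (v ∘ i.succAbove) else 0
  map_add' f g := by
    funext v
    by_cases h : Spans L v <;> simp [h, Finset.sum_add_distrib]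
  map_smul' r f := by
    funext v
    by_cases h : Spans L v
    · simp only [if_pos h, Pi.smul_apply, Finset.smul_sum, RingHom.id_apply]
      exact Finset.sum_congr rfl fun i _ => smul_comm _ _ _
    · simp [h]

variable {L R}

theorem swap_comp_succAbove {n : ℕ} {i j k : Fin (n + 1)} (hij : (j : ℕ) = i + 1)
    (hi : k ≠ i) (hj : k ≠ j) :
    ∃ i' j' : Fin n, (j' : ℕ) = i' + 1 ∧
      ∀ a, Equiv.swap i j (k.succAbove a) = k.succAbove (Equiv.swap i' j' a) := by
  obtain ⟨i', rfl⟩ := Fin.exists_succAbove_eq hi.symm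
  obtain ⟨j', rfl⟩ := Fin.exists_succAbove_eq hj.symm
  refine ⟨i', j', ?_, fun a => ?_⟩
  · simp only [Fin.succAbove, Fin.lt_def, Fin.val_castSucc] at hij
    split_ifs at hij <;> simp only [Fin.val_castSucc, Fin.val_succ] at hij <;> omega
  · exact (Fin.succAbove_right_injective.map_swap i' j' a).symm

theorem swap_comp_left {n : ℕ} {i j : Fin (n + 1)} (hij : (j : ℕ) = i + 1) (a : Fin n) :
    Equiv.swap i j (i.succAbove a) = j.succAbove a := by
  rcases lt_trichotomy (a : ℕ) i with h | h | h
  · rw [Fin.succAbove_of_castSucc_lt i a (by simpa [Fin.lt_def] using h),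
      Fin.succAbove_of_castSucc_lt j a (by simp [Fin.lt_def]; omega),
      Equiv.swap_apply_of_ne_of_ne] <;> simp [Fin.ext_iff] <;> omega
  · rw [Fin.succAbove_of_le_castSucc i a (by simp [Fin.le_def]; omega),
      Fin.succAbove_of_castSucc_lt j a (by simp [Fin.lt_def]; omega),
      show a.succ = j from Fin.ext (by simp; omega), Equiv.swap_apply_right]
    exact Fin.ext (by simp; omega)
  · rw [Fin.succAbove_of_le_castSucc i a (by simp [Fin.le_def]; omega),
      Fin.succAbove_of_le_castSucc j a (by simp [Fin.le_def]; omega),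
      Equiv.swap_apply_of_ne_of_ne] <;> simp [Fin.ext_iff] <;> omega

theorem swap_comp_right {n : ℕ} {i j : Fin (n + 1)} (hij : (j : ℕ) = i + 1) (a : Fin n) :
    Equiv.swap i j (j.succAbove a) = i.succAbove a := by
  rw [← swap_comp_left hij, Equiv.swap_apply_self]

theorem spans_comp_swap {n : ℕ} (v : Fin n → V) (i j : Fin n) :
    Spans L (v ∘ Equiv.swap i j) ↔ Spans L v := by
  classical
  have : Finset.univ.image (v ∘ Equiv.swap i j) = Finset.univ.image v := by
    ext x
    simp only [Finset.mem_image, Finset.mem_univ, true_and, Function.comp_apply]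
    exact ((Equiv.swap i j).surjective.exists (p := fun a => v a = x)).symm
  unfold Spans
  convert Iff.rfl using 2
  convert this.symm

open Classical in
theorem rawCoboundary_swap {n : ℕ} {f : (Fin n → V) → R} (hf : f ∈ alternatingCochains L R n)
    (v : Fin (n + 1) → V) (i j : Fin (n + 1)) (hij : (j : ℕ) = i + 1) :
    rawCoboundary L R n f (v ∘ Equiv.swap i j) = -rawCoboundary L R n f v := by
  have hne : i ≠ j := fun h => by rw [h] at hij; omega
  change (if Spans L (v ∘ Equiv.swap i j) then _ else 0) = -(if Spans L v then _ else 0)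
  by_cases h : Spans L v
  · rw [if_pos h, if_pos ((spans_comp_swap v i j).2 h), ← Equiv.sum_comp (Equiv.swap i j),
      ← Finset.sum_neg_distrib]
    refine Finset.sum_congr rfl fun k _ => ?_
    rcases eq_or_ne k i with rfl | hi
    · rw [Equiv.swap_apply_left, hij, Function.comp_assoc,
        show Equiv.swap k j ∘ j.succAbove = k.succAbove from funext (swap_comp_right hij), pow_succ]
      simp
    · rcases eq_or_ne k j with rfl | hj
      · rw [Equiv.swap_apply_right, hij, Function.comp_assoc,
          show Equiv.swap i k ∘ i.succAbove = k.succAbove from funext (swap_comp_left hij),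
          pow_succ]
        simp
      · rw [Equiv.swap_apply_of_ne_of_ne hi hj]
        obtain ⟨i', j', h', H⟩ := swap_comp_succAbove hij hi hj
        have : (v ∘ Equiv.swap i j) ∘ k.succAbove = (v ∘ k.succAbove) ∘ Equiv.swap i' j' :=
          funext fun a => congrArg v (H a)
        rw [this, hf.2.2 _ _ _ h', smul_neg]
  · rw [if_neg h, if_neg (fun h' => h ((spans_comp_swap v i j).1 h')), neg_zero]

open Classical in
theorem rawCoboundary_adjacent {n : ℕ} {f : (Fin n → V) → R} (hf : f ∈ alternatingCochains L R n)
    (v : Fin (n + 1) → V) (i j : Fin (n + 1)) (hij : (j : ℕ) = i + 1) (hv : v i = v j) :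
    rawCoboundary L R n f v = 0 := by
  have hne : i ≠ j := fun h => by rw [h] at hij; omega
  change (if Spans L v then _ else 0) = (0 : R)
  split_ifs
  · have h0 : ∀ k : Fin (n + 1), k ≠ i ∧ k ≠ j →
        ((-1 : ℤ) ^ (k : ℕ)) • f (v ∘ k.succAbove) = 0 := by
      rintro k ⟨hi, hj⟩
      obtain ⟨a, ha⟩ := Fin.exists_succAbove_eq hi.symm
      obtain ⟨b, hb⟩ := Fin.exists_succAbove_eq hj.symm
      have hab : a < b := by
        rw [← (Fin.strictMono_succAbove k).lt_iff_lt, ha, hb, Fin.lt_def]; omega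
      rw [hf.2.1 _ a b hab (by simp [ha, hb, hv]), smul_zero]
    rw [Fintype.sum_eq_add i j hne h0]
    have : v ∘ j.succAbove = v ∘ i.succAbove := by
      funext a
      have hs : ∀ b, v (Equiv.swap i j b) = v b := by
        intro b
        rcases eq_or_ne b i with rfl | hi
        · rw [Equiv.swap_apply_left, hv]
        · rcases eq_or_ne b j with rfl | hj
          · rw [Equiv.swap_apply_right, hv]
          · rw [Equiv.swap_apply_of_ne_of_ne hi hj]
      change v _ = v _
      rw [← swap_comp_left hij, hs]
    rw [this, hij, pow_succ]
    simp
  · rfl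

theorem rawCoboundary_repeat {n : ℕ} {f : (Fin n → V) → R} (hf : f ∈ alternatingCochains L R n)
    (d : ℕ) : ∀ (v : Fin (n + 1) → V) (i j : Fin (n + 1)), (j : ℕ) = i + d + 1 → v i = v j →
      rawCoboundary L R n f v = 0 := by
  induction d with
  | zero => exact fun v i j h hv => rawCoboundary_adjacent hf v i j (by omega) hv
  | succ d ih =>
    intro v i j h hv
    let k : Fin (n + 1) := ⟨j - 1, by omega⟩
    have hk : (j : ℕ) = k + 1 := by simp only [k]; omega
    have hik : i ≠ k := fun e => by
      have := congrArg Fin.val e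
      omega
    have hij : i ≠ j := fun e => by
      have := congrArg Fin.val e
      omega
    have h1 := rawCoboundary_swap hf v k j hk
    rw [ih (v ∘ Equiv.swap k j) i k (by omega)
      (by simp [Equiv.swap_apply_of_ne_of_ne hik hij, hv])] at h1
    exact neg_eq_zero.1 h1.symm

open Classical in
theorem rawCoboundary_mem {n : ℕ} {f : (Fin n → V) → R} (hf : f ∈ alternatingCochains L R n) :
    rawCoboundary L R n f ∈ alternatingCochains L R (n + 1) := by
  refine ⟨fun v h => if_neg h, fun v i j h hv => ?_, rawCoboundary_swap hf⟩
  exact rawCoboundary_repeat hf (j - i - 1) v i j (by have := Fin.lt_def.1 h; omega) hv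

variable (L R)

/-- The augmented simplicial cochains `C₊^(n-1)(L; R)`: the index `n` is the number of vertices,
one more than the dimension, so `n = 0` is the augmentation degree `-1`. -/
def SimplicialCochain (n : ℕ) : Type (max u w) := alternatingCochains L R n

instance (n : ℕ) : AddCommGroup (SimplicialCochain L R n) :=
  inferInstanceAs (AddCommGroup (alternatingCochains L R n))

instance (n : ℕ) : Module R (SimplicialCochain L R n) :=
  inferInstanceAs (Module R (alternatingCochains L R n))

/-- The coboundary `C₊^(n-1)(L; R) → C₊^n(L; R)`. -/
def simplicialCoboundary (n : ℕ) : SimplicialCochain L R n →ₗ[R] SimplicialCochain L R (n + 1) :=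
  (rawCoboundary L R n).restrict (p := alternatingCochains L R n)
    (q := alternatingCochains L R (n + 1)) fun _ hf => rawCoboundary_mem hf

/-- Cocycles in `C₊^(n-1)(L; R)`. -/
def simplicialCocycles (n : ℕ) : Submodule R (SimplicialCochain L R n) :=
  LinearMap.ker (simplicialCoboundary L R n)

/-- Coboundaries in `C₊^(n-1)(L; R)`. -/
def simplicialCoboundaries (n : ℕ) : Submodule R (SimplicialCochain L R n) :=
  match n with
  | 0 => ⊥
  | n + 1 => LinearMap.range (simplicialCoboundary L R n)

/-- The reduced cohomology of `L` in degree `n - 1`. -/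
def ReducedCohomology (n : ℕ) : Type (max u w) :=
  simplicialCocycles L R n ⧸ (simplicialCoboundaries L R n).submoduleOf (simplicialCocycles L R n)

instance (n : ℕ) : AddCommGroup (ReducedCohomology L R n) :=
  inferInstanceAs (AddCommGroup (_ ⧸
    (simplicialCoboundaries L R n).submoduleOf (simplicialCocycles L R n)))

instance (n : ℕ) : Module R (ReducedCohomology L R n) :=
  inferInstanceAs (Module R (_ ⧸
    (simplicialCoboundaries L R n).submoduleOf (simplicialCocycles L R n)))

/-- `L` is `R`-acyclic: its reduced cohomology with coefficients in `R` vanishes in all degrees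
`≥ -1`. -/
def IsAcyclic : Prop := ∀ n, Subsingleton (ReducedCohomology L R n)

end red

section torus
variable {V : Type u} (L : PreAbstractSimplicialComplex V)

/-- The space `T_L`, the union of the tori `T(σ)` over the simplices `σ` of `L`, inside the
direct sum of circles indexed by `V`. -/
def TorusComplex : Type u :=
  {t : V → Circle // ∃ s : Finset V, IsSimplex L s ∧ ∀ v ∉ s, t v = 1}

open Classical in
/-- The inclusion of the torus `T(σ)` in `T_L`. -/
def TorusComplex.ofTorus (s : {s : Finset V // IsSimplex L s}) (x : s.1 → Circle) :
    TorusComplex L :=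
  ⟨fun v => if h : v ∈ s.1 then x ⟨v, h⟩ else 1, s.1, s.2, fun _ hv => dif_neg hv⟩

/-- The CW topology: a set is open iff its trace on each finite torus `T(σ)` is open. -/
instance : TopologicalSpace (TorusComplex L) :=
  ⨆ s : {s : Finset V // IsSimplex L s},
    TopologicalSpace.coinduced (TorusComplex.ofTorus L s) inferInstance

/-- The map `μ_L`, product of the coordinates. -/
def mu : C(TorusComplex L, Circle) where
  toFun t := ∏ᶠ v, t.1 v
  continuous_toFun := by
    refine continuous_iSup_dom.2 fun s => continuous_coinduced_dom.2 ?_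
    have h : ((fun t : TorusComplex L => ∏ᶠ v, t.1 v) ∘ TorusComplex.ofTorus L s) =
        fun x : s.1 → Circle => ∏ v : s.1, x v := by
      funext x
      change ∏ᶠ v, (TorusComplex.ofTorus L s x).1 v = _
      rw [finprod_eq_prod_of_mulSupport_subset (s := s.1)]
      · rw [← Finset.prod_coe_sort]
        exact Finset.prod_congr rfl fun v _ => dif_pos v.2
      · intro v hv
        by_contra hv'
        exact hv (dif_neg hv')
    rw [h]
    fun_prop

/-- The infinite cyclic cover of `T_L`: pull-back along `μ_L` of the universal cover
`ℝ → S¹`, `θ ↦ exp(iθ)`. -/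
def CyclicCover : Type u := {p : TorusComplex L × ℝ // mu L p.1 = Circle.exp p.2}

instance : TopologicalSpace (CyclicCover L) :=
  inferInstanceAs (TopologicalSpace {p : TorusComplex L × ℝ // mu L p.1 = Circle.exp p.2})

/-- The covering projection to `T_L`. -/
def coverProj : C(CyclicCover L, TorusComplex L) where
  toFun p := p.1.1
  continuous_toFun := continuous_fst.comp continuous_subtype_val

/-- The action of `k ∈ ℤ` by deck transformations. -/
def deck (k : ℤ) : C(CyclicCover L, CyclicCover L) where
  toFun p := ⟨(p.1.1, p.1.2 + k * (2 * Real.pi)),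
    p.2.trans (Circle.exp_eq_exp.2 ⟨-k, by push_cast; ring⟩)⟩
  continuous_toFun := by
    refine Continuous.subtype_mk ?_ _
    exact (continuous_fst.comp continuous_subtype_val).prodMk
      ((continuous_snd.comp continuous_subtype_val).add continuous_const)

variable (R : Type w) [Ring R]

/-- The subring of elements of the cohomology ring of the cover fixed by all deck transformations. -/
def fixedSubring : Subring (SingularCohomologyRing (CyclicCover L) R) where
  carrier := {x | ∀ k : ℤ, pullbackRing R (deck L k) x = x}
  mul_mem' ha hb k := by rw [map_mul, ha k, hb k]
  one_mem' k := map_one _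
  add_mem' ha hb k := by rw [map_add, ha k, hb k]
  zero_mem' k := map_zero _
  neg_mem' ha k := by rw [map_neg, ha k]

/-- The class `β_L ∈ H¹(T_L; R)` that corresponds to `μ_L`, as an element of the ring. -/
def beta : SingularCohomologyRing (TorusComplex L) R :=
  DirectSum.of (SingularCohomology (TorusComplex L) R) 1 (turningClass R (mu L))



end torus

end

end TorusCover

/-!
Write `Y` for the infinite cyclic cover of `T_L` and `t` for the generator of its deck group. The
idea is that `Y` has a simple cubical model. The preimage of `T_L` in `⨁ ℝ` is a union of flats, the
lattice translates of the coordinate subspaces `ℝ^σ`, and it is cubulated by unit cubes. Points of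
it are taken together with a height, which is the sum of the coordinates up to an integer; dividing
by the lattice, which leaves the height fixed, gives `Y`. In `Y` there is one cube for each pair of
an integer height and a simplex of `L`, and opposite faces of a cube differ only by a shift of the
height by one.
Hence the cubical cochains of degree `n` on `Y` are sequences `d : ℤ → C₊^(n-1)(L; R)`, the
coboundary of `d` is `δ (d (k + 1) - d k)`, up to the identification of simplices, and `t` acts by
the shift. Taking the classes of the jumps `d (k + 1) - d k` of a cocycle gives a map
`kappa : Hⁿ(Y) → ∏_ℤ H̄ⁿ⁻¹(L)`.

* `kappa` is surjective, since every sequence of cocycles on `L` is the sequence of jumps of its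
  sums (`kappa_surjective`). If the jumps of `f` are coboundaries then `t f - f`, whose slices they
  are, is a coboundary of cubical cochains (`deck_eq_of_kappa_eq_zero`), and invariant cocycles have
  no jumps (`kappa_eq_zero_of_invariant`).
* The group `ℤ` acts freely on the singular simplices of `Y` with those of `T_L` as quotient.
  So `t - 1` is surjective on singular cochains, with the cochains of `T_L` as kernel, and classes
  fixed by `t` come from `T_L` (`exists_pullback_eq`). Hence the image of `π^*` consists of the fixed
  classes and is the kernel of `kappa` (`exists_kappa`). This proves the statements on the image and
  on the cokernel.
* The class `β` pulls back to the coboundary of the integer part `τ` of the height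
  (`coboundary_levelCochain`), and `t τ = τ + 1`. Sequences are differences of sequences, so
  `H^*(Y)` is the sum of the image of `π^*` and the image of `t - 1` (`exists_eq_pullback_add`).
  Therefore a primitive `e` of `π^* c` can be chosen with `t e - e = π^* b`, for a cocycle `b`. Then
  `e - τ ∪ π^* b` is invariant, and `c - β ∪ b` is a coboundary (`exists_cup_eq`). So the
  kernel of `π^*` is the ideal of `β` (`span_beta_eq_ker`).

To compare singular and cubical cochains no cellular homology is needed. Singular simplices of the
universal abelian cover that lie in one flat, and lattice cubes, both form free complexes on which
the group of translations acts freely, and both are carried by the flats: in each flat they are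
acyclic, by a cone (`Lift.exists_flat_filling`) or by pushing in one direction after the other
(`Cube.exists_filling`). The equivariant form of the method of acyclic carriers
(`CarriedComplex.exists_carriedMap`, `CarriedMap.exists_homotopy`) makes them equivalent for
cochains invariant under the lattice. It remains to see that the singular cochains of `Y` that vanish
on the simplices over a single torus `T(σ)` form an acyclic complex (`exists_cob_of_vanish`). The
cover has open sets that a deformation of `Y` moves into the preimages of the tori (`deform`), and the
deformation, combined with barycentric subdivision, makes singular chains small.
-/

namespace TorusCover

noncomputable section

open CategoryTheory Simplicial Opposite DirectSum

/-! ### Based chain complexes and acyclic carriers -/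

/-- An alternating double sum over the faces of faces vanishes, given the simplicial identities. -/
theorem alternating_double_sum {M : Type*} [AddCommGroup M] {n : ℕ}
    (F : Fin (n + 2) → Fin (n + 1) → M)
    (hF : ∀ i j : Fin (n + 1), i ≤ j → F j.succ i = F i.castSucc j) :
    ∑ i : Fin (n + 2), ∑ j : Fin (n + 1), ((-1 : ℤ) ^ (i : ℕ)) • ((-1 : ℤ) ^ (j : ℕ)) • F i j
      = 0 := by
  rw [← Fintype.sum_prod_type'
    (f := fun (i : Fin (n + 2)) (j : Fin (n + 1)) =>
      ((-1 : ℤ) ^ (i : ℕ)) • ((-1 : ℤ) ^ (j : ℕ)) • F i j)]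
  let S : Finset (Fin (n + 2) × Fin (n + 1)) := {p | (p.1 : ℕ) ≤ p.2}
  rw [← Finset.sum_add_sum_compl S, ← eq_neg_iff_add_eq_zero, ← Finset.sum_neg_distrib]
  refine Finset.sum_bij (fun (p : Fin (n + 2) × Fin (n + 1)) (hp : p ∈ S) =>
      (p.2.succ, p.1.castLT
        (lt_of_le_of_lt (Finset.mem_filter.1 hp).2 p.2.isLt))) ?_ ?_ ?_ ?_
  · rintro ⟨i, j⟩ hp
    have : (i : ℕ) ≤ j := (Finset.mem_filter.1 hp).2
    simp only [S, Finset.compl_filter, Finset.mem_filter, Finset.mem_univ, true_and, Fin.val_succ,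
      Fin.val_castLT]
    omega
  · rintro ⟨i, j⟩ hp ⟨i', j'⟩ hp' h
    simp only [Prod.mk.injEq, Fin.ext_iff, Fin.val_castLT, Fin.val_succ, add_left_inj] at h ⊢
    exact ⟨h.2, h.1⟩
  · rintro ⟨i, j⟩ hp
    have hij : (j : ℕ) < i := by
      simpa [S] using hp
    refine ⟨(j.castSucc, i.pred fun h => by rw [h] at hij; simp at hij), ?_, ?_⟩
    · simp only [S, Finset.mem_filter, Finset.mem_univ, true_and, Fin.val_castSucc, Fin.val_pred]
      omega
    · simp
  · rintro ⟨i, j⟩ hp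
    have hij : (i : ℕ) ≤ j := (Finset.mem_filter.1 hp).2
    have := hF (i.castLT (lt_of_le_of_lt hij j.isLt)) j (by simpa [Fin.le_def] using hij)
    simp only [Fin.castSucc_castLT] at this
    simp only [this, Fin.val_succ, Fin.val_castLT, smul_smul, ← neg_smul]
    congr 1
    ring

/-- A non-negative chain complex of free abelian groups with chosen bases `B n`, augmented by
sending each element of `B 0` to `1`. -/
structure BasedComplex where
  /-- The basis in degree `n`. -/
  B : ℕ → Type u
  /-- The boundary of a basis element. -/
  bd : ∀ n, B (n + 1) → (B n →₀ ℤ)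
  bd_bd : ∀ n b, Finsupp.linearCombination ℤ (bd n) (bd (n + 1) b) = 0
  aug_bd : ∀ b, Finsupp.linearCombination ℤ (fun _ => (1 : ℤ)) (bd 0 b) = 0

namespace BasedComplex

/-- The boundary operator. -/
abbrev d (A : BasedComplex.{u}) (n : ℕ) : (A.B (n + 1) →₀ ℤ) →ₗ[ℤ] (A.B n →₀ ℤ) :=
  Finsupp.linearCombination ℤ (A.bd n)

/-- The augmentation. -/
abbrev aug (A : BasedComplex.{u}) : (A.B 0 →₀ ℤ) →ₗ[ℤ] ℤ :=
  Finsupp.linearCombination ℤ (fun _ => (1 : ℤ))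

/-- Cycles of the augmented complex. -/
def IsCycle (A : BasedComplex.{u}) (n : ℕ) (z : A.B n →₀ ℤ) : Prop :=
  match n, z with
  | 0, z => A.aug z = 0
  | n + 1, z => A.d n z = 0

theorem d_d (A : BasedComplex.{u}) (n : ℕ) (z : A.B (n + 2) →₀ ℤ) : A.d n (A.d (n + 1) z) = 0 := by
  induction z using Finsupp.induction_linear with
  | zero => simp
  | add x y hx hy => rw [map_add, map_add, hx, hy, add_zero]
  | single b c => simp [A.bd_bd]

theorem aug_d (A : BasedComplex.{u}) (z : A.B 1 →₀ ℤ) : A.aug (A.d 0 z) = 0 := by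
  induction z using Finsupp.induction_linear with
  | zero => simp
  | add x y hx hy => rw [map_add, map_add, hx, hy, add_zero]
  | single b c => simp [A.aug_bd]

theorem isCycle_d (A : BasedComplex.{u}) (n : ℕ) (z : A.B (n + 1) →₀ ℤ) :
    A.IsCycle n (A.d n z) := by
  cases n with
  | zero => exact A.aug_d z
  | succ n => exact A.d_d n z

end BasedComplex

/-- A family of sequences built one step at a time. -/
theorem exists_dependent_seq {F : ℕ → Type*} (P : ∀ n, F n → Prop)
    (Q : ∀ n, F n → F (n + 1) → Prop) (h0 : ∃ f, P 0 f)
    (hs : ∀ n f, P n f → ∃ f', P (n + 1) f' ∧ Q n f f') :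
    ∃ f : ∀ n, F n, ∀ n, P n (f n) ∧ Q n (f n) (f (n + 1)) := by
  choose s hs using hs
  let f : ∀ n, {x : F n // P n x} := fun n =>
    Nat.rec ⟨h0.choose, h0.choose_spec⟩ (fun n x => ⟨s n x.1 x.2, (hs n x.1 x.2).1⟩) n
  exact ⟨fun n => (f n).1, fun n => ⟨(f n).2, (hs n _ (f n).2).2⟩⟩

theorem linearCombination_mem_of_support {α M : Type*} [AddCommGroup M] (f : α → M)
    (z : α →₀ ℤ) (N : Submodule ℤ M) (h : ∀ a ∈ z.support, f a ∈ N) :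
    Finsupp.linearCombination ℤ f z ∈ N := by
  rw [Finsupp.linearCombination_apply]
  exact Submodule.sum_mem _ fun a ha => N.smul_mem _ (h a ha)

theorem linearCombination_congr {α M : Type*} [AddCommGroup M] {f g : α → M}
    (z : α →₀ ℤ) (h : ∀ a ∈ z.support, f a = g a) :
    Finsupp.linearCombination ℤ f z = Finsupp.linearCombination ℤ g z := by
  rw [Finsupp.linearCombination_apply, Finsupp.linearCombination_apply]
  exact Finset.sum_congr rfl fun a ha => congrArg _ (h a ha)

/-- Linear maps that agree on the basis agree. -/
theorem linearMap_eq_linearCombination {α M : Type*} [AddCommGroup M]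
    (φ : (α →₀ ℤ) →ₗ[ℤ] M) (f : α → M) (h : ∀ a, φ (Finsupp.single a 1) = f a) (z : α →₀ ℤ) :
    φ z = Finsupp.linearCombination ℤ f z := by
  induction z using Finsupp.induction_linear with
  | zero => simp
  | add x y hx hy => rw [map_add, map_add, hx, hy]
  | single b c =>
    rw [Finsupp.linearCombination_single, ← h, ← map_smul, Finsupp.smul_single, smul_eq_mul,
      mul_one]

/-- A based complex with a free action of `G` on its bases and a system of carriers: each `F : Λ`
carries some of the basis elements, which span an acyclic subcomplex, and each basis element has a
least carrier `fl b`. Freeness is recorded by an equivariant map `gr` to `G`. -/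
structure CarriedComplex (G : Type*) [AddGroup G] (Λ : Type*) [Preorder Λ] [AddAction G Λ] extends
    BasedComplex.{u} where
  act : ∀ n, AddAction G (B n)
  bd_vadd : ∀ n (g : G) (b : B (n + 1)), bd n (g +ᵥ b) = Finsupp.mapDomain (g +ᵥ ·) (bd n b)
  gr : ∀ {n}, B n → G
  gr_vadd : ∀ {n} (g : G) (b : B n), gr (g +ᵥ b) = g + gr b
  /-- `Mem F b`: the basis element `b` is carried by `F`. -/
  Mem : Λ → ∀ {n}, B n → Prop
  mem_mono : ∀ {F F' : Λ} {n} {b : B n}, F ≤ F' → Mem F b → Mem F' b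
  mem_vadd : ∀ {F : Λ} {n} {b : B n} (g : G), Mem F b → Mem (g +ᵥ F) (g +ᵥ b)
  fl : ∀ {n}, B n → Λ
  mem_fl : ∀ {n} (b : B n), Mem (fl b) b
  fl_le : ∀ {F : Λ} {n} {b : B n}, Mem F b → fl b ≤ F
  mem_bd : ∀ {F : Λ} {n} {b : B (n + 1)}, Mem F b → ∀ b' ∈ (bd n b).support, Mem F b'
  nonempty : ∀ F : Λ, ∃ b : B 0, Mem F b
  acyclic : ∀ (F : Λ) (n : ℕ) (z : B n →₀ ℤ), z ∈ Finsupp.supported ℤ ℤ {b | Mem F b} →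
    toBasedComplex.IsCycle n z →
      ∃ y ∈ Finsupp.supported ℤ ℤ {b | Mem F b}, toBasedComplex.d n y = z

attribute [instance] CarriedComplex.act

namespace CarriedComplex

variable {G : Type*} [AddGroup G] {Λ : Type*} [Preorder Λ] [AddAction G Λ]

/-- The chains carried by `F`. -/
def chainsIn (C : CarriedComplex.{u} G Λ) (F : Λ) (n : ℕ) : Submodule ℤ (C.B n →₀ ℤ) :=
  Finsupp.supported ℤ ℤ {b | C.Mem F b}

/-- The action of `G` on chains. -/
abbrev vaddChain (C : CarriedComplex.{u} G Λ) (g : G) (n : ℕ) : (C.B n →₀ ℤ) →ₗ[ℤ] (C.B n →₀ ℤ) :=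
  Finsupp.lmapDomain ℤ ℤ (g +ᵥ ·)

variable (A C : CarriedComplex.{u} G Λ)

theorem chainsIn_mono {F F' : Λ} (h : F ≤ F') (n : ℕ) : C.chainsIn F n ≤ C.chainsIn F' n :=
  Finsupp.supported_mono fun _ hb => C.mem_mono h hb

theorem single_mem_chainsIn {F : Λ} {n : ℕ} {b : C.B n} (h : C.Mem F b) (c : ℤ) :
    Finsupp.single b c ∈ C.chainsIn F n :=
  Finsupp.single_mem_supported ℤ c h

theorem linearCombination_mem_chainsIn {α : Type*} {F : Λ} {n : ℕ} (f : α → (C.B n →₀ ℤ))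
    (z : α →₀ ℤ) (h : ∀ a ∈ z.support, f a ∈ C.chainsIn F n) :
    Finsupp.linearCombination ℤ f z ∈ C.chainsIn F n :=
  linearCombination_mem_of_support f z _ h

theorem vaddChain_mem {F : Λ} {n : ℕ} {z : C.B n →₀ ℤ} (g : G) (h : z ∈ C.chainsIn F n) :
    C.vaddChain g n z ∈ C.chainsIn (g +ᵥ F) n := by
  rw [linearMap_eq_linearCombination (C.vaddChain g n) (fun b => Finsupp.single (g +ᵥ b) 1)
    (by simp)]
  refine C.linearCombination_mem_chainsIn _ _ fun a ha => C.single_mem_chainsIn ?_ _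
  exact C.mem_vadd g ((Finsupp.mem_supported ℤ z).1 h ha)

theorem vaddChain_add (g g' : G) (n : ℕ) (z : C.B n →₀ ℤ) :
    C.vaddChain (g + g') n z = C.vaddChain g n (C.vaddChain g' n z) := by
  induction z using Finsupp.induction_linear with
  | zero => simp
  | add x y hx hy => simp only [map_add, hx, hy]
  | single b c => simp [add_vadd]

theorem d_vaddChain (g : G) (n : ℕ) (z : C.B (n + 1) →₀ ℤ) :
    C.d n (C.vaddChain g (n + 1) z) = C.vaddChain g n (C.d n z) := by
  induction z using Finsupp.induction_linear with
  | zero => simp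
  | add x y hx hy => simp only [map_add, hx, hy]
  | single b c => simp [C.bd_vadd]

theorem aug_vaddChain (g : G) (z : C.B 0 →₀ ℤ) : C.aug (C.vaddChain g 0 z) = C.aug z := by
  induction z using Finsupp.induction_linear with
  | zero => simp
  | add x y hx hy => simp only [map_add, hx, hy]
  | single b c => simp

/-- Carriers of a basis element translate with it. -/
theorem vaddChain_mem_fl {n k : ℕ} (b : A.B n) {z : C.B k →₀ ℤ} (g : G)
    (h : z ∈ C.chainsIn (A.fl b) k) : C.vaddChain g k z ∈ C.chainsIn (A.fl (g +ᵥ b)) k := by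
  have h1 : A.fl b ≤ -g +ᵥ A.fl (g +ᵥ b) :=
    A.fl_le (by simpa using A.mem_vadd (-g) (A.mem_fl (g +ᵥ b)))
  simpa using C.vaddChain_mem g (C.chainsIn_mono h1 k h)

/-- Equivariant choice on a free `G`-set. -/
theorem exists_equivariant {n k : ℕ} (P : A.B n → (C.B k →₀ ℤ) → Prop)
    (hP : ∀ b z (g : G), P b z → P (g +ᵥ b) (C.vaddChain g k z)) (h : ∀ b, ∃ z, P b z) :
    ∃ f : A.B n → (C.B k →₀ ℤ), (∀ g b, f (g +ᵥ b) = C.vaddChain g k (f b)) ∧ ∀ b, P b (f b) := by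
  choose f hf using h
  refine ⟨fun b => C.vaddChain (A.gr b) k (f (-A.gr b +ᵥ b)), fun g b => ?_, fun b => ?_⟩
  · simp only [A.gr_vadd, ← vaddChain_add]
    congr 2
    simp only [neg_add_rev, add_vadd, neg_vadd_vadd]
  · simpa using hP _ _ (A.gr b) (hf (-A.gr b +ᵥ b))

theorem linearCombination_vadd {n k : ℕ} {f : A.B n → (C.B k →₀ ℤ)}
    (hf : ∀ g b, f (g +ᵥ b) = C.vaddChain g k (f b)) (g : G) (z : A.B n →₀ ℤ) :
    Finsupp.linearCombination ℤ f (A.vaddChain g n z) =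
      C.vaddChain g k (Finsupp.linearCombination ℤ f z) := by
  induction z using Finsupp.induction_linear with
  | zero => simp
  | add x y hx hy => simp only [map_add, hx, hy]
  | single b c =>
    rw [Finsupp.lmapDomain_apply, Finsupp.mapDomain_single, Finsupp.linearCombination_single,
      Finsupp.linearCombination_single, hf, map_smul]

/-- An equivariant augmentation-preserving chain map that respects carriers. -/
structure CarriedMap where
  f : ∀ n, A.B n → (C.B n →₀ ℤ)
  equivariant : ∀ n g b, f n (g +ᵥ b) = C.vaddChain g n (f n b)
  carried : ∀ n b, f n b ∈ C.chainsIn (A.fl b) n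
  aug : ∀ b, C.aug (f 0 b) = 1
  comm : ∀ n b, C.d n (f (n + 1) b) = Finsupp.linearCombination ℤ (f n) (A.bd n b)

variable {A C}

theorem mem_chainsIn_of_bd {n k : ℕ} {f : A.B n → (C.B k →₀ ℤ)}
    (hf : ∀ b, f b ∈ C.chainsIn (A.fl b) k) (b : A.B (n + 1)) :
    Finsupp.linearCombination ℤ f (A.bd n b) ∈ C.chainsIn (A.fl b) k :=
  C.linearCombination_mem_chainsIn _ _ fun b' hb' =>
    C.chainsIn_mono (A.fl_le (A.mem_bd (A.mem_fl b) b' hb')) k (hf b')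

variable (A C)

/-- Carried maps exist, by induction over the degree. -/
theorem exists_carriedMap : Nonempty (CarriedMap A C) := by
  -- `P` also records that the value on each boundary is a cycle, so that it can be filled
  -- inside the carrier; `Q` says that the extension is a chain map
  let P : ∀ n, (A.B n → (C.B n →₀ ℤ)) → Prop := fun n f =>
    (∀ g b, f (g +ᵥ b) = C.vaddChain g n (f b)) ∧ (∀ b, f b ∈ C.chainsIn (A.fl b) n) ∧
      (∀ b, C.IsCycle n (Finsupp.linearCombination ℤ f (A.bd n b))) ∧
        (∀ (h : n = 0) b, C.aug (h ▸ f b) = 1)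
  let Q : ∀ n, (A.B n → (C.B n →₀ ℤ)) → (A.B (n + 1) → (C.B (n + 1) →₀ ℤ)) → Prop :=
    fun n f f' => ∀ b, C.d n (f' b) = Finsupp.linearCombination ℤ f (A.bd n b)
  have h0 : ∃ f, P 0 f := by
    obtain ⟨f, h1, h2⟩ := exists_equivariant A C (n := 0) (k := 0)
      (fun b z => z ∈ C.chainsIn (A.fl b) 0 ∧ C.aug z = 1)
      (fun b z g h => ⟨vaddChain_mem_fl A C b g h.1, (aug_vaddChain C g z).trans h.2⟩)
      (fun b => by
        obtain ⟨c, hc⟩ := C.nonempty (A.fl b)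
        exact ⟨Finsupp.single c 1, C.single_mem_chainsIn hc 1, by simp⟩)
    refine ⟨f, h1, fun b => (h2 b).1, fun b => ?_, fun _ b => (h2 b).2⟩
    change C.aug _ = 0
    rw [← A.aug_bd b]
    generalize A.bd 0 b = z
    exact linearMap_eq_linearCombination (C.aug ∘ₗ Finsupp.linearCombination ℤ f) _
      (by simp [(h2 _).2]) z
  have hs : ∀ n f, P n f → ∃ f', P (n + 1) f' ∧ Q n f f' := by
    rintro n f ⟨h1, h2, h3, -⟩
    obtain ⟨f', h4, h5⟩ := exists_equivariant A C (n := n + 1) (k := n + 1)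
      (fun b z => z ∈ C.chainsIn (A.fl b) (n + 1) ∧
        C.d n z = Finsupp.linearCombination ℤ f (A.bd n b))
      (fun b z g h => ⟨vaddChain_mem_fl A C b g h.1, by
        rw [d_vaddChain, h.2, A.bd_vadd, ← linearCombination_vadd A C h1]; rfl⟩)
      (fun b => C.acyclic (A.fl b) n _ (mem_chainsIn_of_bd h2 b) (h3 b))
    refine ⟨f', ⟨h4, fun b => (h5 b).1, fun b => ?_, fun h => by omega⟩, fun b => (h5 b).2⟩
    change C.d n _ = 0
    have : ∀ z, C.d n (Finsupp.linearCombination ℤ f' z) =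
        Finsupp.linearCombination ℤ f (A.d n z) := fun z => by
      rw [← LinearMap.comp_apply, ← LinearMap.comp_apply,
        linearMap_eq_linearCombination _ (fun b => Finsupp.linearCombination ℤ f (A.bd n b))
          (by simp [(h5 _).2])]
      exact (linearMap_eq_linearCombination _ _ (by simp) z).symm
    rw [this, A.bd_bd, map_zero]
  obtain ⟨f, hf⟩ := exists_dependent_seq P Q h0 hs
  exact ⟨⟨f, fun n => (hf n).1.1, fun n => (hf n).1.2.1, fun b => (hf 0).1.2.2.2 rfl b,
    fun n => (hf n).2⟩⟩

variable {A C}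

/-- Two carried maps are equivariantly chain homotopic. -/
theorem CarriedMap.exists_homotopy (φ ψ : CarriedMap A C) :
    ∃ h : ∀ n, A.B n → (C.B (n + 1) →₀ ℤ),
      (∀ n g b, h n (g +ᵥ b) = C.vaddChain g (n + 1) (h n b)) ∧
      (∀ b, C.d 0 (h 0 b) = φ.f 0 b - ψ.f 0 b) ∧
      ∀ n b, C.d (n + 1) (h (n + 1) b) + Finsupp.linearCombination ℤ (h n) (A.bd n b) =
        φ.f (n + 1) b - ψ.f (n + 1) b := by
  -- `P` also records that `φ - ψ - h ∂` has cycles as values in the next degree, so that these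
  -- can be filled inside the carriers; `Q` is the homotopy formula
  let P : ∀ n, (A.B n → (C.B (n + 1) →₀ ℤ)) → Prop := fun n h =>
    (∀ g b, h (g +ᵥ b) = C.vaddChain g (n + 1) (h b)) ∧
      (∀ b, h b ∈ C.chainsIn (A.fl b) (n + 1)) ∧
      (∀ b, C.d n (Finsupp.linearCombination ℤ h (A.bd n b)) =
        C.d n (φ.f (n + 1) b - ψ.f (n + 1) b)) ∧
      (∀ (e : n = 0) (b : A.B 0), C.d 0 (by subst e; exact h b) = φ.f 0 b - ψ.f 0 b)
  let Q : ∀ n, (A.B n → (C.B (n + 1) →₀ ℤ)) → (A.B (n + 1) → (C.B (n + 2) →₀ ℤ)) → Prop :=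
    fun n h h' => ∀ b, C.d (n + 1) (h' b) + Finsupp.linearCombination ℤ h (A.bd n b) =
      φ.f (n + 1) b - ψ.f (n + 1) b
  have lc : ∀ n (z : A.B n →₀ ℤ), Finsupp.linearCombination ℤ (fun b => φ.f n b - ψ.f n b) z =
      Finsupp.linearCombination ℤ (φ.f n) z - Finsupp.linearCombination ℤ (ψ.f n) z := fun n z =>
    (linearMap_eq_linearCombination
      (Finsupp.linearCombination ℤ (φ.f n) - Finsupp.linearCombination ℤ (ψ.f n)) _
      (by simp) z).symm
  have h0 : ∃ f, P 0 f := by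
    obtain ⟨h, h1, h2⟩ := exists_equivariant A C (n := 0) (k := 1)
      (fun b z => z ∈ C.chainsIn (A.fl b) 1 ∧ C.d 0 z = φ.f 0 b - ψ.f 0 b)
      (fun b z g h => ⟨vaddChain_mem_fl A C b g h.1, by
        rw [d_vaddChain, h.2, φ.equivariant, ψ.equivariant, map_sub]⟩)
      (fun b => C.acyclic (A.fl b) 0 _
        (Submodule.sub_mem _ (φ.carried 0 b) (ψ.carried 0 b)) (by
          change C.aug _ = 0
          rw [map_sub, φ.aug, ψ.aug, sub_self]))
    refine ⟨h, h1, fun b => (h2 b).1, fun b => ?_, fun _ b => (h2 b).2⟩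
    rw [map_sub, φ.comm, ψ.comm, ← lc]
    exact linearMap_eq_linearCombination (C.d 0 ∘ₗ Finsupp.linearCombination ℤ h) _
      (by simp [(h2 _).2]) _
  have hs : ∀ n f, P n f → ∃ f', P (n + 1) f' ∧ Q n f f' := by
    rintro n h ⟨h1, h2, h3, -⟩
    obtain ⟨h', h4, h5⟩ := exists_equivariant A C (n := n + 1) (k := n + 2)
      (fun b z => z ∈ C.chainsIn (A.fl b) (n + 2) ∧
        C.d (n + 1) z = φ.f (n + 1) b - ψ.f (n + 1) b -
          Finsupp.linearCombination ℤ h (A.bd n b))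
      (fun b z g h => ⟨vaddChain_mem_fl A C b g h.1, by
        rw [d_vaddChain, h.2, A.bd_vadd, φ.equivariant, ψ.equivariant, map_sub, map_sub,
          ← linearCombination_vadd A C h1]; rfl⟩)
      (fun b => C.acyclic (A.fl b) (n + 1) _
        (Submodule.sub_mem _ (Submodule.sub_mem _ (φ.carried _ b) (ψ.carried _ b))
          (mem_chainsIn_of_bd h2 b)) (by
          change C.d n _ = 0
          rw [map_sub, h3, sub_self]))
    refine ⟨h', ⟨h4, fun b => (h5 b).1, fun b => ?_, fun h => by omega⟩, fun b => by
      rw [(h5 b).2, sub_add_cancel]⟩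
    have : ∀ z, C.d (n + 1) (Finsupp.linearCombination ℤ h' z) =
        Finsupp.linearCombination ℤ (fun b => φ.f (n + 1) b - ψ.f (n + 1) b) z -
          Finsupp.linearCombination ℤ h (A.d n z) := fun z => by
      rw [← LinearMap.comp_apply, linearMap_eq_linearCombination _ _ (fun a => rfl)]
      refine (linearMap_eq_linearCombination
        (Finsupp.linearCombination ℤ (fun b => φ.f (n + 1) b - ψ.f (n + 1) b) -
          Finsupp.linearCombination ℤ h ∘ₗ A.d n) _ (fun a => ?_) z).symm
      simp [(h5 _).2]
    rw [this, A.bd_bd, map_zero, sub_zero, map_sub, φ.comm, ψ.comm, lc]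
  obtain ⟨h, hh⟩ := exists_dependent_seq P Q h0 hs
  exact ⟨h, fun n => (hh n).1.1, fun b => (hh 0).1.2.2.2 rfl b, fun n => (hh n).2⟩

/-- The identity as a carried map. -/
def CarriedMap.id (A : CarriedComplex.{u} G Λ) : CarriedMap A A where
  f _ b := Finsupp.single b 1
  equivariant _ g b := by simp
  carried _ b := A.single_mem_chainsIn (A.mem_fl b) 1
  aug b := by simp
  comm n b := by
    simp only [Finsupp.linearCombination_single, one_smul]
    exact linearMap_eq_linearCombination LinearMap.id _ (fun _ => rfl) _

/-- Composition of carried maps. -/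
def CarriedMap.comp {E : CarriedComplex.{u} G Λ} (ψ : CarriedMap C E) (φ : CarriedMap A C) :
    CarriedMap A E where
  f n b := Finsupp.linearCombination ℤ (ψ.f n) (φ.f n b)
  equivariant n g b := by
    rw [φ.equivariant, linearCombination_vadd C E (ψ.equivariant n)]
  carried n b := E.linearCombination_mem_chainsIn _ _ fun c hc =>
    E.chainsIn_mono (C.fl_le ((Finsupp.mem_supported ℤ _).1 (φ.carried n b) hc)) n (ψ.carried n c)
  aug b := by
    rw [← φ.aug b]
    exact linearMap_eq_linearCombination (E.aug ∘ₗ Finsupp.linearCombination ℤ (ψ.f 0)) _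
      (by simp [ψ.aug]) _
  comm n b := by
    have h1 : ∀ z, E.d n (Finsupp.linearCombination ℤ (ψ.f (n + 1)) z) =
        Finsupp.linearCombination ℤ (ψ.f n) (C.d n z) := fun z => by
      rw [← LinearMap.comp_apply, linearMap_eq_linearCombination _ _ (fun a => rfl)]
      refine (linearMap_eq_linearCombination (Finsupp.linearCombination ℤ (ψ.f n) ∘ₗ C.d n) _
        (fun a => ?_) z).symm
      simp [ψ.comm]
    rw [h1, φ.comm]
    exact linearMap_eq_linearCombination
      (Finsupp.linearCombination ℤ (ψ.f n) ∘ₗ Finsupp.linearCombination ℤ (φ.f n)) _ (by simp) _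

end CarriedComplex

/-! ### Cochains of based complexes -/

/-- The alternating sum of the faces `f i`. -/
def alternatingFaces {B : Type*} {n : ℕ} (f : Fin n → B) : B →₀ ℤ :=
  ∑ i : Fin n, ((-1 : ℤ) ^ (i : ℕ)) • Finsupp.single (f i) 1

section faces
variable {B B' M : Type*} [AddCommGroup M] {n : ℕ}

theorem lin_alternatingFaces (φ : B → M) (f : Fin n → B) :
    Finsupp.linearCombination ℤ φ (alternatingFaces f) =
      ∑ i : Fin n, ((-1 : ℤ) ^ (i : ℕ)) • φ (f i) := by
  simp only [alternatingFaces, map_sum, map_smul, Finsupp.linearCombination_single, one_smul]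

theorem mem_support_alternatingFaces {f : Fin n → B} {b : B}
    (h : b ∈ (alternatingFaces f).support) : ∃ i, b = f i := by
  by_contra! hc
  refine Finsupp.mem_support_iff.1 h ?_
  rw [alternatingFaces, Finsupp.finsetSum_apply]
  refine Finset.sum_eq_zero fun i _ => ?_
  rw [Finsupp.smul_apply, Finsupp.single_eq_of_ne (hc i), smul_zero]

theorem mapDomain_alternatingFaces (φ : B → B') (f : Fin n → B) :
    Finsupp.mapDomain φ (alternatingFaces f) = alternatingFaces (φ ∘ f) := by
  rw [← Finsupp.lmapDomain_apply ℤ ℤ, alternatingFaces, map_sum]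
  simp only [map_smul, Finsupp.lmapDomain_apply, Finsupp.mapDomain_single]
  rfl

theorem alternatingFaces_cons (b : B) (f : Fin n → B) :
    alternatingFaces (Fin.cons b f : Fin (n + 1) → B) =
      Finsupp.single b 1 - alternatingFaces f := by
  rw [alternatingFaces, Fin.sum_univ_succ, alternatingFaces, sub_eq_add_neg,
    ← Finset.sum_neg_distrib]
  simp [pow_succ]

/-- The faces of a cone. -/
theorem alternatingFaces_cone {c : B' → B} {f : Fin (n + 1) → B} {b : B} {g : Fin n → B'}
    (h0 : f 0 = b) (hs : ∀ i, f i.succ = c (g i)) : alternatingFaces f =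
      Finsupp.single b 1 - Finsupp.linearCombination ℤ (fun b' => Finsupp.single (c b') 1)
        (alternatingFaces g) := by
  have : f = Fin.cons b (c ∘ g) := by
    funext i
    refine Fin.cases ?_ (fun i => ?_) i
    · exact h0
    · exact hs i
  rw [this, alternatingFaces_cons, lin_alternatingFaces]
  rfl

end faces

namespace BasedComplex

/-- The based complex of a family of sets with face maps that satisfy the simplicial identities. -/
def ofFaces (B : ℕ → Type u) (face : ∀ n, Fin (n + 2) → B (n + 1) → B n)
    (hface : ∀ n (i j : Fin (n + 2)) (b : B (n + 2)), i ≤ j →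
      face n i (face (n + 1) j.succ b) = face n j (face (n + 1) i.castSucc b)) :
    BasedComplex.{u} where
  B := B
  bd n b := alternatingFaces fun i => face n i b
  bd_bd n b := by
    rw [lin_alternatingFaces]
    simp only [alternatingFaces, Finset.smul_sum]
    exact alternating_double_sum
      (fun i j => Finsupp.single (face n j (face (n + 1) i b)) (1 : ℤ))
      fun i j hij => by rw [hface n i j b hij]
  aug_bd b := by
    rw [lin_alternatingFaces]
    simp [Fin.sum_univ_two]

/-- The coboundary of a cochain. -/
def cob (A : BasedComplex.{u}) {R : Type w} [Ring R] {n : ℕ} (f : A.B n → R) : A.B (n + 1) → R :=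
  fun b => Finsupp.linearCombination ℤ f (A.bd n b)

variable {A : BasedComplex.{u}} {R : Type w} [Ring R] {n : ℕ}

theorem lin_cob (f : A.B n → R) (z : A.B (n + 1) →₀ ℤ) :
    Finsupp.linearCombination ℤ (A.cob f) z = Finsupp.linearCombination ℤ f (A.d n z) :=
  (linearMap_eq_linearCombination (Finsupp.linearCombination ℤ f ∘ₗ A.d n) _
    (by simp [cob]) z).symm

theorem lin_add {α M : Type*} [AddCommGroup M] (f g : α → M) (z : α →₀ ℤ) :
    Finsupp.linearCombination ℤ (f + g) z =
      Finsupp.linearCombination ℤ f z + Finsupp.linearCombination ℤ g z :=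
  (linearMap_eq_linearCombination
    (Finsupp.linearCombination ℤ f + Finsupp.linearCombination ℤ g) _ (by simp) z).symm

theorem lin_sub {α M : Type*} [AddCommGroup M] (f g : α → M) (z : α →₀ ℤ) :
    Finsupp.linearCombination ℤ (f - g) z =
      Finsupp.linearCombination ℤ f z - Finsupp.linearCombination ℤ g z :=
  (linearMap_eq_linearCombination
    (Finsupp.linearCombination ℤ f - Finsupp.linearCombination ℤ g) _ (by simp) z).symm

theorem lin_zero {α M : Type*} [AddCommGroup M] (z : α →₀ ℤ) :
    Finsupp.linearCombination ℤ (0 : α → M) z = 0 :=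
  (linearMap_eq_linearCombination (0 : (α →₀ ℤ) →ₗ[ℤ] M) _ (by simp) z).symm

theorem lin_smul {S α M : Type*} [Ring S] [AddCommGroup M] [Module S M] (r : S) (f : α → M)
    (z : α →₀ ℤ) : Finsupp.linearCombination ℤ (r • f) z =
      r • Finsupp.linearCombination ℤ f z := by
  rw [Finsupp.linearCombination_apply, Finsupp.linearCombination_apply, Finsupp.smul_sum]
  exact Finset.sum_congr rfl fun a _ => smul_comm _ _ _

theorem lin_lin {α β M : Type*} [AddCommGroup M] (f : β → M) (g : α → (β →₀ ℤ)) (z : α →₀ ℤ) :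
    Finsupp.linearCombination ℤ f (Finsupp.linearCombination ℤ g z) =
      Finsupp.linearCombination ℤ (fun a => Finsupp.linearCombination ℤ f (g a)) z :=
  linearMap_eq_linearCombination
    (Finsupp.linearCombination ℤ f ∘ₗ Finsupp.linearCombination ℤ g) _ (by simp) z

theorem cob_sub (f g : A.B n → R) : A.cob (f - g) = A.cob f - A.cob g :=
  funext fun _ => lin_sub f g _

/-- A cone operator on the basis elements in `S` shows that `S` spans an acyclic complex. -/
theorem exists_of_cone (A : BasedComplex.{u}) (S : ∀ n, Set (A.B n))
    (c : ∀ n, A.B n → A.B (n + 1)) (p : A.B 0) (hS : ∀ n, ∀ b ∈ S n, c n b ∈ S (n + 1))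
    (h0 : ∀ b ∈ S 0, A.bd 0 (c 0 b) = Finsupp.single b 1 - Finsupp.single p 1)
    (hs : ∀ n, ∀ b ∈ S (n + 1), A.bd (n + 1) (c (n + 1) b) = Finsupp.single b 1 -
      Finsupp.linearCombination ℤ (fun b' => Finsupp.single (c n b') 1) (A.bd n b))
    (n : ℕ) (z : A.B n →₀ ℤ) (hz : z ∈ Finsupp.supported ℤ ℤ (S n)) (hc : A.IsCycle n z) :
    ∃ y ∈ Finsupp.supported ℤ ℤ (S (n + 1)), A.d n y = z := by
  have hz' := (Finsupp.mem_supported ℤ z).1 hz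
  refine ⟨Finsupp.linearCombination ℤ (fun b => Finsupp.single (c n b) 1) z,
    linearCombination_mem_of_support _ _ _ fun b hb =>
      Finsupp.single_mem_supported ℤ 1 (hS n b (hz' hb)), ?_⟩
  have hid : Finsupp.linearCombination ℤ (fun b => Finsupp.single b (1 : ℤ)) z = z :=
    (linearMap_eq_linearCombination LinearMap.id _ (fun _ => rfl) z).symm
  rw [lin_lin]
  cases n with
  | zero =>
    rw [linearCombination_congr z (g := (fun b => Finsupp.single b (1 : ℤ)) -
      fun _ => Finsupp.single p 1) (fun b hb => by simp [h0 b (hz' hb)]), lin_sub, hid]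
    have : Finsupp.linearCombination ℤ (fun _ : A.B 0 => Finsupp.single p (1 : ℤ)) z =
        A.aug z • Finsupp.single p 1 :=
      (linearMap_eq_linearCombination (A.aug.smulRight (Finsupp.single p 1)) _ (by simp) z).symm
    rw [this, show A.aug z = 0 from hc, zero_smul, sub_zero]
  | succ n =>
    rw [linearCombination_congr z (g := (fun b => Finsupp.single b (1 : ℤ)) -
      fun b => Finsupp.linearCombination ℤ (fun b' => Finsupp.single (c n b') (1 : ℤ)) (A.bd n b))
      (fun b hb => by simp [hs n b (hz' hb)]), lin_sub, hid, ← lin_lin,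
      show Finsupp.linearCombination ℤ (A.bd n) z = 0 from hc, map_zero, sub_zero]

end BasedComplex

namespace CarriedComplex

open BasedComplex

variable {G : Type*} [AddGroup G] {Λ : Type*} [Preorder Λ] [AddAction G Λ]
  {A C : CarriedComplex.{u} G Λ} {R : Type w} [Ring R] (H : AddSubgroup G) {n : ℕ}

/-- Cochains that are invariant under the subgroup `H`. -/
def IsInvariant (A : CarriedComplex.{u} G Λ) {n : ℕ} (f : A.B n → R) : Prop :=
  ∀ g ∈ H, ∀ b, f (g +ᵥ b) = f b

/-- The invariant cochain `f` is the coboundary of an invariant cochain. -/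
def IsCob (A : CarriedComplex.{u} G Λ) (n : ℕ) (f : A.B n → R) : Prop :=
  match n, f with
  | 0, f => f = 0
  | _ + 1, f => ∃ e, A.IsInvariant H e ∧ A.cob e = f

variable {H}

theorem IsCob.sub {f g : A.B n → R} (hf : A.IsCob H n f) (hg : A.IsCob H n g) :
    A.IsCob H n (f - g) := by
  cases n with
  | zero => rw [show f = 0 from hf, show g = 0 from hg, sub_zero]; rfl
  | succ n =>
    obtain ⟨e, he, rfl⟩ := hf
    obtain ⟨e', he', rfl⟩ := hg
    exact ⟨e - e', fun g hg b => by simp [he g hg b, he' g hg b], cob_sub _ _⟩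

/-- Evaluation of an invariant cochain on a translated chain. -/
theorem IsInvariant.lin_vadd {f : A.B n → R} (hf : A.IsInvariant H f) {g : G} (hg : g ∈ H)
    (z : A.B n →₀ ℤ) : Finsupp.linearCombination ℤ f (A.vaddChain g n z) =
      Finsupp.linearCombination ℤ f z :=
  linearMap_eq_linearCombination (Finsupp.linearCombination ℤ f ∘ₗ A.vaddChain g n) _
    (by simp [hf g hg]) z

theorem IsInvariant.cob {f : A.B n → R} (hf : A.IsInvariant H f) :
    A.IsInvariant H (A.cob f) := fun g hg b => by
  change Finsupp.linearCombination ℤ f (A.bd n (g +ᵥ b)) = _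
  rw [A.bd_vadd]
  exact hf.lin_vadd hg _

namespace CarriedMap

/-- Pull-back of cochains along a carried map. -/
def pull (φ : CarriedMap A C) (f : C.B n → R) : A.B n → R :=
  fun b => Finsupp.linearCombination ℤ f (φ.f n b)

theorem pull_cob (φ : CarriedMap A C) (f : C.B n → R) :
    φ.pull (C.cob f) = A.cob (φ.pull f) := funext fun b => by
  change Finsupp.linearCombination ℤ (C.cob f) _ =
    Finsupp.linearCombination ℤ (fun b => Finsupp.linearCombination ℤ f (φ.f n b)) _
  rw [lin_cob, φ.comm, lin_lin]

theorem pull_invariant (φ : CarriedMap A C) {f : C.B n → R} (hf : C.IsInvariant H f) :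
    A.IsInvariant H (φ.pull f) := fun g hg b => by
  change Finsupp.linearCombination ℤ f _ = Finsupp.linearCombination ℤ f _
  rw [φ.equivariant, hf.lin_vadd hg]

theorem pull_isCob (φ : CarriedMap A C) {f : C.B n → R} (hf : C.IsCob H n f) :
    A.IsCob H n (φ.pull f) := by
  cases n with
  | zero => rw [show f = 0 from hf]; exact funext fun b => lin_zero _
  | succ n =>
    obtain ⟨e, he, rfl⟩ := hf
    exact ⟨φ.pull e, φ.pull_invariant he, (φ.pull_cob e).symm⟩

/-- Carried maps agree on cohomology with invariant cochains. -/
theorem isCob_pull_sub_pull (φ ψ : CarriedMap A C) {f : C.B n → R} (hf : C.IsInvariant H f)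
    (hc : C.cob f = 0) : A.IsCob H n (φ.pull f - ψ.pull f) := by
  obtain ⟨h, h1, h2, h3⟩ := φ.exists_homotopy ψ
  have key : ∀ z, Finsupp.linearCombination ℤ f (C.d n z) = 0 := fun z => by
    rw [← lin_cob, hc, lin_zero]
  cases n with
  | zero =>
    refine funext fun b => ?_
    change Finsupp.linearCombination ℤ f _ - Finsupp.linearCombination ℤ f _ = 0
    rw [← map_sub, ← h2, key]
  | succ n =>
    refine ⟨fun b => Finsupp.linearCombination ℤ f (h n b), fun g hg b => ?_, funext fun b => ?_⟩
    · change Finsupp.linearCombination ℤ f (h n (g +ᵥ b)) = Finsupp.linearCombination ℤ f (h n b)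
      rw [h1, hf.lin_vadd hg]
    · change Finsupp.linearCombination ℤ (fun b => Finsupp.linearCombination ℤ f (h n b)) _ =
        Finsupp.linearCombination ℤ f _ - Finsupp.linearCombination ℤ f _
      rw [← map_sub, ← h3, map_add, key, zero_add, lin_lin]

theorem pull_comp {E : CarriedComplex.{u} G Λ} (ψ : CarriedMap C E) (φ : CarriedMap A C)
    (f : E.B n → R) : (ψ.comp φ).pull f = φ.pull (ψ.pull f) := funext fun _ => lin_lin _ _ _

theorem pull_id (f : A.B n → R) : (CarriedMap.id A).pull f = f := funext fun b => by
  simp [pull, CarriedMap.id]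

/-- A carried map is injective on cohomology with invariant cochains. -/
theorem isCob_of_pull (ψ : CarriedMap C A) {f : A.B n → R} (hf : A.IsInvariant H f)
    (hc : A.cob f = 0) (h : C.IsCob H n (ψ.pull f)) : A.IsCob H n f := by
  obtain ⟨φ⟩ := exists_carriedMap A C
  have h1 := (ψ.comp φ).isCob_pull_sub_pull (CarriedMap.id A) hf hc
  rw [pull_id, pull_comp] at h1
  simpa using (φ.pull_isCob h).sub h1

/-- A carried map is surjective on cohomology with invariant cochains. -/
theorem exists_isCob_pull_sub (ψ : CarriedMap C A) {e : C.B n → R} (he : C.IsInvariant H e)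
    (hc : C.cob e = 0) : ∃ f : A.B n → R, A.IsInvariant H f ∧ A.cob f = 0 ∧
      C.IsCob H n (ψ.pull f - e) := by
  obtain ⟨φ⟩ := exists_carriedMap A C
  refine ⟨φ.pull e, φ.pull_invariant he, ?_, ?_⟩
  · rw [← pull_cob, hc]
    exact funext fun b => lin_zero _
  · have h1 := (φ.comp ψ).isCob_pull_sub_pull (CarriedMap.id C) he hc
    rwa [pull_id, pull_comp] at h1

end CarriedMap

end CarriedComplex

theorem BasedComplex.isCycle_of_sub (A : BasedComplex.{u}) {n : ℕ} {x y : A.B n →₀ ℤ}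
    (hx : A.IsCycle n x) (h : A.IsCycle n (x - y)) : A.IsCycle n y := by
  cases n with
  | zero =>
    change A.aug _ = 0 at hx h ⊢
    rwa [map_sub, hx, zero_sub, neg_eq_zero] at h
  | succ n =>
    change A.d n _ = 0 at hx h ⊢
    rwa [map_sub, hx, zero_sub, neg_eq_zero] at h

/-! ### Flats and lattice cubes -/

section flats
variable {V : Type u} (L : PreAbstractSimplicialComplex V)

/-- The translate `a + ℝ^σ` of a coordinate subspace, `σ ∈ L`, together with an integer `m`, the
height of the point `a`. These are the lifts of the tori `T(σ)` to the universal abelian cover of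
`T_L`, paired with a component of the infinite cyclic cover. Two triples may describe the same
flat. -/
structure Flat where
  /-- A lattice point of the flat. -/
  a : V → ℤ
  /-- The height of `a`. -/
  m : ℤ
  /-- The directions of the flat. -/
  s : Finset V
  isSimplex : IsSimplex L s

variable {L}

namespace Flat

/-- Inclusion of flats. -/
instance : Preorder (Flat L) where
  le F F' := F.s ⊆ F'.s ∧ (∀ v ∉ F'.s, F.a v = F'.a v) ∧
    F.m = F'.m + ∑ v ∈ F'.s, (F.a v - F'.a v)
  le_refl F := ⟨subset_rfl, fun _ _ => rfl, by simp⟩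
  le_trans F F' F'' h h' := by
    refine ⟨h.1.trans h'.1, fun v hv => (h.2.1 v fun h'' => hv (h'.1 h'')).trans (h'.2.1 v hv), ?_⟩
    rw [h.2.2, h'.2.2, Finset.sum_subset h'.1 fun v _ hv => by rw [h.2.1 v hv, sub_self],
      add_assoc, ← Finset.sum_add_distrib]
    exact congrArg _ (Finset.sum_congr rfl fun v _ => by ring)

theorem le_def {F F' : Flat L} : F ≤ F' ↔ F.s ⊆ F'.s ∧ (∀ v ∉ F'.s, F.a v = F'.a v) ∧
    F.m = F'.m + ∑ v ∈ F'.s, (F.a v - F'.a v) := Iff.rfl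

/-- The lattice and the deck transformations act by translation. -/
instance : AddAction ((V → ℤ) × ℤ) (Flat L) where
  vadd g F := ⟨g.1 + F.a, g.2 + F.m, F.s, F.isSimplex⟩
  zero_vadd F := by
    change (⟨0 + F.a, 0 + F.m, F.s, F.isSimplex⟩ : Flat L) = F
    simp
  add_vadd g g' F := by
    change (⟨(g.1 + g'.1) + F.a, (g.2 + g'.2) + F.m, F.s, F.isSimplex⟩ : Flat L) =
      ⟨g.1 + (g'.1 + F.a), g.2 + (g'.2 + F.m), F.s, F.isSimplex⟩
    simp only [add_assoc]

theorem vadd_le {F F' : Flat L} (g : (V → ℤ) × ℤ) (h : F ≤ F') : g +ᵥ F ≤ g +ᵥ F' := by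
  refine ⟨h.1, fun v hv => congrArg (g.1 v + ·) (h.2.1 v hv), ?_⟩
  change g.2 + F.m = g.2 + F'.m + ∑ v ∈ F'.s, ((g.1 v + F.a v) - (g.1 v + F'.a v))
  simp only [add_sub_add_left_eq_sub, h.2.2, add_assoc]

end Flat

end flats

theorem spans_of_mem {V : Type u} {L : PreAbstractSimplicialComplex V} {n : ℕ} {v : Fin n → V}
    {s : Finset V} (hs : IsSimplex L s) (h : ∀ i, v i ∈ s) : Spans L v := by
  classical
  refine hs.subset fun x hx => ?_
  obtain ⟨i, -, rfl⟩ := Finset.mem_image.1 hx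
  exact h i

theorem Spans.comp {V : Type u} {L : PreAbstractSimplicialComplex V} {n k : ℕ} {v : Fin n → V}
    (h : Spans L v) (f : Fin k → Fin n) : Spans L (v ∘ f) := by
  classical
  exact spans_of_mem h fun i => Finset.mem_image_of_mem v (Finset.mem_univ (f i))

/-- The simplicial identity for face maps. -/
theorem succAbove_comm {n : ℕ} {i j : Fin (n + 2)} (h : i ≤ j) (x : Fin (n + 1)) :
    j.succ.succAbove (i.succAbove x) = i.castSucc.succAbove (j.succAbove x) := by
  have h' := Fin.le_def.1 h
  simp only [Fin.succAbove, Fin.lt_def, Fin.ext_iff]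
  split_ifs <;> simp_all <;> omega

section telescope
variable {M N : Type*} [AddCommGroup M] [AddCommGroup N]

/-- The oriented sum of `g` over the integers from `a` to `b`. -/
def intSum (g : ℤ → M) (a b : ℤ) : M := ∑ k ∈ Finset.Ico a b, g k - ∑ k ∈ Finset.Ico b a, g k

theorem intSum_self (g : ℤ → M) (a : ℤ) : intSum g a a = 0 := by simp [intSum]

theorem intSum_succ (g : ℤ → M) (a b : ℤ) : intSum g a (b + 1) = intSum g a b + g b := by
  unfold intSum
  rcases le_or_gt a b with h | h
  · rw [Finset.Ico_eq_empty_of_le (h.trans (by omega : b ≤ b + 1)),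
      Finset.Ico_eq_empty_of_le h, ← Finset.insert_Ico_right_eq_Ico_add_one h,
      Finset.sum_insert (by simp)]
    simp [add_comm]
  · rw [Finset.Ico_eq_empty_of_le (by omega : b + 1 ≤ a), Finset.Ico_eq_empty_of_le h.le,
      ← Finset.insert_Ico_add_one_left_eq_Ico h, Finset.sum_insert (by simp)]
    simp

theorem map_intSum (φ : M →ₗ[ℤ] N) (g : ℤ → M) (a b : ℤ) :
    φ (intSum g a b) = intSum (fun k => φ (g k)) a b := by
  simp [intSum]

theorem intSum_sub (g : ℤ → M) (a b : ℤ) : intSum (fun k => g (k + 1) - g k) a b = g b - g a := by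
  induction b using Int.inductionOn' (b := a) with
  | zero => rw [intSum_self, sub_self]
  | succ k _ ih => rw [intSum_succ, ih]; abel
  | pred k _ ih =>
    have := intSum_succ (fun k => g (k + 1) - g k) a (k - 1)
    rw [sub_add_cancel, ih] at this
    rw [eq_sub_of_add_eq this.symm]; abel

theorem intSum_fun_sub (g g' : ℤ → M) (a b : ℤ) :
    intSum (fun k => g k - g' k) a b = intSum g a b - intSum g' a b := by
  simp only [intSum, Finset.sum_sub_distrib]; abel

theorem intSum_sum {ι : Type*} (s : Finset ι) (g : ι → ℤ → M) (a b : ℤ) :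
    intSum (fun k => ∑ i ∈ s, g i k) a b = ∑ i ∈ s, intSum (g i) a b := by
  simp only [intSum, Finset.sum_sub_distrib]
  rw [Finset.sum_comm, Finset.sum_comm (s := Finset.Ico b a)]

theorem intSum_zsmul (c : ℤ) (g : ℤ → M) (a b : ℤ) :
    intSum (fun k => c • g k) a b = c • intSum g a b := by
  simp only [intSum, Finset.smul_sum, smul_sub]

theorem intSum_mem (P : Submodule ℤ M) (g : ℤ → M) (h : ∀ k, g k ∈ P) (a b : ℤ) :
    intSum g a b ∈ P :=
  P.sub_mem (P.sum_mem fun k _ => h k) (P.sum_mem fun k _ => h k)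

end telescope

section cubes
variable {V : Type u} (L : PreAbstractSimplicialComplex V) [LinearOrder V]

/-- A lattice cube of height `m`, with lowest corner `a` and edges in the directions of the
simplex `v` of `L`, whose vertices are listed in increasing order. -/
@[ext] structure Cube (n : ℕ) where
  /-- The lowest corner. -/
  a : V → ℤ
  /-- The height of the lowest corner. -/
  m : ℤ
  /-- The directions of the edges. -/
  v : Fin n → V
  mono : StrictMono v
  spans : Spans L v

variable {L}

namespace Cube
variable {n : ℕ}

/-- The face on which the `i`-th coordinate is least. -/
def back (i : Fin (n + 1)) (c : Cube L (n + 1)) : Cube L n :=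
  ⟨c.a, c.m, c.v ∘ i.succAbove, c.mono.comp (Fin.strictMono_succAbove i), c.spans.comp _⟩

/-- The face on which the `i`-th coordinate is greatest. -/
def front (i : Fin (n + 1)) (c : Cube L (n + 1)) : Cube L n :=
  ⟨c.a + Pi.single (c.v i) 1, c.m + 1, c.v ∘ i.succAbove,
    c.mono.comp (Fin.strictMono_succAbove i), c.spans.comp _⟩

/-- The boundary of a cube. -/
def bd (n : ℕ) (c : Cube L (n + 1)) : Cube L n →₀ ℤ :=
  ∑ i : Fin (n + 1), ((-1 : ℤ) ^ (i : ℕ)) •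
    (Finsupp.single (c.front i) 1 - Finsupp.single (c.back i) 1)

/-- The flat spanned by a cube. -/
def flat (c : Cube L n) : Flat L :=
  ⟨c.a, c.m, Finset.univ.image c.v, by have := c.spans; unfold Spans at this; convert this⟩

instance : AddAction ((V → ℤ) × ℤ) (Cube L n) where
  vadd g c := ⟨g.1 + c.a, g.2 + c.m, c.v, c.mono, c.spans⟩
  zero_vadd c := by
    change (⟨0 + c.a, 0 + c.m, c.v, c.mono, c.spans⟩ : Cube L n) = c
    simp
  add_vadd g g' c := by
    change (⟨(g.1 + g'.1) + c.a, (g.2 + g'.2) + c.m, c.v, c.mono, c.spans⟩ : Cube L n) =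
      ⟨g.1 + (g'.1 + c.a), g.2 + (g'.2 + c.m), c.v, c.mono, c.spans⟩
    simp only [add_assoc]

theorem vadd_back (g : (V → ℤ) × ℤ) (i : Fin (n + 1)) (c : Cube L (n + 1)) :
    (g +ᵥ c).back i = g +ᵥ c.back i := rfl

theorem vadd_front (g : (V → ℤ) × ℤ) (i : Fin (n + 1)) (c : Cube L (n + 1)) :
    (g +ᵥ c).front i = g +ᵥ c.front i :=
  Cube.ext (add_assoc _ _ _) (add_assoc _ _ _) rfl

theorem comp_succAbove_comm {V : Type*} (v : Fin (n + 2) → V) {i j : Fin (n + 1)} (h : i ≤ j) :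
    (v ∘ j.succ.succAbove) ∘ i.succAbove = (v ∘ i.castSucc.succAbove) ∘ j.succAbove := by
  funext x
  cases n with
  | zero => exact x.elim0
  | succ n => exact congrArg v (succAbove_comm h x)

theorem succ_succAbove_eq {i j : Fin (n + 1)} (h : i ≤ j) : j.succ.succAbove i = i.castSucc :=
  Fin.succAbove_of_castSucc_lt _ _ (by simpa [Fin.lt_def, Nat.lt_succ_iff] using h)

theorem castSucc_succAbove_eq {i j : Fin (n + 1)} (h : i ≤ j) :
    i.castSucc.succAbove j = j.succ :=
  Fin.succAbove_of_le_castSucc _ _ (Fin.castSucc_le_castSucc_iff.2 h)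

theorem bd_bd (n : ℕ) (c : Cube L (n + 2)) :
    Finsupp.linearCombination ℤ (bd n) (bd (n + 1) c) = 0 := by
  let F : Fin (n + 2) → Fin (n + 1) → (Cube L n →₀ ℤ) := fun i j =>
    (Finsupp.single ((c.front i).front j) 1 - Finsupp.single ((c.front i).back j) 1) -
      (Finsupp.single ((c.back i).front j) 1 - Finsupp.single ((c.back i).back j) 1)
  have : Finsupp.linearCombination ℤ (bd n) (bd (n + 1) c) =
      ∑ i : Fin (n + 2), ∑ j : Fin (n + 1),
        ((-1 : ℤ) ^ (i : ℕ)) • ((-1 : ℤ) ^ (j : ℕ)) • F i j := by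
    conv_lhs => rw [bd]
    simp only [map_sum, map_smul, map_sub, Finsupp.linearCombination_single, one_smul]
    refine Finset.sum_congr rfl fun i _ => ?_
    simp only [F, bd, ← Finset.sum_sub_distrib, Finset.smul_sum, smul_sub]
  rw [this]
  refine alternating_double_sum F fun i j h => ?_
  have e1 : (c.front j.succ).front i = (c.front i.castSucc).front j := by
    refine Cube.ext ?_ rfl (comp_succAbove_comm c.v h)
    simp only [front, Function.comp_apply, succ_succAbove_eq h, castSucc_succAbove_eq h]
    abel
  have e2 : (c.front j.succ).back i = (c.back i.castSucc).front j := by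
    refine Cube.ext ?_ rfl (comp_succAbove_comm c.v h)
    simp only [front, back, Function.comp_apply, castSucc_succAbove_eq h]
  have e3 : (c.back j.succ).front i = (c.front i.castSucc).back j := by
    refine Cube.ext ?_ rfl (comp_succAbove_comm c.v h)
    simp only [front, back, Function.comp_apply, succ_succAbove_eq h]
  have e4 : (c.back j.succ).back i = (c.back i.castSucc).back j :=
    Cube.ext rfl rfl (comp_succAbove_comm c.v h)
  simp only [F, e1, e2, e3, e4]
  abel

variable (L) in
/-- The cubical chains. -/
def complex : BasedComplex.{u} where
  B := Cube L
  bd := bd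
  bd_bd := bd_bd
  aug_bd c := by simp [bd]

theorem mem_flat_iff {F : Flat L} {c : Cube L n} : c.flat ≤ F ↔ (∀ i, c.v i ∈ F.s) ∧
    (∀ v ∉ F.s, c.a v = F.a v) ∧ c.m = F.m + ∑ v ∈ F.s, (c.a v - F.a v) := by
  rw [Flat.le_def]
  refine and_congr ?_ Iff.rfl
  simp [flat, Finset.image_subset_iff]

theorem back_flat_le (c : Cube L (n + 1)) (i : Fin (n + 1)) : (c.back i).flat ≤ c.flat :=
  mem_flat_iff.2 ⟨fun j => Finset.mem_image_of_mem c.v (Finset.mem_univ (i.succAbove j)),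
    fun _ _ => rfl, by simp [back, flat]⟩

theorem front_flat_le (c : Cube L (n + 1)) (i : Fin (n + 1)) : (c.front i).flat ≤ c.flat := by
  refine mem_flat_iff.2 ⟨fun j => Finset.mem_image_of_mem c.v (Finset.mem_univ (i.succAbove j)),
    fun v hv => ?_, ?_⟩
  · have : v ≠ c.v i := fun h => hv (h ▸ Finset.mem_image_of_mem c.v (Finset.mem_univ i))
    simp [front, flat, this]
  · have : c.v i ∈ c.flat.s := Finset.mem_image_of_mem c.v (Finset.mem_univ i)
    simp only [front, flat, Pi.add_apply, add_sub_cancel_left]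
    change c.m + 1 = c.m + ∑ v ∈ c.flat.s, (Pi.single (c.v i) 1 : V → ℤ) v
    simp [Pi.single_apply, this]

theorem mem_bd_support {c : Cube L (n + 1)} {c' : Cube L n} (h : c' ∈ (bd n c).support) :
    ∃ i, c' = c.front i ∨ c' = c.back i := by
  by_contra! hc
  refine Finsupp.mem_support_iff.1 h ?_
  simp only [bd, Finsupp.coe_finsetSum, Finset.sum_apply, Finsupp.smul_apply, Finsupp.sub_apply]
  refine Finset.sum_eq_zero fun i _ => ?_
  rw [Finsupp.single_eq_of_ne (hc i).1, Finsupp.single_eq_of_ne (hc i).2]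
  simp

/-! ### Contracting a direction -/

variable (w : V)

/-- The cube `c` lies in directions above `w` and can be extended in direction `w`. -/
def Extends (c : Cube L n) : Prop := (∀ i, w < c.v i) ∧ Spans L (Fin.cons w c.v : Fin (n + 1) → V)

variable {w}

theorem Extends.back {c : Cube L (n + 1)} (h : c.Extends w) (i : Fin (n + 1)) :
    (c.back i).Extends w := by
  refine ⟨fun j => h.1 _, ?_⟩
  have := h.2.comp i.succ.succAbove
  convert this using 1
  funext x
  refine Fin.cases ?_ (fun x => ?_) x
  · simp
  · simp [Cube.back]

theorem Extends.front {c : Cube L (n + 1)} (h : c.Extends w) (i : Fin (n + 1)) :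
    (c.front i).Extends w := h.back i

variable (w) in
/-- Translate `c` in direction `w` so that the coordinate becomes `k`. -/
def slide (k : ℤ) (c : Cube L n) : Cube L n :=
  ⟨Function.update c.a w k, c.m + (k - c.a w), c.v, c.mono, c.spans⟩

/-- The product of `c` with the edge from `k` to `k + 1` in direction `w`. -/
def thicken (k : ℤ) (c : Cube L n) (h : c.Extends w) : Cube L (n + 1) :=
  ⟨Function.update c.a w k, c.m + (k - c.a w), Fin.cons w c.v,
    Fin.strictMono_cons.2 ⟨h.1, c.mono⟩, h.2⟩

theorem thicken_congr {k : ℤ} {c c' : Cube L n} (h : c.Extends w) (h' : c'.Extends w)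
    (ha : Function.update c.a w k = Function.update c'.a w k)
    (hm : c.m - c.a w = c'.m - c'.a w) (hv : c.v = c'.v) :
    thicken k c h = thicken k c' h' := by
  refine Cube.ext ha ?_ (by simp [thicken, hv])
  simp only [thicken]
  omega

theorem thicken_back_zero (k : ℤ) (c : Cube L n) (h : c.Extends w) :
    (c.thicken k h).back 0 = c.slide w k :=
  Cube.ext rfl rfl (by funext x; simp [thicken, back, slide])

theorem thicken_front_zero (k : ℤ) (c : Cube L n) (h : c.Extends w) :
    (c.thicken k h).front 0 = c.slide w (k + 1) := by
  refine Cube.ext ?_ ?_ (by funext x; simp [thicken, front, slide])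
  · funext x
    rcases eq_or_ne x w with rfl | hx
    · simp [thicken, front, slide]
    · simp [thicken, front, slide, hx]
  · simp [thicken, front, slide]; ring

theorem cons_comp_succ_succAbove {V : Type*} (w : V) (v : Fin (n + 1) → V) (i : Fin (n + 1)) :
    (Fin.cons w v : Fin (n + 2) → V) ∘ i.succ.succAbove =
      (Fin.cons w (v ∘ i.succAbove) : Fin (n + 1) → V) := by
  funext x
  refine Fin.cases ?_ (fun x => ?_) x <;> simp

theorem thicken_back_succ (k : ℤ) (c : Cube L (n + 1)) (h : c.Extends w) (i : Fin (n + 1)) :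
    (c.thicken k h).back i.succ = (c.back i).thicken k (h.back i) :=
  Cube.ext rfl rfl (cons_comp_succ_succAbove w c.v i)

theorem thicken_front_succ (k : ℤ) (c : Cube L (n + 1)) (h : c.Extends w) (i : Fin (n + 1)) :
    (c.thicken k h).front i.succ = (c.front i).thicken k (h.front i) := by
  have hw : w ≠ c.v i := (h.1 i).ne
  refine Cube.ext ?_ ?_ (cons_comp_succ_succAbove w c.v i)
  · funext x
    rcases eq_or_ne x w with rfl | hx
    · simp [thicken, front, hw]
    · simp [thicken, front, hx]
  · simp [thicken, front, hw]; ring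

open Classical in
variable (w) in
/-- The homotopy that pushes cubes in direction `w` to the coordinate `a₀`. -/
def push (a₀ : ℤ) (c : Cube L n) : Cube L (n + 1) →₀ ℤ :=
  if h : c.Extends w then intSum (fun k => Finsupp.single (c.thicken k h) 1) a₀ (c.a w) else 0

theorem d_push (a₀ : ℤ) (c : Cube L n) (h : c.Extends w) :
    Finsupp.linearCombination ℤ (bd n) (push w a₀ c) =
      Finsupp.single c 1 - Finsupp.single (c.slide w a₀) 1 -
      ∑ i : Fin n, ((-1 : ℤ) ^ (i : ℕ)) • intSum (fun k =>
        Finsupp.single ((c.thicken k h).front i.succ) 1 -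
          Finsupp.single ((c.thicken k h).back i.succ) 1) a₀ (c.a w) := by
  have h1 : ∀ k, bd n (c.thicken k h) = (Finsupp.single (c.slide w (k + 1)) 1 -
      Finsupp.single (c.slide w k) 1) - ∑ i : Fin n, ((-1 : ℤ) ^ (i : ℕ)) •
        (Finsupp.single ((c.thicken k h).front i.succ) 1 -
          Finsupp.single ((c.thicken k h).back i.succ) 1) := fun k => by
    rw [bd, Fin.sum_univ_succ, thicken_back_zero, thicken_front_zero]
    simp only [Fin.val_zero, pow_zero, one_smul, Fin.val_succ, pow_succ, mul_neg, mul_one,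
      neg_smul, Finset.sum_neg_distrib, sub_eq_add_neg]
  have h2 : c.slide w (c.a w) = c :=
    Cube.ext (Function.update_eq_self _ _) (by simp [slide]) rfl
  rw [push, dif_pos h, map_intSum]
  have h3 : ∀ k, Finsupp.linearCombination ℤ (bd n) (Finsupp.single (c.thicken k h) 1) =
      bd n (c.thicken k h) := fun k => by rw [Finsupp.linearCombination_single, one_smul]
  simp only [h3, h1]
  rw [intSum_fun_sub, intSum_sub (fun k => Finsupp.single (c.slide w k) (1 : ℤ)), intSum_sum, h2]
  simp only [intSum_zsmul]

/-- The homotopy formula for a cube that does not extend in direction `w`. -/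
theorem push_homotopy_of_extends (a₀ : ℤ) (c : Cube L (n + 1)) (h : c.Extends w) :
    Finsupp.linearCombination ℤ (bd (n + 1)) (push w a₀ c) +
      Finsupp.linearCombination ℤ (push w a₀) (bd n c) =
        Finsupp.single c 1 - Finsupp.single (c.slide w a₀) 1 := by
  rw [d_push a₀ c h, bd, map_sum]
  simp only [map_smul, map_sub, Finsupp.linearCombination_single, one_smul]
  rw [sub_add, sub_eq_self, ← Finset.sum_sub_distrib]
  refine Finset.sum_eq_zero fun i _ => ?_
  rw [← smul_sub, push, push, dif_pos (h.front i), dif_pos (h.back i), intSum_fun_sub]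
  have hw : (c.front i).a w = c.a w := by
    simp [front, (h.1 i).ne]
  simp only [hw, thicken_front_succ, thicken_back_succ]
  rw [show (c.back i).a w = c.a w from rfl, sub_self, smul_zero]

/-- The homotopy formula for a cube with an edge in direction `w`. -/
theorem push_homotopy_of_eq (a₀ : ℤ) (c : Cube L (n + 1)) (hw : c.v 0 = w) :
    Finsupp.linearCombination ℤ (bd (n + 1)) (push w a₀ c) +
      Finsupp.linearCombination ℤ (push w a₀) (bd n c) = Finsupp.single c 1 := by
  have hn : ∀ {k} (c : Cube L (k + 1)), c.v 0 = w → push w a₀ c = 0 := fun c hc =>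
    dif_neg fun h => (h.1 0).ne hc.symm
  rw [hn c hw, map_zero, zero_add, bd, map_sum, Fin.sum_univ_succ]
  have h0 : ∑ i : Fin n, Finsupp.linearCombination ℤ (push w a₀)
      (((-1 : ℤ) ^ (i.succ : ℕ)) • (Finsupp.single (c.front i.succ) 1 -
        Finsupp.single (c.back i.succ) 1)) = 0 := by
    cases n with
    | zero => simp
    | succ n =>
      refine Finset.sum_eq_zero fun i _ => ?_
      simp only [map_smul, map_sub, Finsupp.linearCombination_single, one_smul]
      rw [hn (c.front i.succ) (by simp [front, hw]), hn (c.back i.succ) (by simp [back, hw])]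
      simp
  have hcons : (Fin.cons w (c.v ∘ (0 : Fin (n + 1)).succAbove) : Fin (n + 1) → V) = c.v := by
    funext x
    refine Fin.cases ?_ (fun x => ?_) x <;> simp [hw]
  have hb : (c.back 0).Extends w := by
    refine ⟨fun i => ?_, ?_⟩
    · rw [← hw]
      exact c.mono (by simp)
    · change Spans L (Fin.cons w (c.v ∘ (0 : Fin (n + 1)).succAbove) : Fin (n + 1) → V)
      rw [hcons]
      exact c.spans
  have hf : (c.front 0).Extends w := hb
  have hfa : (c.front 0).a w = c.a w + 1 := by simp [front, hw]
  rw [h0, add_zero]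
  simp only [Fin.val_zero, pow_zero, one_smul, map_sub, Finsupp.linearCombination_single]
  rw [push, push, dif_pos hf, dif_pos hb, hfa, intSum_succ]
  have hk : ∀ k, (c.front 0).thicken k hf = (c.back 0).thicken k hb := fun k => by
    refine thicken_congr hf hb ?_ ?_ rfl
    · funext x
      rcases eq_or_ne x w with rfl | hx
      · simp
      · simp [front, back, hx, hw]
    · rw [hfa]
      change c.m + 1 - (c.a w + 1) = c.m - c.a w
      ring
  simp only [hk]
  rw [show (c.back 0).a w = c.a w from rfl, add_sub_cancel_left]
  congr 1
  exact Cube.ext (Function.update_eq_self _ _) (by simp [thicken, back]) hcons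

/-- The cubes that lie in the flat `F`. -/
def inFlat (F : Flat L) (n : ℕ) : Set (Cube L n) := Set.ofPred fun c => c.flat ≤ F

theorem extends_of_flat_le {F : Flat L} {c : Cube L n} (hc : c.flat ≤ F) (hw : w ∈ F.s)
    (h : ∀ i, w < c.v i) : c.Extends w := by
  refine ⟨h, spans_of_mem F.isSimplex fun i => ?_⟩
  refine Fin.cases ?_ (fun i => ?_) i
  · simpa using hw
  · simpa using (mem_flat_iff.1 hc).1 i

theorem thicken_flat_le {F : Flat L} {c : Cube L n} (hc : c.flat ≤ F) (hw : w ∈ F.s)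
    (h : c.Extends w) (k : ℤ) : (c.thicken k h).flat ≤ F := by
  obtain ⟨h1, h2, h3⟩ := mem_flat_iff.1 hc
  refine mem_flat_iff.2 ⟨fun i => ?_, fun v hv => ?_, ?_⟩
  · refine Fin.cases ?_ (fun i => ?_) i
    · simpa [thicken] using hw
    · simpa [thicken] using h1 i
  · have : v ≠ w := fun e => hv (e ▸ hw)
    simp [thicken, this, h2 v hv]
  · simp only [thicken, h3]
    rw [← Finset.add_sum_erase _ _ hw, ← Finset.add_sum_erase _ _ hw]
    simp only [Function.update_self]
    have : ∑ x ∈ F.s.erase w, (Function.update c.a w k x - F.a x) =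
        ∑ x ∈ F.s.erase w, (c.a x - F.a x) :=
      Finset.sum_congr rfl fun x hx => by
        rw [Function.update_of_ne (Finset.ne_of_mem_erase hx)]
    rw [this]
    ring

theorem push_mem {F : Flat L} {c : Cube L n} (hc : c.flat ≤ F) (hw : w ∈ F.s) (a₀ : ℤ) :
    push w a₀ c ∈ Finsupp.supported ℤ ℤ (inFlat F (n + 1)) := by
  unfold push
  split_ifs with h
  · exact intSum_mem _ _ (fun k => Finsupp.single_mem_supported ℤ 1
      (show c.thicken k h ∈ inFlat F (n + 1) from thicken_flat_le hc hw h k)) _ _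
  · exact Submodule.zero_mem _

theorem slide_flat_le {s : Finset V} {hs : IsSimplex L s} (hws : w ∉ s)
    {hs' : IsSimplex L (insert w s)} {a : V → ℤ} {m : ℤ} {c : Cube L n}
    (hc : c.flat ≤ ⟨a, m, insert w s, hs'⟩) (h : c.Extends w) :
    (c.slide w (a w)).flat ≤ ⟨a, m, s, hs⟩ := by
  obtain ⟨h1, h2, h3⟩ := mem_flat_iff.1 hc
  refine mem_flat_iff.2 ⟨fun i => Finset.mem_of_mem_insert_of_ne (h1 i) (h.1 i).ne',
    fun v hv => ?_, ?_⟩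
  · rcases eq_or_ne v w with rfl | hvw
    · simp [slide]
    · simpa [slide, hvw] using h2 v (by simp [hvw]; exact hv)
  · rw [Finset.sum_insert hws] at h3
    simp only [slide, h3]
    have : ∑ x ∈ s, (Function.update c.a w (a w) x - a x) = ∑ x ∈ s, (c.a x - a x) :=
      Finset.sum_congr rfl fun x hx => by
        rw [Function.update_of_ne (fun e : x = w => hws (e ▸ hx))]
    rw [this]
    ring

/-- The cubes in a flat span an acyclic complex: contract one direction after the other, the
least one first. -/
theorem exists_filling (s : Finset V) : ∀ (hs : IsSimplex L s) (a : V → ℤ) (m : ℤ) (n : ℕ)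
    (z : Cube L n →₀ ℤ), z ∈ Finsupp.supported ℤ ℤ (inFlat ⟨a, m, s, hs⟩ n) →
      (complex L).IsCycle n z → ∃ y ∈ Finsupp.supported ℤ ℤ
        (inFlat ⟨a, m, s, hs⟩ (n + 1)), Finsupp.linearCombination ℤ (bd n) y = z := by
  induction s using Finset.induction_on_min with
  | empty =>
    -- the flat is a lattice point, and carries a single cube, of dimension `0`
    intro hs a m n z hz hc
    refine ⟨0, Submodule.zero_mem _, ?_⟩
    rw [map_zero, eq_comm]
    rw [Finsupp.mem_supported] at hz
    cases n with
    | succ n =>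
      refine Finsupp.support_eq_empty.1 (Finset.eq_empty_of_forall_notMem fun c hc => ?_)
      simpa using (mem_flat_iff.1 (hz hc)).1 0
    | zero =>
      have huniq : ∀ c ∈ z.support, c = ⟨a, m, Fin.elim0, fun i => i.elim0,
          spans_of_mem (Or.inl rfl : IsSimplex L ∅) fun i => i.elim0⟩ := fun c hc => by
        obtain ⟨-, h2, h3⟩ := mem_flat_iff.1 (hz hc)
        exact Cube.ext (funext fun v => h2 v (by simp)) (by simpa using h3)
          (funext fun i => i.elim0)
      have : z = Finsupp.single ⟨a, m, Fin.elim0, fun i => i.elim0,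
          spans_of_mem (Or.inl rfl : IsSimplex L ∅) fun i => i.elim0⟩ (z ⟨a, m, Fin.elim0,
            fun i => i.elim0, spans_of_mem (Or.inl rfl : IsSimplex L ∅) fun i => i.elim0⟩) := by
        classical
        refine Finsupp.ext fun c => ?_
        rw [Finsupp.single_apply]
        split_ifs with h
        · rw [h]
        · exact Finsupp.notMem_support_iff.1 fun hc => h (huniq c hc).symm
      have h0 : Finsupp.linearCombination ℤ (fun _ => (1 : ℤ)) z = 0 := hc
      rw [this, Finsupp.linearCombination_single, smul_eq_mul, mul_one] at h0
      rw [this, h0, Finsupp.single_zero]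
  | insert w s hws ih =>
    intro hs a m n z hz hc
    have hw : w ∉ s := fun h => (hws w h).false
    have hs' : IsSimplex L s := hs.subset (Finset.subset_insert w s)
    have hle : (⟨a, m, s, hs'⟩ : Flat L) ≤ ⟨a, m, insert w s, hs⟩ :=
      ⟨Finset.subset_insert w s, fun _ _ => rfl, by simp⟩
    have hz' := (Finsupp.mem_supported ℤ z).1 hz
    classical
    -- the projection along `w`: cubes with an edge in direction `w` become degenerate
    let p : Cube L n → (Cube L n →₀ ℤ) := fun c =>
      if c.Extends w then Finsupp.single (c.slide w (a w)) 1 else 0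
    have hp : ∀ c ∈ z.support, p c ∈ Finsupp.supported ℤ ℤ
        (inFlat ⟨a, m, s, hs'⟩ n) := fun c hc => by
      simp only [p]
      split_ifs with h
      · exact Finsupp.single_mem_supported ℤ 1
          (show c.slide w (a w) ∈ inFlat ⟨a, m, s, hs'⟩ n from slide_flat_le hw (hz' hc) h)
      · exact Submodule.zero_mem _
    have hid : Finsupp.linearCombination ℤ (fun b => Finsupp.single b (1 : ℤ)) z = z :=
      (linearMap_eq_linearCombination LinearMap.id _ (fun _ => rfl) z).symm
    have hpush := linearCombination_mem_of_support (push w (a w)) z _ fun c hc =>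
      push_mem (hz' hc) (Finset.mem_insert_self w s) (a w)
    have hp' := linearCombination_mem_of_support p z _ hp
    -- the chain `z` is homologous to its projection
    have key : Finsupp.linearCombination ℤ (bd n)
        (Finsupp.linearCombination ℤ (push w (a w)) z) = z - Finsupp.linearCombination ℤ p z := by
      rw [BasedComplex.lin_lin]
      cases n with
      | zero =>
        rw [linearCombination_congr z (g := (fun c => Finsupp.single c (1 : ℤ)) - p)
          (fun c hc => ?_), BasedComplex.lin_sub, hid]
        have he : c.Extends w :=
          extends_of_flat_le (hz' hc) (Finset.mem_insert_self w s) fun i => i.elim0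
        rw [d_push _ _ he]
        simp [p, he]
      | succ n =>
        rw [linearCombination_congr z (g := ((fun c => Finsupp.single c (1 : ℤ)) - p) -
          fun c => Finsupp.linearCombination ℤ (push w (a w)) (bd n c)) (fun c hc => ?_),
          BasedComplex.lin_sub, BasedComplex.lin_sub, hid, ← BasedComplex.lin_lin,
          show Finsupp.linearCombination ℤ (bd n) z = 0 from hc, map_zero, sub_zero]
        rw [Pi.sub_apply, Pi.sub_apply, eq_sub_iff_add_eq]
        -- as `w` is the least direction, a cube has an edge along `w` only as its first edge
        by_cases h0 : c.v 0 = w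
        · have he : ¬ c.Extends w := fun h => (h.1 0).ne h0.symm
          rw [push_homotopy_of_eq _ _ h0]
          simp [p, he]
        · have he : c.Extends w := by
            refine extends_of_flat_le (hz' hc) (Finset.mem_insert_self w s) fun i => ?_
            have h0s : w < c.v 0 :=
              hws _ (Finset.mem_of_mem_insert_of_ne ((mem_flat_iff.1 (hz' hc)).1 0) h0)
            exact h0s.trans_le (c.mono.monotone (Fin.zero_le i))
          rw [push_homotopy_of_extends _ _ he]
          simp [p, he]
    have hcyc : (complex L).IsCycle n (Finsupp.linearCombination ℤ p z) := by
      have h1 := (complex L).isCycle_d n (Finsupp.linearCombination ℤ (push w (a w)) z)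
      have h2 : (complex L).d n (Finsupp.linearCombination ℤ (push w (a w)) z) =
        z - Finsupp.linearCombination ℤ p z := key
      rw [h2] at h1
      exact (complex L).isCycle_of_sub hc h1
    obtain ⟨y, hy, hyd⟩ := ih hs' a m n _ hp' hcyc
    refine ⟨y + Finsupp.linearCombination ℤ (push w (a w)) z,
      Submodule.add_mem _ (Finsupp.supported_mono (fun c hc => ?_) hy) hpush, ?_⟩
    · exact le_trans (Set.mem_ofPred.1 hc) hle
    · rw [map_add, hyd, key, add_sub_cancel]

theorem bd_vadd (n : ℕ) (g : (V → ℤ) × ℤ) (c : Cube L (n + 1)) :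
    bd n (g +ᵥ c) = Finsupp.mapDomain (g +ᵥ ·) (bd n c) := by
  rw [← Finsupp.lmapDomain_apply ℤ ℤ, bd, bd, map_sum]
  simp only [map_smul, map_sub, Finsupp.lmapDomain_apply, Finsupp.mapDomain_single, vadd_front,
    vadd_back]

variable (L) in
/-- The cubical chains, with the flats as carriers. -/
def carried : CarriedComplex.{u} ((V → ℤ) × ℤ) (Flat L) where
  toBasedComplex := complex L
  act _ := inferInstanceAs (AddAction ((V → ℤ) × ℤ) (Cube L _))
  bd_vadd := bd_vadd
  gr c := (Cube.a c, Cube.m c)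
  gr_vadd _ _ := rfl
  Mem F _ c := Cube.flat c ≤ F
  mem_mono h hc := hc.trans h
  mem_vadd g h := Flat.vadd_le g h
  fl c := Cube.flat c
  mem_fl _ := le_rfl
  fl_le h := h
  mem_bd {F n c} h c' hc' := by
    obtain ⟨i, rfl | rfl⟩ := mem_bd_support hc'
    · exact (front_flat_le c i).trans h
    · exact (back_flat_le c i).trans h
  nonempty F := ⟨⟨F.a, F.m, Fin.elim0, fun i => i.elim0,
    spans_of_mem F.isSimplex fun i => i.elim0⟩, mem_flat_iff.2 ⟨fun i => i.elim0, fun _ _ => rfl,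
      by simp⟩⟩
  acyclic F n z hz hc := exists_filling F.s F.isSimplex F.a F.m n z hz hc

end Cube

end cubes

/-! ### Cones of functions on simplices -/

section cone
variable {n : ℕ}

/-- The inclusion of the `i`-th face of the standard simplex. -/
def faceMap (i : Fin (n + 2)) :
    C(stdSimplex ℝ (Fin (n + 1)), stdSimplex ℝ (Fin (n + 2))) :=
  ⟨stdSimplex.map i.succAbove, stdSimplex.continuous_map _⟩

theorem faceMap_succAbove (i : Fin (n + 2)) (z : stdSimplex ℝ (Fin (n + 1))) (j : Fin (n + 1)) :
    faceMap i z (i.succAbove j) = z j := by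
  change FunOnFinite.linearMap ℝ ℝ i.succAbove z (i.succAbove j) = z j
  rw [FunOnFinite.linearMap_apply_apply]
  rw [Finset.sum_eq_single j (fun b hb hbj => ?_) (by simp)]
  exact absurd (Fin.succAbove_right_injective (Finset.mem_filter.1 hb).2) hbj

theorem faceMap_self (i : Fin (n + 2)) (z : stdSimplex ℝ (Fin (n + 1))) : faceMap i z i = 0 := by
  change FunOnFinite.linearMap ℝ ℝ i.succAbove z i = 0
  rw [FunOnFinite.linearMap_apply_apply]
  refine Finset.sum_eq_zero fun b hb => ?_
  exact absurd (Finset.mem_filter.1 hb).2 (Fin.succAbove_ne i b)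

theorem faceMap_comm {i j : Fin (n + 2)} (h : i ≤ j) (z : stdSimplex ℝ (Fin (n + 1))) :
    faceMap j.succ (faceMap i z) = faceMap i.castSucc (faceMap j z) := by
  change stdSimplex.map _ (stdSimplex.map _ z) = stdSimplex.map _ (stdSimplex.map _ z)
  rw [stdSimplex.map_comp_apply, stdSimplex.map_comp_apply]
  congr 1
  funext x
  exact succAbove_comm h x

open Classical in
/-- The projection of a simplex from its vertex `0` to the opposite face, with an arbitrary value
at the vertex. -/
def coneProj (z : stdSimplex ℝ (Fin (n + 2))) : stdSimplex ℝ (Fin (n + 1)) :=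
  if h : z 0 < 1 then ⟨fun j => z j.succ / (1 - z 0), fun j =>
    div_nonneg (stdSimplex.zero_le z _) (by linarith), by
      rw [← Finset.sum_div, div_eq_one_iff_eq (by linarith), eq_sub_iff_add_eq, add_comm]
      exact (Fin.sum_univ_succ z).symm.trans (stdSimplex.sum_eq_one z)⟩
  else stdSimplex.vertex 0

theorem coneProj_apply {z : stdSimplex ℝ (Fin (n + 2))} (h : z 0 < 1) (j : Fin (n + 1)) :
    coneProj z j = z j.succ / (1 - z 0) := by
  rw [coneProj, dif_pos h]; rfl

theorem continuousAt_coneProj {z : stdSimplex ℝ (Fin (n + 2))} (h : z 0 < 1) :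
    ContinuousAt (coneProj (n := n)) z := by
  have hc : ∀ j : Fin (n + 2), Continuous fun z : stdSimplex ℝ (Fin (n + 2)) => z j := fun j =>
    (continuous_apply j).comp continuous_subtype_val
  rw [Topology.IsInducing.subtypeVal.continuousAt_iff]
  have h1 : ContinuousAt (fun (z : stdSimplex ℝ (Fin (n + 2))) (j : Fin (n + 1)) =>
      z j.succ / (1 - z 0)) z :=
    continuousAt_pi.2 fun j => (hc _).continuousAt.div
      (continuous_const.sub (hc 0)).continuousAt (by linarith)
  refine h1.congr ?_
  filter_upwards [(isOpen_lt (hc 0) continuous_const).mem_nhds h] with y hy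
  exact funext fun j => (coneProj_apply hy j).symm

/-- The cone on a function: it is `0` at the vertex `0`, equal to `f` on the opposite face, and
affine on the segments between them. -/
def cone (f : C(stdSimplex ℝ (Fin (n + 1)), ℝ)) : C(stdSimplex ℝ (Fin (n + 2)), ℝ) where
  toFun z := (1 - z 0) * f (coneProj z)
  continuous_toFun := by
    have hc : Continuous fun z : stdSimplex ℝ (Fin (n + 2)) => z 0 :=
      (continuous_apply 0).comp continuous_subtype_val
    refine continuous_iff_continuousAt.2 fun z => ?_
    rcases (stdSimplex.le_one z 0).lt_or_eq with h | h
    · exact (continuous_const.sub hc).continuousAt.mul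
        (f.continuous.continuousAt.comp (continuousAt_coneProj h))
    · -- near the vertex, use that `f` is bounded
      have h0 : Filter.Tendsto (fun y : stdSimplex ℝ (Fin (n + 2)) => ‖f‖ * (1 - y 0))
          (nhds z) (nhds 0) := by
        have h1 : Filter.Tendsto (fun y : stdSimplex ℝ (Fin (n + 2)) => ‖f‖ * (1 - y 0))
            (nhds z) (nhds (‖f‖ * (1 - z 0))) :=
          (continuous_const.mul (continuous_const.sub hc)).tendsto z
        rwa [h, sub_self, mul_zero] at h1
      change Filter.Tendsto _ (nhds z) (nhds ((1 - z 0) * f (coneProj z)))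
      rw [h, sub_self, zero_mul]
      refine squeeze_zero_norm (fun y => ?_) h0
      have hy : 0 ≤ 1 - y 0 := sub_nonneg.2 (stdSimplex.le_one y 0)
      rw [norm_mul, mul_comm, Real.norm_of_nonneg hy]
      exact mul_le_mul_of_nonneg_right (f.norm_coe_le_norm _) hy

theorem cone_apply (f : C(stdSimplex ℝ (Fin (n + 1)), ℝ)) (z : stdSimplex ℝ (Fin (n + 2))) :
    cone f z = (1 - z 0) * f (coneProj z) := rfl

theorem cone_faceMap_zero (f : C(stdSimplex ℝ (Fin (n + 1)), ℝ))
    (z : stdSimplex ℝ (Fin (n + 1))) : cone f (faceMap 0 z) = f z := by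
  have h0 : faceMap 0 z 0 = 0 := faceMap_self 0 z
  have h1 : coneProj (faceMap 0 z) = z := by
    ext j
    rw [coneProj_apply (by rw [h0]; exact one_pos), h0, sub_zero, div_one]
    exact faceMap_succAbove 0 z j
  rw [cone_apply, h0, h1, sub_zero, one_mul]

theorem faceMap_succ_zero (i : Fin (n + 2)) (z : stdSimplex ℝ (Fin (n + 2))) :
    faceMap i.succ z 0 = z 0 := by
  simpa using faceMap_succAbove i.succ z 0

theorem coneProj_faceMap_succ (i : Fin (n + 2)) {z : stdSimplex ℝ (Fin (n + 2))} (h : z 0 < 1) :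
    coneProj (faceMap i.succ z) = faceMap i (coneProj z) := by
  have h0 := faceMap_succ_zero i z
  ext j
  rw [coneProj_apply (by rw [h0]; exact h), h0]
  rcases Fin.eq_self_or_eq_succAbove i j with rfl | ⟨k, rfl⟩
  · rw [faceMap_self, faceMap_self, zero_div]
  · rw [faceMap_succAbove, coneProj_apply h]
    congr 1
    rw [← faceMap_succAbove i.succ z k.succ, Fin.succ_succAbove_succ]

theorem cone_faceMap_succ (f : C(stdSimplex ℝ (Fin (n + 2)), ℝ)) (i : Fin (n + 2))
    (z : stdSimplex ℝ (Fin (n + 2))) :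
    cone f (faceMap i.succ z) = cone (f.comp (faceMap i)) z := by
  rw [cone_apply, cone_apply, faceMap_succ_zero]
  rcases (stdSimplex.le_one z 0).lt_or_eq with h | h
  · rw [coneProj_faceMap_succ i h]; rfl
  · rw [h, sub_self, zero_mul, zero_mul]

theorem cone_faceMap_one (f : C(stdSimplex ℝ (Fin 1), ℝ)) (z : stdSimplex ℝ (Fin 1)) :
    cone f (faceMap 1 z) = 0 := by
  have : faceMap 1 z 0 = 1 := by
    rw [← stdSimplex.sum_eq_one z, Fin.sum_univ_one]
    exact faceMap_succAbove 1 z 0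
  rw [cone_apply, this, sub_self, zero_mul]

end cone

/-! ### Lifts of singular simplices to the universal abelian cover -/

section lifts
variable {V : Type u} {L : PreAbstractSimplicialComplex V} {n : ℕ}

/-- The flat `F` contains the image of the singular simplex with coordinates `θ` and
height `h`. -/
def Flat.Contains (F : Flat L) (θ : V → C(stdSimplex ℝ (Fin (n + 1)), ℝ))
    (h : C(stdSimplex ℝ (Fin (n + 1)), ℝ)) : Prop :=
  (∀ v ∉ F.s, ∀ z, θ v z = F.a v) ∧ ∀ z, h z = F.m + ∑ v ∈ F.s, (θ v z - F.a v)

variable (L) in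
/-- A singular simplex in a flat of the universal abelian cover of `T_L`, given by its coordinates
`θ`, together with the height function `h`. The unit of length is a full turn of the circle. -/
@[ext] structure Lift (n : ℕ) where
  /-- The coordinates. -/
  θ : V → C(stdSimplex ℝ (Fin (n + 1)), ℝ)
  /-- The height, the sum of the coordinates up to an integer. -/
  h : C(stdSimplex ℝ (Fin (n + 1)), ℝ)
  exists_flat : ∃ F : Flat L, F.Contains θ h

theorem Flat.Contains.mono {F F' : Flat L} (hF : F ≤ F')
    {θ : V → C(stdSimplex ℝ (Fin (n + 1)), ℝ)} {h : C(stdSimplex ℝ (Fin (n + 1)), ℝ)}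
    (H : F.Contains θ h) : F'.Contains θ h := by
  refine ⟨fun v hv z => ?_, fun z => ?_⟩
  · rw [H.1 v (fun h => hv (hF.1 h)), hF.2.1 v hv]
  · rw [H.2, hF.2.2, Finset.sum_subset hF.1 fun v _ hv => by rw [H.1 v hv, sub_self]]
    push_cast
    rw [add_assoc, ← Finset.sum_add_distrib]
    congr 1
    exact Finset.sum_congr rfl fun v _ => by ring

namespace Lift

/-- The `i`-th face. -/
def face (i : Fin (n + 2)) (x : Lift L (n + 1)) : Lift L n where
  θ v := (x.θ v).comp (faceMap i)
  h := x.h.comp (faceMap i)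
  exists_flat := by
    obtain ⟨F, hF⟩ := x.exists_flat
    exact ⟨F, fun v hv z => hF.1 v hv _, fun z => hF.2 _⟩

variable (L) in
/-- The chains on the singular simplices in flats. -/
def complex : BasedComplex.{u} :=
  BasedComplex.ofFaces (Lift L) (fun _ => face) fun n i j x hij => by
    refine Lift.ext (funext fun v => ?_) ?_ <;> ext z
    · exact congrArg (x.θ v) (faceMap_comm hij z)
    · exact congrArg x.h (faceMap_comm hij z)

/-- The lattice and the deck transformations act by translation. -/
instance : AddAction ((V → ℤ) × ℤ) (Lift L n) where
  vadd g x :=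
    { θ := fun v => ContinuousMap.const _ (g.1 v : ℝ) + x.θ v
      h := ContinuousMap.const _ (g.2 : ℝ) + x.h
      exists_flat := by
        obtain ⟨F, hF⟩ := x.exists_flat
        refine ⟨g +ᵥ F, fun v hv z => ?_, fun z => ?_⟩
        · change (g.1 v : ℝ) + x.θ v z = ((g.1 v + F.a v : ℤ) : ℝ)
          rw [hF.1 v hv z]; push_cast; ring
        · change (g.2 : ℝ) + x.h z = ((g.2 + F.m : ℤ) : ℝ) +
            ∑ v ∈ F.s, ((g.1 v : ℝ) + x.θ v z - ((g.1 v + F.a v : ℤ) : ℝ))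
          rw [hF.2 z]; push_cast
          simp only [add_sub_add_left_eq_sub, add_assoc] }
  zero_vadd x := by
    refine Lift.ext (funext fun v => ?_) ?_ <;> ext z
    · change ((0 : ℤ) : ℝ) + x.θ v z = _; simp
    · change ((0 : ℤ) : ℝ) + x.h z = _; simp
  add_vadd g g' x := by
    refine Lift.ext (funext fun v => ?_) ?_ <;> ext z
    · change ((g.1 v + g'.1 v : ℤ) : ℝ) + x.θ v z = (g.1 v : ℝ) + ((g'.1 v : ℝ) + x.θ v z)
      push_cast; ring
    · change ((g.2 + g'.2 : ℤ) : ℝ) + x.h z = (g.2 : ℝ) + ((g'.2 : ℝ) + x.h z)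
      push_cast; ring

theorem vadd_h (g : (V → ℤ) × ℤ) (x : Lift L n) (z : stdSimplex ℝ (Fin (n + 1))) :
    (g +ᵥ x).h z = g.2 + x.h z := rfl

theorem contains_vadd {F : Flat L} (g : (V → ℤ) × ℤ) {x : Lift L n} (hF : F.Contains x.θ x.h) :
    (g +ᵥ F).Contains (g +ᵥ x).θ (g +ᵥ x).h := by
  refine ⟨fun v hv z => ?_, fun z => ?_⟩
  · change (g.1 v : ℝ) + x.θ v z = ((g.1 v + F.a v : ℤ) : ℝ)
    rw [hF.1 v hv z]; push_cast; ring
  · change (g.2 : ℝ) + x.h z = ((g.2 + F.m : ℤ) : ℝ) +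
      ∑ v ∈ F.s, ((g.1 v : ℝ) + x.θ v z - ((g.1 v + F.a v : ℤ) : ℝ))
    rw [hF.2 z]; push_cast
    simp only [add_sub_add_left_eq_sub, add_assoc]

open Classical in
/-- The least flat that contains a given singular simplex: its directions are those in which the
simplex is not constant with integer value. -/
def fl (x : Lift L n) : Flat L :=
  let F := x.exists_flat.choose
  { a := fun v => ⌊x.θ v (stdSimplex.vertex 0)⌋
    m := F.m + ∑ v ∈ F.s, (⌊x.θ v (stdSimplex.vertex 0)⌋ - F.a v)
    s := F.s.filter fun v => ¬ ∃ k : ℤ, ∀ z, x.θ v z = k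
    isSimplex := F.isSimplex.subset (Finset.filter_subset _ _) }

theorem θ_eq_floor {x : Lift L n} {v : V} (h : ∃ k : ℤ, ∀ z, x.θ v z = k)
    (z : stdSimplex ℝ (Fin (n + 1))) : x.θ v z = ⌊x.θ v (stdSimplex.vertex 0)⌋ := by
  obtain ⟨k, hk⟩ := h
  rw [hk, hk, Int.floor_intCast]

theorem fl_contains (x : Lift L n) : x.fl.Contains x.θ x.h := by
  classical
  have hF := x.exists_flat.choose_spec
  set F := x.exists_flat.choose with hFdef
  have h1 : ∀ v ∉ x.fl.s, ∀ z, x.θ v z = x.fl.a v := fun v hv z => by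
    refine θ_eq_floor ?_ z
    by_contra hk
    by_cases hvF : v ∈ F.s
    · exact hv (Finset.mem_filter.2 ⟨hvF, hk⟩)
    · exact hk ⟨F.a v, hF.1 v hvF⟩
  refine ⟨h1, fun z => ?_⟩
  have hs : x.fl.s ⊆ F.s := Finset.filter_subset _ F.s
  rw [hF.2, Finset.sum_subset hs fun v _ hv => by rw [h1 v hv, sub_self]]
  change _ = ((F.m + ∑ v ∈ F.s, (x.fl.a v - F.a v) : ℤ) : ℝ) + _
  push_cast
  rw [add_assoc, ← Finset.sum_add_distrib]
  congr 1
  exact Finset.sum_congr rfl fun v _ => by ring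

theorem fl_le {F : Flat L} {x : Lift L n} (hF : F.Contains x.θ x.h) : x.fl ≤ F := by
  classical
  have hs : x.fl.s ⊆ F.s := fun v hv => by
    by_contra hvF
    exact (Finset.mem_filter.1 hv).2 ⟨F.a v, hF.1 v hvF⟩
  have hx := x.fl_contains
  refine ⟨hs, fun v hv => ?_, ?_⟩
  · have := hF.1 v hv (stdSimplex.vertex 0)
    rw [hx.1 v fun h => hv (hs h)] at this
    exact_mod_cast this
  · have h1 := hx.2 (stdSimplex.vertex 0)
    rw [hF.2, Finset.sum_subset hs fun v _ hv => by rw [hx.1 v hv, sub_self]] at h1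
    have h2 : (x.fl.m : ℝ) = F.m + ∑ v ∈ F.s, ((x.fl.a v : ℝ) - F.a v) := by
      rw [← sub_eq_iff_eq_add] at h1
      rw [← h1, add_sub_assoc, ← Finset.sum_sub_distrib]
      congr 1
      exact Finset.sum_congr rfl fun v _ => by ring
    exact_mod_cast h2

open Classical in
/-- The cone on a singular simplex in the flat `F` with the lattice point of `F` as apex; for other
simplices a junk value. -/
def coneTo (F : Flat L) (x : Lift L n) : Lift L (n + 1) :=
  if hF : F.Contains x.θ x.h then
    { θ := fun v => ContinuousMap.const _ (F.a v : ℝ) +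
        cone (x.θ v - ContinuousMap.const _ (F.a v : ℝ))
      h := ContinuousMap.const _ (F.m : ℝ) + cone (x.h - ContinuousMap.const _ (F.m : ℝ))
      exists_flat := ⟨F, fun v hv z => by simp [cone_apply, hF.1 v hv], fun z => by
        simp only [cone_apply, hF.2, Finset.mul_sum, ContinuousMap.add_apply,
          ContinuousMap.const_apply, ContinuousMap.sub_apply, add_sub_cancel_left]⟩ }
  else
    { θ := fun v => ContinuousMap.const _ (F.a v : ℝ)
      h := ContinuousMap.const _ (F.m : ℝ)
      exists_flat := ⟨F, fun v hv z => rfl, fun z => by simp⟩ }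

variable {F : Flat L} {x : Lift L n}

theorem coneTo_θ (hF : F.Contains x.θ x.h) (v : V) (z : stdSimplex ℝ (Fin (n + 2))) :
    (x.coneTo F).θ v z = F.a v + cone (x.θ v - ContinuousMap.const _ (F.a v : ℝ)) z := by
  rw [coneTo, dif_pos hF]; rfl

theorem coneTo_h (hF : F.Contains x.θ x.h) (z : stdSimplex ℝ (Fin (n + 2))) :
    (x.coneTo F).h z = F.m + cone (x.h - ContinuousMap.const _ (F.m : ℝ)) z := by
  rw [coneTo, dif_pos hF]; rfl

theorem contains_coneTo (hF : F.Contains x.θ x.h) :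
    F.Contains (x.coneTo F).θ (x.coneTo F).h :=
  ⟨fun v hv z => by simp [coneTo_θ hF, cone_apply, hF.1 v hv], fun z => by
    simp only [coneTo_θ hF, coneTo_h hF, cone_apply, hF.2, Finset.mul_sum,
      ContinuousMap.const_apply, ContinuousMap.sub_apply, add_sub_cancel_left]⟩

theorem face_zero_coneTo (hF : F.Contains x.θ x.h) : (x.coneTo F).face 0 = x := by
  refine Lift.ext (funext fun v => ?_) ?_ <;> ext z
  · change (x.coneTo F).θ v (faceMap 0 z) = _
    rw [coneTo_θ hF, cone_faceMap_zero]; simp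
  · change (x.coneTo F).h (faceMap 0 z) = _
    rw [coneTo_h hF, cone_faceMap_zero]; simp

theorem face_succ_coneTo {x : Lift L (n + 1)} (hF : F.Contains x.θ x.h) (i : Fin (n + 2)) :
    (x.coneTo F).face i.succ = (x.face i).coneTo F := by
  have hF' : F.Contains (x.face i).θ (x.face i).h :=
    ⟨fun v hv z => hF.1 v hv _, fun z => hF.2 _⟩
  refine Lift.ext (funext fun v => ?_) ?_ <;> ext z
  · change (x.coneTo F).θ v (faceMap i.succ z) = _
    rw [coneTo_θ hF, cone_faceMap_succ, coneTo_θ hF']; rfl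
  · change (x.coneTo F).h (faceMap i.succ z) = _
    rw [coneTo_h hF, cone_faceMap_succ, coneTo_h hF']; rfl

/-- The lattice point of a flat, as a `0`-simplex. -/
def apex (F : Flat L) : Lift L 0 where
  θ v := ContinuousMap.const _ (F.a v : ℝ)
  h := ContinuousMap.const _ (F.m : ℝ)
  exists_flat := ⟨F, fun v hv z => rfl, fun z => by simp⟩

theorem face_one_coneTo {x : Lift L 0} (hF : F.Contains x.θ x.h) :
    (x.coneTo F).face 1 = apex F := by
  refine Lift.ext (funext fun v => ?_) ?_ <;> ext z
  · change (x.coneTo F).θ v (faceMap 1 z) = F.a v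
    rw [coneTo_θ hF, cone_faceMap_one, add_zero]
  · change (x.coneTo F).h (faceMap 1 z) = F.m
    rw [coneTo_h hF, cone_faceMap_one, add_zero]

theorem alternatingFaces_coneTo_zero {x : Lift L 0} (hF : F.Contains x.θ x.h) :
    alternatingFaces (fun i => (x.coneTo F).face i) =
      Finsupp.single x 1 - Finsupp.single (apex F) 1 := by
  rw [alternatingFaces_cone (c := fun _ : Unit => apex F) (g := fun _ : Fin 1 => ())
    (face_zero_coneTo hF) (Fin.forall_fin_one.2 (face_one_coneTo hF)), lin_alternatingFaces]
  simp

theorem alternatingFaces_coneTo {x : Lift L (n + 1)} (hF : F.Contains x.θ x.h) :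
    alternatingFaces (fun i => (x.coneTo F).face i) = Finsupp.single x 1 -
      Finsupp.linearCombination ℤ (fun y : Lift L n => Finsupp.single (y.coneTo F) 1)
        (alternatingFaces fun i => x.face i) :=
  alternatingFaces_cone (face_zero_coneTo hF) (face_succ_coneTo hF)

theorem alternatingFaces_vadd (g : (V → ℤ) × ℤ) (x : Lift L (n + 1)) :
    alternatingFaces (fun i => (g +ᵥ x).face i) =
      Finsupp.mapDomain (fun y : Lift L n => g +ᵥ y) (alternatingFaces fun i => x.face i) :=
  (mapDomain_alternatingFaces (fun y : Lift L n => g +ᵥ y) fun i => x.face i).symm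

theorem exists_flat_filling (F : Flat L) (n : ℕ) (z : Lift L n →₀ ℤ)
    (hz : ∀ x ∈ z.support, F.Contains x.θ x.h) (hc : (complex L).IsCycle n z) :
    ∃ w : Lift L (n + 1) →₀ ℤ, (∀ x ∈ w.support, F.Contains x.θ x.h) ∧ (complex L).d n w = z :=
  BasedComplex.exists_of_cone (complex L) (fun _ => Set.ofPred fun x =>
    F.Contains x.θ x.h) (fun _ x => coneTo F x) (apex F) (fun _ x hx => contains_coneTo (x := x) hx)
    (fun x hx => alternatingFaces_coneTo_zero (x := x) hx)
    (fun _ x hx => alternatingFaces_coneTo (x := x) hx) n z hz hc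

variable (L) in
/-- The chains on the singular simplices in flats, with the flats as carriers. -/
def carried : CarriedComplex.{u} ((V → ℤ) × ℤ) (Flat L) where
  toBasedComplex := complex L
  act _ := inferInstanceAs (AddAction ((V → ℤ) × ℤ) (Lift L _))
  bd_vadd n g (x : Lift L (n + 1)) := alternatingFaces_vadd g x
  gr {n} (x : Lift L n) := (fun v => ⌊x.θ v (stdSimplex.vertex 0)⌋, ⌊x.h (stdSimplex.vertex 0)⌋)
  gr_vadd {n} g (x : Lift L n) := by
    refine Prod.ext (funext fun v => ?_) ?_
    · exact Int.floor_intCast_add (g.1 v) (x.θ v (stdSimplex.vertex 0))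
    · exact Int.floor_intCast_add g.2 (x.h (stdSimplex.vertex 0))
  Mem F {n} (x : Lift L n) := F.Contains x.θ x.h
  mem_mono h hx := hx.mono h
  mem_vadd g h := contains_vadd g h
  fl {n} (x : Lift L n) := x.fl
  mem_fl {n} (x : Lift L n) := x.fl_contains
  fl_le h := fl_le h
  mem_bd {F n} (x : Lift L (n + 1)) h x' hx' := by
    obtain ⟨i, rfl⟩ := mem_support_alternatingFaces hx'
    exact ⟨fun v hv z => h.1 v hv _, fun z => h.2 _⟩
  nonempty F := ⟨apex F, fun v hv z => rfl, fun z => by simp [apex]⟩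
  acyclic F := exists_flat_filling F

end Lift

end lifts

/-! ### Barycentric subdivision -/

section subdivision
variable {ι κ : Type} [Fintype ι] [Fintype κ]

/-- The convex combination of the points `p j` with weights `z j`. -/
def comb (p : κ → stdSimplex ℝ ι) (z : stdSimplex ℝ κ) : stdSimplex ℝ ι :=
  ⟨fun i => ∑ j, z j * p j i,
    fun i => Finset.sum_nonneg fun j _ => mul_nonneg (stdSimplex.zero_le z j)
      (stdSimplex.zero_le (p j) i), by
    rw [Finset.sum_comm]
    simp only [← Finset.mul_sum, stdSimplex.sum_eq_one, mul_one]⟩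

theorem comb_apply (p : κ → stdSimplex ℝ ι) (z : stdSimplex ℝ κ) (i : ι) :
    comb p z i = ∑ j, z j * p j i := rfl

theorem continuous_comb (p : κ → stdSimplex ℝ ι) : Continuous (comb p) := by
  refine Continuous.subtype_mk (continuous_pi fun i => continuous_finsetSum _ fun j _ => ?_) _
  exact ((continuous_apply j).comp continuous_subtype_val).mul continuous_const

theorem map_apply_eq_sum [DecidableEq κ] (f : ι → κ) (z : stdSimplex ℝ ι) (j : κ) :
    stdSimplex.map f z j = ∑ i, if f i = j then z i else 0 := by
  change FunOnFinite.linearMap ℝ ℝ f z j = _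
  rw [FunOnFinite.linearMap_apply_apply, Finset.sum_filter]

theorem comb_comp {κ' : Type} [Fintype κ'] (p : κ → stdSimplex ℝ ι) (f : κ' → κ)
    (z : stdSimplex ℝ κ') : comb (p ∘ f) z = comb p (stdSimplex.map f z) := by
  classical
  ext i
  simp only [comb_apply, map_apply_eq_sum, Finset.sum_mul, Function.comp_apply]
  rw [Finset.sum_comm]
  refine Finset.sum_congr rfl fun j _ => ?_
  simp

theorem comb_map {ι' : Type} [Fintype ι'] (f : ι → ι') (p : κ → stdSimplex ℝ ι)
    (z : stdSimplex ℝ κ) :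
    comb (stdSimplex.map f ∘ p) z = stdSimplex.map f (comb p z) := by
  classical
  ext i
  simp only [comb_apply, map_apply_eq_sum, Function.comp_apply, Finset.mul_sum]
  rw [Finset.sum_comm]
  refine Finset.sum_congr rfl fun j _ => ?_
  split_ifs <;> simp

theorem comb_vertex_right [DecidableEq κ] (p : κ → stdSimplex ℝ ι) (a : κ) :
    comb p (stdSimplex.vertex a) = p a := by
  ext i
  rw [comb_apply, Finset.sum_eq_single a]
  · simp
  · intro j _ hj
    simp [stdSimplex.vertex_coe, hj.symm]
  · simp

theorem comb_vertex [DecidableEq κ] (z : stdSimplex ℝ κ) : comb stdSimplex.vertex z = z := by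
  ext i
  rw [comb_apply, Finset.sum_eq_single i]
  · simp
  · intro j _ hj
    simp [stdSimplex.vertex_coe, hj.symm]
  · simp

/-- The ordered affine `k`-simplices in a standard simplex, given by their vertices. -/
abbrev Tuple (ι : Type) [Fintype ι] (k : ℕ) : Type := Fin (k + 1) → stdSimplex ℝ ι

/-- The boundary of an affine simplex. -/
abbrev tupleBd (k : ℕ) (p : Tuple ι (k + 1)) : Tuple ι k →₀ ℤ :=
  alternatingFaces fun i => p ∘ i.succAbove

variable (ι) in
/-- The chains on ordered affine simplices. -/
def tuples : BasedComplex.{0} :=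
  BasedComplex.ofFaces (Tuple ι) (fun _ i p => p ∘ i.succAbove) fun _ _ _ p hij =>
    funext fun x => congrArg p (succAbove_comm hij x)

/-- The cone with apex `c`. -/
def coneChain (c : stdSimplex ℝ ι) (k : ℕ) : (Tuple ι k →₀ ℤ) →ₗ[ℤ] (Tuple ι (k + 1) →₀ ℤ) :=
  Finsupp.lmapDomain ℤ ℤ fun p => (Fin.cons c p : Tuple ι (k + 1))

theorem coneChain_single (c : stdSimplex ℝ ι) (k : ℕ) (p : Tuple ι k) (a : ℤ) :
    coneChain c k (Finsupp.single p a) = Finsupp.single (Fin.cons c p : Tuple ι (k + 1)) a := by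
  simp [coneChain]

theorem tupleBd_cons_zero (c : stdSimplex ℝ ι) (p : Tuple ι 0) :
    tupleBd 0 (Fin.cons c p : Tuple ι 1) = Finsupp.single p 1 - Finsupp.single (fun _ => c) 1 := by
  rw [tupleBd, alternatingFaces_cone (b := p) (c := fun _ : Unit => fun _ => c)
    (g := fun _ : Fin 1 => ()), lin_alternatingFaces]
  · simp
  · funext i; rfl
  · intro i; funext j
    rw [Fin.fin_one_eq_zero i, Fin.fin_one_eq_zero j]; rfl

theorem tupleBd_cons_succ (c : stdSimplex ℝ ι) (k : ℕ) (p : Tuple ι (k + 1)) :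
    tupleBd (k + 1) (Fin.cons c p : Tuple ι (k + 2)) =
      Finsupp.single p 1 - coneChain c k (tupleBd k p) := by
  rw [tupleBd, alternatingFaces_cone (b := p) (c := fun q : Tuple ι k => (Fin.cons c q :
    Tuple ι (k + 1))) (g := fun i => p ∘ i.succAbove)]
  · rw [coneChain, linearMap_eq_linearCombination (Finsupp.lmapDomain ℤ ℤ _) _ fun a => by
      rw [Finsupp.lmapDomain_apply, Finsupp.mapDomain_single]]
  · funext i; rfl
  · intro i; funext j
    refine Fin.cases ?_ (fun j => ?_) j
    · simp
    · simp

/-- The cone on a cycle is bounded by the cycle. -/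
theorem d_coneChain (c : stdSimplex ℝ ι) (k : ℕ) (z : Tuple ι k →₀ ℤ)
    (hz : (tuples ι).IsCycle k z) :
    Finsupp.linearCombination ℤ (tupleBd k) (coneChain c k z) = z := by
  cases k with
  | zero =>
    have key : ∀ z : Tuple ι 0 →₀ ℤ,
        Finsupp.linearCombination ℤ (tupleBd 0) (coneChain c 0 z) = z -
          Finsupp.linearCombination ℤ (fun _ => (1 : ℤ)) z •
            Finsupp.single (fun _ => c : Tuple ι 0) 1 := fun z => by
      induction z using Finsupp.induction_linear with
      | zero => simp
      | add x y hx hy => simp only [map_add, hx, hy, add_smul]; abel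
      | single p a =>
        rw [coneChain_single, Finsupp.linearCombination_single, tupleBd_cons_zero]
        simp [smul_sub]
    rw [key, show Finsupp.linearCombination ℤ (fun _ => (1 : ℤ)) z = 0 from hz, zero_smul, sub_zero]
  | succ k =>
    have key : ∀ z : Tuple ι (k + 1) →₀ ℤ,
        Finsupp.linearCombination ℤ (tupleBd (k + 1)) (coneChain c (k + 1) z) = z -
          coneChain c k (Finsupp.linearCombination ℤ (tupleBd k) z) := fun z => by
      induction z using Finsupp.induction_linear with
      | zero => simp
      | add x y hx hy => simp only [map_add, hx, hy]; abel
      | single p a =>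
        rw [coneChain_single, Finsupp.linearCombination_single, tupleBd_cons_succ]
        simp [smul_sub]
    rw [key, show Finsupp.linearCombination ℤ (tupleBd k) z = 0 from hz, map_zero, sub_zero]

/-- The affine map of standard simplices given by a map of vertices, on chains. -/
def tupleMap (f : ι → κ) (k : ℕ) : (Tuple ι k →₀ ℤ) →ₗ[ℤ] (Tuple κ k →₀ ℤ) :=
  Finsupp.lmapDomain ℤ ℤ fun p => stdSimplex.map f ∘ p

theorem tupleMap_single (f : ι → κ) (k : ℕ) (p : Tuple ι k) (a : ℤ) :
    tupleMap f k (Finsupp.single p a) = Finsupp.single (stdSimplex.map f ∘ p) a := by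
  simp [tupleMap]

theorem tupleMap_tupleBd (f : ι → κ) (k : ℕ) (p : Tuple ι (k + 1)) :
    tupleMap f k (tupleBd k p) = tupleBd k (stdSimplex.map f ∘ p) :=
  mapDomain_alternatingFaces _ _

theorem d_tupleMap (f : ι → κ) (k : ℕ) (z : Tuple ι (k + 1) →₀ ℤ) :
    Finsupp.linearCombination ℤ (tupleBd k) (tupleMap f (k + 1) z) =
      tupleMap f k (Finsupp.linearCombination ℤ (tupleBd k) z) := by
  induction z using Finsupp.induction_linear with
  | zero => simp
  | add x y hx hy => simp only [map_add, hx, hy]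
  | single p a => simp [tupleMap_single, tupleMap_tupleBd]

theorem aug_tupleMap (f : ι → κ) (z : Tuple ι 0 →₀ ℤ) :
    Finsupp.linearCombination ℤ (fun _ => (1 : ℤ)) (tupleMap f 0 z) =
      Finsupp.linearCombination ℤ (fun _ => (1 : ℤ)) z := by
  induction z using Finsupp.induction_linear with
  | zero => simp
  | add x y hx hy => simp only [map_add, hx, hy]
  | single p a => simp [tupleMap_single]

theorem tupleMap_coneChain (f : ι → κ) (c : stdSimplex ℝ ι) (k : ℕ) (z : Tuple ι k →₀ ℤ) :
    tupleMap f (k + 1) (coneChain c k z) = coneChain (stdSimplex.map f c) k (tupleMap f k z) := by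
  induction z using Finsupp.induction_linear with
  | zero => simp
  | add x y hx hy => simp only [map_add, hx, hy]
  | single p a =>
    simp only [tupleMap_single, coneChain_single]
    congr 1
    funext j
    refine Fin.cases ?_ (fun j => ?_) j
    · simp
    · simp

/-- The barycenter of an affine simplex. -/
def center {k : ℕ} (p : Tuple ι k) : stdSimplex ℝ ι := comb p stdSimplex.barycenter

/-- Barycentric subdivision. -/
def sd (k : ℕ) : Tuple ι k → (Tuple ι k →₀ ℤ) :=
  match k with
  | 0 => fun p => Finsupp.single p 1
  | k + 1 => fun p => coneChain (center p) k (Finsupp.linearCombination ℤ (sd k) (tupleBd k p))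

theorem d_sd (k : ℕ) (p : Tuple ι (k + 1)) :
    Finsupp.linearCombination ℤ (tupleBd k) (sd (k + 1) p) =
      Finsupp.linearCombination ℤ (sd k) (tupleBd k p) := by
  refine d_coneChain _ k _ ?_
  induction k with
  | zero =>
    change Finsupp.linearCombination ℤ (fun _ : Tuple ι 0 => (1 : ℤ)) _ = 0
    rw [BasedComplex.lin_lin]
    refine Eq.trans ?_ ((tuples ι).aug_bd p)
    exact linearCombination_congr _ fun a _ => by simp [sd]
  | succ k ih =>
    change Finsupp.linearCombination ℤ (tupleBd k) _ = 0
    rw [BasedComplex.lin_lin, linearCombination_congr (f := fun a =>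
      Finsupp.linearCombination ℤ (tupleBd k) (sd (k + 1) a)) (g := fun a =>
      Finsupp.linearCombination ℤ (sd k) (tupleBd k a)) _ fun a _ => d_coneChain _ k _ (ih a),
      ← BasedComplex.lin_lin]
    rw [show Finsupp.linearCombination ℤ (tupleBd k) (tupleBd (k + 1) p) = 0 from
      (tuples ι).bd_bd k p, map_zero]

theorem sd_map (f : ι → κ) (k : ℕ) (p : Tuple ι k) :
    sd k (stdSimplex.map f ∘ p) = tupleMap f k (sd k p) := by
  induction k with
  | zero => simp [sd, tupleMap_single]
  | succ k ih =>
    change coneChain (center _) k (Finsupp.linearCombination ℤ (sd k) (tupleBd k _)) =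
      tupleMap f (k + 1) (coneChain (center p) k (Finsupp.linearCombination ℤ (sd k) (tupleBd k p)))
    rw [tupleMap_coneChain, center, comb_map, ← tupleMap_tupleBd]
    congr 1
    induction tupleBd k p using Finsupp.induction_linear with
    | zero => simp
    | add x y hx hy => simp only [map_add, hx, hy]
    | single p a => simp [tupleMap_single, ih]

/-- The iterated barycentric subdivision, as an operator on chains. -/
def sdIter (m k : ℕ) : (Tuple ι k →₀ ℤ) →ₗ[ℤ] (Tuple ι k →₀ ℤ) :=
  (Finsupp.linearCombination ℤ (sd k) : Module.End ℤ (Tuple ι k →₀ ℤ)) ^ m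

theorem sdIter_succ (m k : ℕ) (z : Tuple ι k →₀ ℤ) :
    sdIter (m + 1) k z = Finsupp.linearCombination ℤ (sd k) (sdIter m k z) := by
  rw [sdIter, pow_succ']; rfl

theorem d_sdIter (m k : ℕ) (z : Tuple ι (k + 1) →₀ ℤ) :
    Finsupp.linearCombination ℤ (tupleBd k) (sdIter m (k + 1) z) =
      sdIter m k (Finsupp.linearCombination ℤ (tupleBd k) z) := by
  induction m with
  | zero => rfl
  | succ m ih =>
    rw [sdIter_succ, sdIter_succ, ← ih, BasedComplex.lin_lin, BasedComplex.lin_lin]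
    exact linearCombination_congr _ fun a _ => d_sd k a

theorem aug_sdIter (m : ℕ) (z : Tuple ι 0 →₀ ℤ) :
    Finsupp.linearCombination ℤ (fun _ => (1 : ℤ)) (sdIter m 0 z) =
      Finsupp.linearCombination ℤ (fun _ => (1 : ℤ)) z := by
  induction m with
  | zero => rfl
  | succ m ih =>
    rw [sdIter_succ, ← ih, BasedComplex.lin_lin]
    exact linearCombination_congr _ fun a _ => by simp [sd]

theorem sdIter_map (f : ι → κ) (m k : ℕ) (z : Tuple ι k →₀ ℤ) :
    sdIter m k (tupleMap f k z) = tupleMap f k (sdIter m k z) := by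
  induction m with
  | zero => rfl
  | succ m ih =>
    rw [sdIter_succ, sdIter_succ, ih]
    induction sdIter m k z using Finsupp.induction_linear with
    | zero => simp
    | add x y hx hy => simp only [map_add, hx, hy]
    | single p a => simp [tupleMap_single, sd_map]

/-! ### The mesh of the subdivision -/

/-- The coordinates of any two vertices differ by at most `d`. -/
def IsSmall (d : ℝ) {k : ℕ} (p : Tuple ι k) : Prop := ∀ a b i, |p a i - p b i| ≤ d

/-- A bound for the distance of a point from a convex combination. -/
theorem abs_sub_comb_le {k : ℕ} {p : Tuple ι k} {q : stdSimplex ℝ ι} {i : ι} {d : ℝ}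
    (h : ∀ a, |q i - p a i| ≤ d) (z : stdSimplex ℝ (Fin (k + 1))) : |q i - comb p z i| ≤ d := by
  have h1 : q i - comb p z i = ∑ j, z j * (q i - p j i) := by
    simp only [mul_sub, Finset.sum_sub_distrib, ← Finset.sum_mul, stdSimplex.sum_eq_one, one_mul,
      comb_apply]
  rw [h1]
  calc |∑ j, z j * (q i - p j i)| ≤ ∑ j, |z j * (q i - p j i)| := Finset.abs_sum_le_sum_abs _ _
    _ ≤ ∑ j, z j * d := Finset.sum_le_sum fun j _ => by
        rw [abs_mul, abs_of_nonneg (stdSimplex.zero_le z j)]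
        exact mul_le_mul_of_nonneg_left (h j) (stdSimplex.zero_le z j)
    _ = d := by rw [← Finset.sum_mul, stdSimplex.sum_eq_one, one_mul]

/-- The barycenter is nearer to each vertex than the vertices are to each other: one of the `k + 1`
terms of the average of the differences is `0`. -/
theorem abs_center_sub_le {k : ℕ} {p : Tuple ι k} {d : ℝ} (h : IsSmall d p) (a : Fin (k + 1))
    (i : ι) : |center p i - p a i| ≤ k / (k + 1) * d := by
  have h1 : center p i - p a i = (∑ j, (p j i - p a i)) / (k + 1) := by
    rw [center, comb_apply, Finset.sum_sub_distrib, Finset.sum_const, Finset.card_univ,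
      Fintype.card_fin, nsmul_eq_mul, sub_div, Finset.sum_div]
    push_cast
    rw [mul_div_cancel_left₀ _ (by positivity)]
    congr 1
    refine Finset.sum_congr rfl fun j _ => ?_
    rw [show stdSimplex.barycenter j = ((Fintype.card (Fin (k + 1)) : ℝ))⁻¹ from
      stdSimplex.barycenter_apply j, Fintype.card_fin]
    push_cast
    rw [div_eq_inv_mul]
  rw [h1, abs_div, abs_of_nonneg (by positivity : (0 : ℝ) ≤ k + 1), div_mul_eq_mul_div]
  refine div_le_div_of_nonneg_right ?_ (by positivity)
  calc |∑ j, (p j i - p a i)| ≤ ∑ j, |p j i - p a i| := Finset.abs_sum_le_sum_abs _ _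
    _ = ∑ j ∈ Finset.univ.erase a, |p j i - p a i| := by
        rw [← Finset.add_sum_erase _ _ (Finset.mem_univ a)]; simp
    _ ≤ ∑ j ∈ Finset.univ.erase a, d := Finset.sum_le_sum fun j _ => h j a i
    _ = k * d := by simp [Finset.card_erase_of_mem]

/-- The simplices of the subdivision of `p` lie in the hull of `p`, and are smaller. -/
theorem sd_support {k : ℕ} {p : Tuple ι k} {d : ℝ} (hd : 0 ≤ d) (h : IsSmall d p) :
    ∀ q ∈ (sd k p).support, (∀ a, ∃ z, q a = comb p z) ∧ IsSmall (k / (k + 1) * d) q := by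
  induction k with
  | zero =>
    intro q hq
    obtain rfl : q = p := by
      simpa [sd, Finsupp.support_single] using hq
    refine ⟨fun a => ⟨stdSimplex.vertex a, (comb_vertex_right q a).symm⟩, fun a b i => ?_⟩
    rw [Fin.fin_one_eq_zero a, Fin.fin_one_eq_zero b]; simp
  | succ k ih =>
    suffices hs : sd (k + 1) p ∈ Finsupp.supported ℤ ℤ (Set.ofPred fun q : Tuple ι (k + 1) =>
        (∀ a, ∃ z, q a = comb p z) ∧ IsSmall ((k + 1 : ℕ) / ((k + 1 : ℕ) + 1) * d) q) from
      (Finsupp.mem_supported ℤ _).1 hs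
    -- the subdivided faces, over which the cone with the barycenter as apex is taken
    have key : Finsupp.linearCombination ℤ (sd k) (tupleBd k p) ∈
        Finsupp.supported ℤ ℤ (Set.ofPred fun q : Tuple ι k =>
          (∀ a, ∃ z, q a = comb p z) ∧ IsSmall (k / (k + 1) * d) q) := by
      refine linearCombination_mem_of_support _ _ _ fun p' hp' => ?_
      obtain ⟨i, rfl⟩ := mem_support_alternatingFaces hp'
      refine (Finsupp.mem_supported ℤ _).2 fun q hq => ?_
      obtain ⟨h1, h2⟩ := ih (p := p ∘ i.succAbove) (fun a b => h _ _) q hq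
      refine ⟨fun a => ?_, h2⟩
      obtain ⟨z, hz⟩ := h1 a
      exact ⟨stdSimplex.map i.succAbove z, hz.trans (comb_comp _ _ _)⟩
    have hkk : (k : ℝ) / (k + 1) * d ≤ (k + 1 : ℕ) / ((k + 1 : ℕ) + 1) * d := by
      refine mul_le_mul_of_nonneg_right ?_ hd
      rw [div_le_div_iff₀ (by positivity) (by positivity)]
      push_cast
      nlinarith
    have h0 : 0 ≤ ((k + 1 : ℕ) : ℝ) / ((k + 1 : ℕ) + 1) * d := by positivity
    change coneChain _ _ _ ∈ _
    rw [coneChain, linearMap_eq_linearCombination (Finsupp.lmapDomain ℤ ℤ _) _ fun a => by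
      rw [Finsupp.lmapDomain_apply, Finsupp.mapDomain_single]]
    refine linearCombination_mem_of_support _ _ _ fun q hq => ?_
    obtain ⟨h1, h2⟩ := (Finsupp.mem_supported ℤ _).1 key hq
    have hc : ∀ a i, |center p i - q a i| ≤ (k + 1 : ℕ) / ((k + 1 : ℕ) + 1) * d := fun a i => by
      obtain ⟨z, hz⟩ := h1 a
      rw [hz]
      exact abs_sub_comb_le (fun b => abs_center_sub_le h b i) z
    refine Finsupp.single_mem_supported ℤ 1 ⟨fun a => ?_, fun a b i => ?_⟩
    · refine Fin.cases ⟨_, rfl⟩ (fun a => ?_) a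
      exact h1 a
    · refine Fin.cases ?_ (fun a => ?_) a <;> refine Fin.cases ?_ (fun b => ?_) b
      · simpa using h0
      · exact hc b i
      · rw [abs_sub_comm]; exact hc a i
      · exact (h2 a b i).trans hkk

/-- The mesh of the subdivisions tends to `0`; the bound starts from the mesh `1` of any simplex. -/
theorem sdIter_support {k : ℕ} (m : ℕ) (p : Tuple ι k) :
    ∀ q ∈ (sdIter m k (Finsupp.single p 1)).support, IsSmall ((k / (k + 1) : ℝ) ^ m) q := by
  induction m with
  | zero =>
    intro q _ a b i
    rw [pow_zero, abs_le]
    have h1 := stdSimplex.zero_le (q a) i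
    have h2 := stdSimplex.zero_le (q b) i
    have h3 := stdSimplex.le_one (q a) i
    have h4 := stdSimplex.le_one (q b) i
    constructor <;> linarith
  | succ m ih =>
    suffices hs : sdIter (m + 1) k (Finsupp.single p 1) ∈ Finsupp.supported ℤ ℤ
        (Set.ofPred fun q : Tuple ι k => IsSmall ((k / (k + 1) : ℝ) ^ (m + 1)) q) from
      (Finsupp.mem_supported ℤ _).1 hs
    rw [sdIter_succ]
    refine linearCombination_mem_of_support _ _ _ fun p' hp' => ?_
    refine (Finsupp.mem_supported ℤ _).2 fun q hq => ?_
    have := (sd_support (by positivity) (ih p' hp') q hq).2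
    rwa [← pow_succ'] at this

end subdivision

/-! ### Singular chains that are small with respect to a deformation -/

section prism
variable {ι κ : Type} [Fintype ι] [Fintype κ]

/-- The vertices `(i, s)` of the prism, for a fixed end `s`. -/
abbrev endMap (s : Fin 2) (i : ι) : ι × Fin 2 := (i, s)

/-- The chain homotopy in the prism over a simplex between its bottom and the `m`-th subdivision
of its top. The prism over the simplex with vertex set `ι` is taken inside the simplex with
vertex set `ι × Fin 2`. -/
def prism (m k : ℕ) : Tuple ι k → (Tuple (ι × Fin 2) (k + 1) →₀ ℤ) :=
  match k with
  | 0 => fun p => coneChain (stdSimplex.map (endMap 0) (p 0)) 0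
      (tupleMap (endMap 1) 0 (sdIter m 0 (Finsupp.single p 1)) -
        tupleMap (endMap 0) 0 (Finsupp.single p 1))
  | k + 1 => fun p => coneChain (stdSimplex.map (endMap 0) (p 0)) (k + 1)
      (tupleMap (endMap 1) (k + 1) (sdIter m (k + 1) (Finsupp.single p 1)) -
        tupleMap (endMap 0) (k + 1) (Finsupp.single p 1) -
          Finsupp.linearCombination ℤ (prism m k) (tupleBd k p))

theorem prism_zero (m : ℕ) (p : Tuple ι 0) :
    prism m 0 p = coneChain (stdSimplex.map (endMap 0) (p 0)) 0
      (tupleMap (endMap 1) 0 (sdIter m 0 (Finsupp.single p 1)) -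
        tupleMap (endMap 0) 0 (Finsupp.single p 1)) := rfl

theorem prism_succ (m k : ℕ) (p : Tuple ι (k + 1)) :
    prism m (k + 1) p = coneChain (stdSimplex.map (endMap 0) (p 0)) (k + 1)
      (tupleMap (endMap 1) (k + 1) (sdIter m (k + 1) (Finsupp.single p 1)) -
        tupleMap (endMap 0) (k + 1) (Finsupp.single p 1) -
          Finsupp.linearCombination ℤ (prism m k) (tupleBd k p)) := rfl

theorem d_prism_zero (m : ℕ) (p : Tuple ι 0) :
    Finsupp.linearCombination ℤ (tupleBd 0) (prism m 0 p) =
      tupleMap (endMap 1) 0 (sdIter m 0 (Finsupp.single p 1)) -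
        tupleMap (endMap 0) 0 (Finsupp.single p 1) := by
  refine d_coneChain _ 0 _ ?_
  change Finsupp.linearCombination ℤ (fun _ : Tuple (ι × Fin 2) 0 => (1 : ℤ)) _ = 0
  rw [map_sub, aug_tupleMap, aug_tupleMap, aug_sdIter, sub_self]

theorem lin_d_prism_zero (m : ℕ) (z : Tuple ι 0 →₀ ℤ) :
    Finsupp.linearCombination ℤ (tupleBd 0) (Finsupp.linearCombination ℤ (prism m 0) z) =
      tupleMap (endMap 1) 0 (sdIter m 0 z) - tupleMap (endMap 0) 0 z := by
  induction z using Finsupp.induction_linear with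
  | zero => simp
  | add x y hx hy => simp only [map_add, hx, hy]; abel
  | single p a =>
    have : Finsupp.single p a = a • Finsupp.single p 1 := by simp
    rw [this]
    simp only [map_smul, Finsupp.linearCombination_single, one_smul, d_prism_zero, smul_sub]

theorem d_prism_succ (m k : ℕ) (p : Tuple ι (k + 1)) :
    Finsupp.linearCombination ℤ (tupleBd (k + 1)) (prism m (k + 1) p) =
      tupleMap (endMap 1) (k + 1) (sdIter m (k + 1) (Finsupp.single p 1)) -
        tupleMap (endMap 0) (k + 1) (Finsupp.single p 1) -
          Finsupp.linearCombination ℤ (prism m k) (tupleBd k p) := by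
  induction k with
  | zero =>
    refine d_coneChain _ 1 _ ?_
    change Finsupp.linearCombination ℤ (tupleBd 0) _ = 0
    rw [map_sub, map_sub, d_tupleMap, d_tupleMap, d_sdIter, Finsupp.linearCombination_single,
      one_smul, lin_d_prism_zero, sub_self]
  | succ k ih =>
    have key : ∀ z : Tuple ι (k + 1) →₀ ℤ, Finsupp.linearCombination ℤ (tupleBd (k + 1))
        (Finsupp.linearCombination ℤ (prism m (k + 1)) z) =
          tupleMap (endMap 1) (k + 1) (sdIter m (k + 1) z) - tupleMap (endMap 0) (k + 1) z -
            Finsupp.linearCombination ℤ (prism m k) (Finsupp.linearCombination ℤ (tupleBd k) z) := by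
      intro z
      induction z using Finsupp.induction_linear with
      | zero => simp
      | add x y hx hy => simp only [map_add, hx, hy]; abel
      | single q a =>
        have hq : Finsupp.single q a = a • Finsupp.single q 1 := by simp
        rw [hq]
        simp only [map_smul, Finsupp.linearCombination_single, one_smul, ih, smul_sub]
    refine d_coneChain _ (k + 2) _ ?_
    change Finsupp.linearCombination ℤ (tupleBd (k + 1)) _ = 0
    rw [map_sub, map_sub, d_tupleMap, d_tupleMap, d_sdIter, Finsupp.linearCombination_single,
      one_smul, key, show Finsupp.linearCombination ℤ (tupleBd k) (tupleBd (k + 1) p) = 0 from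
      (tuples ι).bd_bd k p, map_zero, sub_zero, sub_self]

theorem prism_map (f : ι → κ) (m k : ℕ) (p : Tuple ι k) :
    prism m k (stdSimplex.map f ∘ p) = tupleMap (Prod.map f id) (k + 1) (prism m k p) := by
  have he : ∀ (s : Fin 2) (k : ℕ) (z : Tuple ι k →₀ ℤ), tupleMap (endMap s) k (tupleMap f k z) =
      tupleMap (Prod.map f id) k (tupleMap (endMap s) k z) := fun s k z => by
    induction z using Finsupp.induction_linear with
    | zero => simp
    | add x y hx hy => simp only [map_add, hx, hy]
    | single p a =>
      simp only [tupleMap_single]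
      congr 1
      funext j
      simp only [Function.comp_apply, stdSimplex.map_comp_apply]
      rfl
  have hc : ∀ z : stdSimplex ℝ ι, stdSimplex.map (endMap 0) (stdSimplex.map f z) =
      stdSimplex.map (Prod.map f id) (stdSimplex.map (endMap (0 : Fin 2)) z) := fun z => by
    simp only [stdSimplex.map_comp_apply]
    rfl
  induction k with
  | zero =>
    rw [prism_zero, prism_zero, ← tupleMap_single f, sdIter_map, he, he, tupleMap_coneChain,
      map_sub (tupleMap _ _), ← hc]
    rfl
  | succ k ih =>
    have h2 : Finsupp.linearCombination ℤ (prism m k) (tupleBd k (stdSimplex.map f ∘ p)) =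
        tupleMap (Prod.map f id) (k + 1)
          (Finsupp.linearCombination ℤ (prism m k) (tupleBd k p)) := by
      rw [← tupleMap_tupleBd]
      induction tupleBd k p using Finsupp.induction_linear with
      | zero => simp
      | add x y hx hy => simp only [map_add, hx, hy]
      | single p a => simp [tupleMap_single, ih]
    rw [prism_succ, prism_succ, h2, ← tupleMap_single f, sdIter_map, he, he, tupleMap_coneChain,
      map_sub (tupleMap _ _), map_sub (tupleMap _ _), ← hc]
    rfl

end prism

section singular
variable (Y : Type u) [TopologicalSpace Y]

/-- The boundary of a singular simplex. -/
abbrev singBd {Y : Type u} [TopologicalSpace Y] (n : ℕ) (x : C(stdSimplex ℝ (Fin (n + 2)), Y)) :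
    C(stdSimplex ℝ (Fin (n + 1)), Y) →₀ ℤ :=
  alternatingFaces fun i => x.comp (faceMap i)

/-- The singular chains of `Y`. -/
def singular : BasedComplex.{u} :=
  BasedComplex.ofFaces (fun n => C(stdSimplex ℝ (Fin (n + 1)), Y)) (fun _ i x => x.comp (faceMap i))
    fun _ _ _ x hij => ContinuousMap.ext fun z => congrArg x (faceMap_comm hij z)

variable {Y} {ι κ : Type} [Fintype ι] [Fintype κ]

/-- A map of vertices gives a continuous map of simplices. -/
def vertexMap (f : ι → κ) : C(stdSimplex ℝ ι, stdSimplex ℝ κ) :=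
  ⟨stdSimplex.map f, stdSimplex.continuous_map f⟩

/-- A map on a standard simplex sends affine simplices to singular simplices. -/
def along (H : C(stdSimplex ℝ ι, Y)) (k : ℕ) :
    (Tuple ι k →₀ ℤ) →ₗ[ℤ] (C(stdSimplex ℝ (Fin (k + 1)), Y) →₀ ℤ) :=
  Finsupp.lmapDomain ℤ ℤ fun p => H.comp ⟨comb p, continuous_comb p⟩

theorem along_single (H : C(stdSimplex ℝ ι, Y)) (k : ℕ) (p : Tuple ι k) (a : ℤ) :
    along H k (Finsupp.single p a) = Finsupp.single (H.comp ⟨comb p, continuous_comb p⟩) a := by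
  simp [along]

theorem d_along (H : C(stdSimplex ℝ ι, Y)) (k : ℕ) (z : Tuple ι (k + 1) →₀ ℤ) :
    Finsupp.linearCombination ℤ (singBd k) (along H (k + 1) z) =
      along H k (Finsupp.linearCombination ℤ (tupleBd k) z) := by
  induction z using Finsupp.induction_linear with
  | zero => simp
  | add x y hx hy => simp only [map_add, hx, hy]
  | single p a =>
    rw [along_single, Finsupp.linearCombination_single, Finsupp.linearCombination_single, map_smul]
    congr 1
    rw [along, Finsupp.lmapDomain_apply, tupleBd, mapDomain_alternatingFaces, singBd]
    congr 1
    funext i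
    refine ContinuousMap.ext fun z => congrArg H ?_
    exact (comb_comp p i.succAbove z).symm

theorem along_tupleMap (H : C(stdSimplex ℝ κ, Y)) (f : ι → κ) (k : ℕ) (z : Tuple ι k →₀ ℤ) :
    along H k (tupleMap f k z) = along (H.comp (vertexMap f)) k z := by
  induction z using Finsupp.induction_linear with
  | zero => simp
  | add x y hx hy => simp only [map_add, hx, hy]
  | single p a =>
    rw [tupleMap_single, along_single, along_single]
    congr 1
    exact ContinuousMap.ext fun z => congrArg H (comb_map f p z)

/-- The standard simplex as an affine simplex in itself. -/
abbrev vertices (n : ℕ) : Tuple (Fin (n + 1)) n := stdSimplex.vertex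

theorem along_vertices {n : ℕ} (x : C(stdSimplex ℝ (Fin (n + 1)), Y)) :
    along x n (Finsupp.single (vertices n) 1) = Finsupp.single x 1 := by
  rw [along_single]
  congr 1
  exact ContinuousMap.ext fun z => congrArg x (comb_vertex z)

/-- A singular simplex moved along a deformation, as a map on the prism. -/
def movedPrism (ρ : C(ℝ × Y, Y)) (x : C(stdSimplex ℝ ι, Y)) : C(stdSimplex ℝ (ι × Fin 2), Y) where
  toFun z := ρ (stdSimplex.map Prod.snd z 1, x (stdSimplex.map Prod.fst z))
  continuous_toFun := ρ.continuous.comp <| Continuous.prodMk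
    (((continuous_apply (1 : Fin 2)).comp continuous_subtype_val).comp
      (stdSimplex.continuous_map Prod.snd))
    (x.continuous.comp (stdSimplex.continuous_map Prod.fst))

theorem movedPrism_endMap (ρ : C(ℝ × Y, Y)) (x : C(stdSimplex ℝ ι, Y)) (s : Fin 2)
    (z : stdSimplex ℝ ι) : (movedPrism ρ x).comp (vertexMap (endMap s)) z = ρ ((s : ℕ), x z) := by
  change ρ (stdSimplex.map Prod.snd (stdSimplex.map (endMap s) z) 1,
    x (stdSimplex.map Prod.fst (stdSimplex.map (endMap s) z))) = _
  rw [stdSimplex.map_comp_apply, stdSimplex.map_comp_apply]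
  have h1 : stdSimplex.map (S := ℝ) (Prod.fst ∘ endMap (ι := ι) s) z = z := stdSimplex.map_id_apply z
  rw [h1, map_apply_eq_sum]
  congr 2
  fin_cases s
  · simp
  · simp [stdSimplex.sum_eq_one]

theorem movedPrism_map (ρ : C(ℝ × Y, Y)) (x : C(stdSimplex ℝ κ, Y)) (f : ι → κ) :
    (movedPrism ρ x).comp (vertexMap (Prod.map f id)) = movedPrism ρ (x.comp (vertexMap f)) := by
  refine ContinuousMap.ext fun z => ?_
  change ρ (stdSimplex.map Prod.snd (stdSimplex.map _ z) 1,
    x (stdSimplex.map Prod.fst (stdSimplex.map _ z))) =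
      ρ (stdSimplex.map Prod.snd z 1, x (stdSimplex.map f (stdSimplex.map Prod.fst z)))
  simp only [stdSimplex.map_comp_apply]
  rfl

/-- The trace of a singular simplex under the deformation `ρ`, between the simplex and the `m`-th
subdivision of its final position. -/
def trace (ρ : C(ℝ × Y, Y)) (m : ℕ) {n : ℕ} (x : C(stdSimplex ℝ (Fin (n + 1)), Y)) :
    C(stdSimplex ℝ (Fin (n + 2)), Y) →₀ ℤ :=
  along (movedPrism ρ x) (n + 1) (prism m n (vertices n))

/-- The `m`-th subdivision of the final position of a singular simplex. -/
def finalSd (ρ : C(ℝ × Y, Y)) (m : ℕ) {n : ℕ} (x : C(stdSimplex ℝ (Fin (n + 1)), Y)) :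
    C(stdSimplex ℝ (Fin (n + 1)), Y) →₀ ℤ :=
  along ((movedPrism ρ x).comp (vertexMap (endMap 1))) n (sdIter m n (Finsupp.single (vertices n) 1))

theorem along_start {ρ : C(ℝ × Y, Y)} (h0 : ∀ y, ρ (0, y) = y) {n : ℕ}
    (x : C(stdSimplex ℝ (Fin (n + 1)), Y)) :
    along (movedPrism ρ x) n (tupleMap (endMap 0) n (Finsupp.single (vertices n) 1)) =
      Finsupp.single x 1 := by
  rw [along_tupleMap]
  have : (movedPrism ρ x).comp (vertexMap (endMap 0)) = x := ContinuousMap.ext fun z => by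
    rw [movedPrism_endMap]; simp [h0]
  rw [this, along_vertices]

theorem d_trace_zero {ρ : C(ℝ × Y, Y)} (h0 : ∀ y, ρ (0, y) = y) (m : ℕ)
    (x : C(stdSimplex ℝ (Fin 1), Y)) :
    Finsupp.linearCombination ℤ (singBd 0) (trace ρ m x) = finalSd ρ m x - Finsupp.single x 1 := by
  rw [trace, d_along, d_prism_zero, map_sub, along_start h0, along_tupleMap]
  rfl

theorem d_trace_succ {ρ : C(ℝ × Y, Y)} (h0 : ∀ y, ρ (0, y) = y) (m n : ℕ)
    (x : C(stdSimplex ℝ (Fin (n + 2)), Y)) :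
    Finsupp.linearCombination ℤ (singBd (n + 1)) (trace ρ m x) =
      finalSd ρ m x - Finsupp.single x 1 -
        Finsupp.linearCombination ℤ (trace ρ m) (singBd n x) := by
  rw [trace, d_along, d_prism_succ, map_sub, map_sub, along_start h0, along_tupleMap,
    lin_alternatingFaces, lin_alternatingFaces, map_sum]
  refine congrArg₂ _ rfl (Finset.sum_congr rfl fun i _ => ?_)
  have : vertices (n + 1) ∘ i.succAbove = stdSimplex.map i.succAbove ∘ vertices n :=
    funext fun j => (stdSimplex.map_vertex _ _).symm
  rw [map_smul, this, prism_map, along_tupleMap, movedPrism_map]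
  rfl

variable {J : Type*} {A U : J → Set Y}

/-- The singular simplices that lie in one of the sets `A j`. -/
def simplicesIn (A : J → Set Y) (n : ℕ) : Set C(stdSimplex ℝ (Fin (n + 1)), Y) :=
  Set.ofPred fun x => ∃ j, ∀ z, x z ∈ A j

theorem simplicesIn_face {n : ℕ} {x : C(stdSimplex ℝ (Fin (n + 2)), Y)}
    (hx : x ∈ simplicesIn A (n + 1)) (i : Fin (n + 2)) : x.comp (faceMap i) ∈ simplicesIn A n :=
  ⟨hx.choose, fun _ => hx.choose_spec _⟩

theorem along_mem {H : C(stdSimplex ℝ ι, Y)} {k : ℕ} (z : Tuple ι k →₀ ℤ)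
    (h : ∀ p ∈ z.support, ∃ j, ∀ w, H (comb p w) ∈ A j) :
    along H k z ∈ Finsupp.supported ℤ ℤ (simplicesIn A k) := by
  rw [along, linearMap_eq_linearCombination (Finsupp.lmapDomain ℤ ℤ _) _ fun a => by
    rw [Finsupp.lmapDomain_apply, Finsupp.mapDomain_single]]
  exact linearCombination_mem_of_support _ _ _ fun p hp =>
    Finsupp.single_mem_supported ℤ 1 (h p hp)

theorem trace_mem {ρ : C(ℝ × Y, Y)} (hA : ∀ j, ∀ y ∈ A j, ∀ s, ρ (s, y) ∈ A j) (m : ℕ) {n : ℕ}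
    {x : C(stdSimplex ℝ (Fin (n + 1)), Y)} (hx : x ∈ simplicesIn A n) :
    trace ρ m x ∈ Finsupp.supported ℤ ℤ (simplicesIn A (n + 1)) := by
  obtain ⟨j, hj⟩ := hx
  exact along_mem _ fun p _ => ⟨j, fun w => hA j _ (hj _) _⟩

/-- Sufficiently fine subdivisions of the final position are small (Lebesgue's lemma). -/
theorem exists_finalSd_mem {ρ : C(ℝ × Y, Y)} (hU : ∀ j, IsOpen (U j)) (hc : ∀ y, ∃ j, y ∈ U j)
    (hUA : ∀ j, ∀ y ∈ U j, ρ (1, y) ∈ A j) {n : ℕ} (x : C(stdSimplex ℝ (Fin (n + 1)), Y)) :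
    ∃ m₀, ∀ m, m₀ ≤ m → finalSd ρ m x ∈ Finsupp.supported ℤ ℤ (simplicesIn A n) := by
  obtain ⟨δ, hδ, h⟩ := lebesgue_number_lemma_of_metric (s := (Set.univ : Set
    (stdSimplex ℝ (Fin (n + 1))))) (c := fun j => x ⁻¹' U j) isCompact_univ
    (fun j => (hU j).preimage x.continuous) fun z _ => Set.mem_iUnion.2 (hc (x z))
  have hn : (n : ℝ) / (n + 1) < 1 := by
    rw [div_lt_one (by positivity)]; linarith
  obtain ⟨m₀, hm₀⟩ := exists_pow_lt_of_lt_one hδ hn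
  refine ⟨m₀, fun m hm => along_mem _ fun p hp => ?_⟩
  have hp' := sdIter_support m _ p hp
  obtain ⟨j, hj⟩ := h (p 0) (Set.mem_univ _)
  refine ⟨j, fun w => ?_⟩
  rw [movedPrism_endMap]
  have hw : comb p w ∈ Metric.ball (p 0) δ := by
    have hle : (n / (n + 1) : ℝ) ^ m < δ :=
      lt_of_le_of_lt (pow_le_pow_of_le_one (by positivity) hn.le hm) hm₀
    rw [Metric.mem_ball, Subtype.dist_eq, dist_comm]
    refine lt_of_le_of_lt ((dist_pi_le_iff (by positivity)).2 fun i => ?_) hle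
    rw [Real.dist_eq]
    exact abs_sub_comb_le (fun a => hp' 0 a i) w
  simpa using hUA j _ (hj hw)

variable {ρ : C(ℝ × Y, Y)}

theorem lin_single_one {α : Type*} (z : α →₀ ℤ) :
    Finsupp.linearCombination ℤ (fun a => Finsupp.single a (1 : ℤ)) z = z :=
  (linearMap_eq_linearCombination LinearMap.id _ (fun _ => rfl) z).symm

/-- Every `0`-chain is homologous to a chain on `simplicesIn A`. -/
theorem exists_small_zero (h0 : ∀ y, ρ (0, y) = y) (hU : ∀ j, IsOpen (U j))
    (hc : ∀ y, ∃ j, y ∈ U j) (hUA : ∀ j, ∀ y ∈ U j, ρ (1, y) ∈ A j)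
    (z : C(stdSimplex ℝ (Fin 1), Y) →₀ ℤ) :
    ∃ w, z - Finsupp.linearCombination ℤ (singBd 0) w ∈
      Finsupp.supported ℤ ℤ (simplicesIn A 0) := by
  choose m₀ hm₀ using fun x : C(stdSimplex ℝ (Fin 1), Y) => exists_finalSd_mem hU hc hUA x
  refine ⟨-Finsupp.linearCombination ℤ (trace ρ (z.support.sup m₀)) z, ?_⟩
  have key := BasedComplex.lin_sub (finalSd ρ (z.support.sup m₀)) (fun x => Finsupp.single x 1) z
  have hd := linearCombination_congr
    (f := fun x => Finsupp.linearCombination ℤ (singBd 0) (trace ρ (z.support.sup m₀) x))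
    (g := finalSd ρ (z.support.sup m₀) - fun x => Finsupp.single x 1) z
    fun x _ => d_trace_zero h0 _ x
  rw [lin_single_one] at key
  rw [map_neg, sub_neg_eq_add, BasedComplex.lin_lin, hd, key, add_sub_cancel]
  exact linearCombination_mem_of_support _ _ _ fun x hx => hm₀ x _ (Finset.le_sup hx)

/-- A chain with boundary on `simplicesIn A` is homologous to a chain on `simplicesIn A`. -/
theorem exists_small_succ (h0 : ∀ y, ρ (0, y) = y) (hU : ∀ j, IsOpen (U j))
    (hc : ∀ y, ∃ j, y ∈ U j) (hUA : ∀ j, ∀ y ∈ U j, ρ (1, y) ∈ A j)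
    (hA : ∀ j, ∀ y ∈ A j, ∀ s, ρ (s, y) ∈ A j) (n : ℕ)
    (z : C(stdSimplex ℝ (Fin (n + 2)), Y) →₀ ℤ) (hz : Finsupp.linearCombination ℤ (singBd n) z ∈
      Finsupp.supported ℤ ℤ (simplicesIn A n)) :
    ∃ w, z - Finsupp.linearCombination ℤ (singBd (n + 1)) w ∈
      Finsupp.supported ℤ ℤ (simplicesIn A (n + 1)) := by
  choose m₀ hm₀ using fun x : C(stdSimplex ℝ (Fin (n + 2)), Y) => exists_finalSd_mem hU hc hUA x
  set m := z.support.sup m₀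
  refine ⟨-Finsupp.linearCombination ℤ (trace ρ m) z, ?_⟩
  have key := BasedComplex.lin_sub (finalSd ρ m - fun x => Finsupp.single x 1)
    (fun x => Finsupp.linearCombination ℤ (trace ρ m) (singBd n x)) z
  have hd := linearCombination_congr
    (f := fun x => Finsupp.linearCombination ℤ (singBd (n + 1)) (trace ρ m x))
    (g := (finalSd ρ m - fun x => Finsupp.single x 1) -
      fun x => Finsupp.linearCombination ℤ (trace ρ m) (singBd n x)) z
    fun x _ => d_trace_succ h0 m n x
  rw [BasedComplex.lin_sub (finalSd ρ m), lin_single_one, ← BasedComplex.lin_lin] at key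
  have hs : ∀ a b c : C(stdSimplex ℝ (Fin (n + 2)), Y) →₀ ℤ, a + (b - a - c) = b - c :=
    fun a b c => by abel
  rw [map_neg, sub_neg_eq_add, BasedComplex.lin_lin, hd, key, hs]
  refine Submodule.sub_mem _ ?_ ?_
  · exact linearCombination_mem_of_support _ _ _ fun x hx => hm₀ x _ (Finset.le_sup hx)
  · exact linearCombination_mem_of_support _ _ _ fun x hx =>
      trace_mem hA m ((Finsupp.mem_supported ℤ _).1 hz hx)

theorem singBd_mem {n : ℕ} {x : C(stdSimplex ℝ (Fin (n + 2)), Y)} (hx : x ∈ simplicesIn A (n + 1)) :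
    singBd n x ∈ Finsupp.supported ℤ ℤ (simplicesIn A n) :=
  (Finsupp.mem_supported ℤ _).2 fun y hy => by
    obtain ⟨i, rfl⟩ := mem_support_alternatingFaces hy
    exact simplicesIn_face hx i

/-- A contraction of the singular chains relative to the chains on `simplicesIn A`. -/
theorem exists_relative_contraction (h0 : ∀ y, ρ (0, y) = y) (hU : ∀ j, IsOpen (U j))
    (hc : ∀ y, ∃ j, y ∈ U j) (hUA : ∀ j, ∀ y ∈ U j, ρ (1, y) ∈ A j)
    (hA : ∀ j, ∀ y ∈ A j, ∀ s, ρ (s, y) ∈ A j) :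
    ∃ h : ∀ n, C(stdSimplex ℝ (Fin (n + 1)), Y) → (C(stdSimplex ℝ (Fin (n + 2)), Y) →₀ ℤ),
      (∀ n, ∀ x ∈ simplicesIn A n, h n x = 0) ∧
      (∀ x, Finsupp.single x 1 - Finsupp.linearCombination ℤ (singBd 0) (h 0 x) ∈
        Finsupp.supported ℤ ℤ (simplicesIn A 0)) ∧
      ∀ n x, Finsupp.single x 1 - Finsupp.linearCombination ℤ (h n) (singBd n x) -
        Finsupp.linearCombination ℤ (singBd (n + 1)) (h (n + 1) x) ∈
          Finsupp.supported ℤ ℤ (simplicesIn A (n + 1)) := by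
  classical
  let F : ℕ → Type u := fun n => C(stdSimplex ℝ (Fin (n + 1)), Y) →
    (C(stdSimplex ℝ (Fin (n + 2)), Y) →₀ ℤ)
  -- the condition on `h n` under which the boundary of `x - h ∂x` is relative to `A`
  let P : ∀ n, F n → Prop := fun n h => (∀ x ∈ simplicesIn A n, h x = 0) ∧
    (∀ x, Finsupp.linearCombination ℤ (singBd n)
      (Finsupp.single x 1 - Finsupp.linearCombination ℤ h (singBd n x)) ∈
        Finsupp.supported ℤ ℤ (simplicesIn A n)) ∧
    ∀ (e : n = 0) x, Finsupp.single x 1 - Finsupp.linearCombination ℤ (singBd n) (h x) ∈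
        Finsupp.supported ℤ ℤ (simplicesIn A n)
  let Q : ∀ n, F n → F (n + 1) → Prop := fun n h h' => ∀ x,
    Finsupp.single x 1 - Finsupp.linearCombination ℤ h (singBd n x) -
      Finsupp.linearCombination ℤ (singBd (n + 1)) (h' x) ∈
        Finsupp.supported ℤ ℤ (simplicesIn A (n + 1))
  have hP0 : ∃ h, P 0 h := by
    choose w hw using fun x : C(stdSimplex ℝ (Fin 1), Y) =>
      exists_small_zero h0 hU hc hUA (Finsupp.single x 1)
    -- the choice is changed to `0` on `simplicesIn A`, where it is not needed
    let h : F 0 := fun x => if x ∈ simplicesIn A 0 then 0 else w x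
    have hh : ∀ x, Finsupp.single x 1 - Finsupp.linearCombination ℤ (singBd 0) (h x) ∈
        Finsupp.supported ℤ ℤ (simplicesIn A 0) := fun x => by
      by_cases hx : x ∈ simplicesIn A 0
      · simpa [h, hx] using Finsupp.single_mem_supported ℤ (1 : ℤ) hx
      · simpa [h, hx] using hw x
    refine ⟨h, fun x hx => if_pos hx, fun x => ?_, fun _ => hh⟩
    have key := BasedComplex.lin_sub (fun x => Finsupp.single x 1)
      (fun x => Finsupp.linearCombination ℤ (singBd 0) (h x)) (singBd 0 x)
    rw [lin_single_one, ← BasedComplex.lin_lin] at key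
    rw [map_sub, Finsupp.linearCombination_single, one_smul, ← key]
    exact linearCombination_mem_of_support _ _ _ fun y _ => hh y
  have hPs : ∀ n h, P n h → ∃ h', P (n + 1) h' ∧ Q n h h' := fun n h hP => by
    choose w hw using fun x => exists_small_succ h0 hU hc hUA hA n _ (hP.2.1 x)
    let h' : F (n + 1) := fun x => if x ∈ simplicesIn A (n + 1) then 0 else w x
    have hQ : Q n h h' := fun x => by
      by_cases hx : x ∈ simplicesIn A (n + 1)
      · have : Finsupp.linearCombination ℤ h (singBd n x) = 0 := by
          rw [linearCombination_congr (g := 0) _ fun y hy =>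
            hP.1 y ((Finsupp.mem_supported ℤ _).1 (singBd_mem hx) hy), BasedComplex.lin_zero]
        simpa [h', hx, this] using Finsupp.single_mem_supported ℤ (1 : ℤ) hx
      · simpa [h', hx] using hw x
    refine ⟨h', ⟨fun x hx => if_pos hx, fun x => ?_, fun e => absurd e (by omega)⟩, hQ⟩
    have key := BasedComplex.lin_sub ((fun x => Finsupp.single x 1) -
      fun x => Finsupp.linearCombination ℤ h (singBd n x))
      (fun x => Finsupp.linearCombination ℤ (singBd (n + 1)) (h' x)) (singBd (n + 1) x)
    rw [BasedComplex.lin_sub (fun x => Finsupp.single x 1), lin_single_one, ← BasedComplex.lin_lin,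
      ← BasedComplex.lin_lin, show Finsupp.linearCombination ℤ (singBd n) (singBd (n + 1) x) = 0 from
        (singular Y).bd_bd n x, map_zero, sub_zero] at key
    rw [map_sub, Finsupp.linearCombination_single, one_smul, ← key]
    exact linearCombination_mem_of_support _ _ _ fun y _ => hQ y
  obtain ⟨h, hh⟩ := exists_dependent_seq P Q hP0 hPs
  exact ⟨h, fun n => (hh n).1.1, (hh 0).1.2.2 rfl, fun n => (hh n).2⟩

/-- Cocycles that vanish on `simplicesIn A` vanish in degree `0`. -/
theorem eq_zero_of_vanish {R : Type w} [Ring R] (h0 : ∀ y, ρ (0, y) = y) (hU : ∀ j, IsOpen (U j))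
    (hc : ∀ y, ∃ j, y ∈ U j) (hUA : ∀ j, ∀ y ∈ U j, ρ (1, y) ∈ A j)
    {f : C(stdSimplex ℝ (Fin 1), Y) → R} (hf : ∀ x, Finsupp.linearCombination ℤ f (singBd 0 x) = 0)
    (hv : ∀ x ∈ simplicesIn A 0, f x = 0) : f = 0 := funext fun x => by
  obtain ⟨w, hw⟩ := exists_small_zero h0 hU hc hUA (Finsupp.single x 1)
  have h1 : Finsupp.linearCombination ℤ f
      (Finsupp.single x 1 - Finsupp.linearCombination ℤ (singBd 0) w) = 0 := by
    rw [linearCombination_congr (g := 0) _ fun y hy =>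
      hv y ((Finsupp.mem_supported ℤ _).1 hw hy), BasedComplex.lin_zero]
  rwa [map_sub, BasedComplex.lin_lin, linearCombination_congr (g := 0) w fun y _ => hf y,
    BasedComplex.lin_zero, sub_zero, Finsupp.linearCombination_single, one_smul] at h1

/-- Cocycles that vanish on `simplicesIn A` are coboundaries of cochains that vanish there. -/
theorem exists_cob_of_vanish {R : Type w} [Ring R] (h0 : ∀ y, ρ (0, y) = y) (hU : ∀ j, IsOpen (U j))
    (hc : ∀ y, ∃ j, y ∈ U j) (hUA : ∀ j, ∀ y ∈ U j, ρ (1, y) ∈ A j)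
    (hA : ∀ j, ∀ y ∈ A j, ∀ s, ρ (s, y) ∈ A j) {n : ℕ}
    {f : C(stdSimplex ℝ (Fin (n + 2)), Y) → R}
    (hf : ∀ x, Finsupp.linearCombination ℤ f (singBd (n + 1) x) = 0)
    (hv : ∀ x ∈ simplicesIn A (n + 1), f x = 0) :
    ∃ e : C(stdSimplex ℝ (Fin (n + 1)), Y) → R,
      (∀ x, Finsupp.linearCombination ℤ e (singBd n x) = f x) ∧
        ∀ x ∈ simplicesIn A n, e x = 0 := by
  obtain ⟨h, h1, -, h3⟩ := exists_relative_contraction h0 hU hc hUA hA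
  refine ⟨fun x => Finsupp.linearCombination ℤ f (h n x), fun x => ?_,
    fun x hx => by simp [h1 n x hx]⟩
  have h1 : Finsupp.linearCombination ℤ f (Finsupp.single x 1 -
      Finsupp.linearCombination ℤ (h n) (singBd n x) -
        Finsupp.linearCombination ℤ (singBd (n + 1)) (h (n + 1) x)) = 0 := by
    rw [linearCombination_congr (g := 0) _ fun y hy =>
      hv y ((Finsupp.mem_supported ℤ _).1 (h3 n x) hy), BasedComplex.lin_zero]
  rw [map_sub, map_sub, BasedComplex.lin_lin, BasedComplex.lin_lin,
    linearCombination_congr (g := 0) (h (n + 1) x) fun y _ => hf y,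
    BasedComplex.lin_zero, sub_zero, Finsupp.linearCombination_single, one_smul, sub_eq_zero] at h1
  exact h1.symm

end singular

/-! ### Deformation of neighbourhoods of the tori -/

section deform
variable {V : Type u} (L : PreAbstractSimplicialComplex V)

theorem continuous_ofTorus (s : {s : Finset V // IsSimplex L s}) :
    Continuous (TorusComplex.ofTorus L s) :=
  continuous_iSup_rng (i := s) continuous_coinduced_rng

/-- `T_L` as a quotient of the disjoint union of its tori. -/
theorem isQuotientMap_tori : Topology.IsQuotientMap
    (fun p : (Σ s : {s : Finset V // IsSimplex L s}, s.1 → Circle) =>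
      TorusComplex.ofTorus L p.1 p.2) := by
  classical
  refine ⟨?_, fun t => ?_⟩
  · refine ⟨?_⟩
    change (⨆ s : {s : Finset V // IsSimplex L s}, TopologicalSpace.coinduced
      (TorusComplex.ofTorus L s) inferInstance) = TopologicalSpace.coinduced _ (⨆ s, _)
    rw [coinduced_iSup]
    simp only [coinduced_compose]
    rfl
  · obtain ⟨s, hs, h⟩ := t.2
    refine ⟨⟨⟨s, hs⟩, fun v => t.1 v⟩, Subtype.ext (funext fun v => ?_)⟩
    by_cases hv : v ∈ s
    · exact dif_pos hv
    · exact (dif_neg hv).trans (h v hv).symm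

theorem ofTorus_mem {s : {s : Finset V // IsSimplex L s}} (x : s.1 → Circle) (v : s.1) :
    (TorusComplex.ofTorus L s x).1 v = x v := dif_pos v.2

theorem ofTorus_notMem {s : {s : Finset V // IsSimplex L s}} (x : s.1 → Circle) {v : V}
    (hv : v ∉ s.1) : (TorusComplex.ofTorus L s x).1 v = 1 := dif_neg hv

/-- The angle of a point in the right half of the circle, extended to a continuous function on the
whole circle. -/
def angle (c : Circle) : ℝ := Real.arcsin (c : ℂ).im

theorem angle_one : angle 1 = 0 := by simp [angle]

theorem continuous_angle : Continuous angle :=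
  Real.continuous_arcsin.comp (Complex.continuous_im.comp continuous_subtype_val)

theorem exp_angle {c : Circle} (hc : 0 < (c : ℂ).re) : Circle.exp (angle c) = c := by
  have : angle c = Complex.arg c := by
    rw [Complex.arg_of_re_nonneg hc.le, Circle.norm_coe, div_one]; rfl
  rw [this, Circle.exp_arg]

/-- The sum of the angles of the coordinates. -/
def angleSum (t : TorusComplex L) : ℝ := ∑ᶠ v, angle (t.1 v)

theorem angleSum_eq {t : TorusComplex L} {s : Finset V} (h : ∀ v ∉ s, t.1 v = 1) :
    angleSum L t = ∑ v ∈ s, angle (t.1 v) :=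
  finsum_eq_sum_of_support_subset _ fun v hv => by
    by_contra hv'
    exact hv ((congrArg angle (h v hv')).trans angle_one)

theorem mu_eq {t : TorusComplex L} {s : Finset V} (h : ∀ v ∉ s, t.1 v = 1) :
    mu L t = ∏ v ∈ s, t.1 v :=
  finprod_eq_prod_of_mulSupport_subset _ fun v hv => by
    by_contra hv'
    exact hv (h v hv')

theorem continuous_angleSum : Continuous (angleSum L) := by
  refine (isQuotientMap_tori L).continuous_iff.2 (continuous_sigma fun s => ?_)
  have : (fun x : s.1 → Circle => angleSum L (TorusComplex.ofTorus L s x)) =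
      fun x => ∑ v : s.1, angle (x v) := by
    funext x
    rw [angleSum_eq L (s := s.1) fun v hv => ofTorus_notMem L x hv, ← Finset.sum_coe_sort]
    exact Finset.sum_congr rfl fun v _ => by rw [ofTorus_mem]
  change Continuous fun x : s.1 → Circle => angleSum L (TorusComplex.ofTorus L s x)
  rw [this]
  exact continuous_finsetSum _ fun v _ => continuous_angle.comp (continuous_apply v)

/-- Every coordinate is turned back by `r` times its angle. -/
def turnBack (p : TorusComplex L × ℝ) : TorusComplex L :=
  ⟨fun v => p.1.1 v * Circle.exp (-(p.2 * angle (p.1.1 v))), by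
    obtain ⟨s, hs, h⟩ := p.1.2
    exact ⟨s, hs, fun v hv => by simp [h v hv, angle_one]⟩⟩

theorem continuous_turnBack : Continuous (turnBack L) := by
  -- the product of a quotient map with the locally compact line is a quotient map
  refine (isQuotientMap_tori L).continuous_lift_prod_left ?_
  -- the disjoint union of the tori times the line is a disjoint union of products
  let e := Homeomorph.sigmaProdDistrib (ι := {s : Finset V // IsSimplex L s}) (Y := ℝ)
    (X := fun s => s.1 → Circle)
  refine (e.symm.comp_continuous_iff' (f := fun p =>
    turnBack L (TorusComplex.ofTorus L p.1.1 p.1.2, p.2))).1 ?_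
  refine continuous_sigma fun s => ?_
  have : (fun p : (s.1 → Circle) × ℝ => turnBack L (TorusComplex.ofTorus L s p.1, p.2)) =
      fun p => TorusComplex.ofTorus L s fun v => p.1 v * Circle.exp (-(p.2 * angle (p.1 v))) := by
    funext p
    refine Subtype.ext (funext fun v => ?_)
    by_cases hv : v ∈ s.1
    · have h1 := ofTorus_mem L p.1 ⟨v, hv⟩
      change (TorusComplex.ofTorus L s p.1).1 v * Circle.exp
        (-(p.2 * angle ((TorusComplex.ofTorus L s p.1).1 v))) = _
      rw [h1]
      exact (ofTorus_mem L (fun v => p.1 v * Circle.exp (-(p.2 * angle (p.1 v)))) ⟨v, hv⟩).symm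
    · change (TorusComplex.ofTorus L s p.1).1 v * Circle.exp
        (-(p.2 * angle ((TorusComplex.ofTorus L s p.1).1 v))) = _
      rw [ofTorus_notMem L _ hv, ofTorus_notMem L _ hv, angle_one]
      simp
  change Continuous fun p : (s.1 → Circle) × ℝ => turnBack L (TorusComplex.ofTorus L s p.1, p.2)
  rw [this]
  refine (continuous_ofTorus L s).comp (continuous_pi fun v => ?_)
  have h1 : Continuous fun p : (s.1 → Circle) × ℝ => p.1 v :=
    (continuous_apply v).comp continuous_fst
  exact h1.mul (Circle.exp.continuous.comp
    (continuous_snd.mul (continuous_angle.comp h1)).neg)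

theorem circle_exp_sum {α : Type*} (s : Finset α) (f : α → ℝ) :
    Circle.exp (∑ a ∈ s, f a) = ∏ a ∈ s, Circle.exp (f a) := by
  classical
  induction s using Finset.induction_on with
  | empty => simp
  | insert a s ha ih => rw [Finset.sum_insert ha, Finset.prod_insert ha, Circle.exp_add, ih]

theorem mu_turnBack (t : TorusComplex L) (r : ℝ) :
    mu L (turnBack L (t, r)) = mu L t * Circle.exp (-(r * angleSum L t)) := by
  obtain ⟨s, hs, h⟩ := t.2
  rw [mu_eq L h, angleSum_eq L h, mu_eq L (s := s) (fun v hv => by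
    change t.1 v * Circle.exp (-(r * angle (t.1 v))) = 1
    simp [h v hv, angle_one]), Finset.mul_sum, ← Finset.sum_neg_distrib]
  change ∏ v ∈ s, t.1 v * Circle.exp (-(r * angle (t.1 v))) = _
  rw [Finset.prod_mul_distrib]
  rw [circle_exp_sum]

/-- The deformation of the cyclic cover: the coordinates are turned back, and the height changes
accordingly. -/
def deform : C(ℝ × CyclicCover L, CyclicCover L) where
  toFun p := ⟨(turnBack L (p.2.1.1, p.1), p.2.1.2 - p.1 * angleSum L p.2.1.1), by
    rw [mu_turnBack, p.2.2, ← Circle.exp_add, sub_eq_add_neg]⟩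
  continuous_toFun := by
    have h1 : Continuous fun p : ℝ × CyclicCover L => p.2.1.1 :=
      continuous_fst.comp (continuous_subtype_val.comp continuous_snd)
    have h2 : Continuous fun p : ℝ × CyclicCover L => p.2.1.2 :=
      continuous_snd.comp (continuous_subtype_val.comp continuous_snd)
    exact Continuous.subtype_mk (((continuous_turnBack L).comp (h1.prodMk continuous_fst)).prodMk
      (h2.sub (continuous_fst.mul ((continuous_angleSum L).comp h1)))) _

theorem deform_zero (y : CyclicCover L) : deform L (0, y) = y := by
  refine Subtype.ext (Prod.ext (Subtype.ext (funext fun v => ?_)) ?_)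
  · change y.1.1.1 v * Circle.exp (-(0 * _)) = _
    simp
  · change y.1.2 - 0 * _ = _
    simp

/-- The part of the cyclic cover over the torus `T(σ)`. -/
def coverTorus (s : {s : Finset V // IsSimplex L s}) : Set (CyclicCover L) :=
  Set.ofPred fun y => ∀ v ∉ s.1, y.1.1.1 v = 1

/-- A neighbourhood of `coverTorus`. -/
def coverNhd (s : {s : Finset V // IsSimplex L s}) : Set (CyclicCover L) :=
  Set.ofPred fun y => ∀ v ∉ s.1, 0 < (y.1.1.1 v : ℂ).re

/-- On each torus `T(τ)` only the finitely many coordinates in `τ` impose a condition. -/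
theorem isOpen_coverNhd (s : {s : Finset V // IsSimplex L s}) : IsOpen (coverNhd L s) := by
  suffices h : IsOpen (Set.ofPred fun t : TorusComplex L => ∀ v ∉ s.1, 0 < (t.1 v : ℂ).re) from
    h.preimage (continuous_fst.comp continuous_subtype_val)
  refine (isQuotientMap_tori L).isOpen_preimage.1 (isOpen_sigma_iff.2 fun τ => ?_)
  have : (Sigma.mk τ ⁻¹' ((fun p : (Σ s : {s : Finset V // IsSimplex L s}, s.1 → Circle) =>
      TorusComplex.ofTorus L p.1 p.2) ⁻¹'
        (Set.ofPred fun t : TorusComplex L => ∀ v ∉ s.1, 0 < (t.1 v : ℂ).re))) =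
      ⋂ v : τ.1, Set.ofPred fun x : τ.1 → Circle => (v : V) ∉ s.1 → 0 < (x v : ℂ).re := by
    ext x
    refine ⟨fun h => Set.mem_iInter.2 fun v hv => ?_, fun h v hv => ?_⟩
    · have := h v hv
      rwa [ofTorus_mem] at this
    · by_cases hτ : v ∈ τ.1
      · have := Set.mem_iInter.1 h ⟨v, hτ⟩ hv
        have h2 := ofTorus_mem L x ⟨v, hτ⟩
        change 0 < ((TorusComplex.ofTorus L τ x).1 v : ℂ).re
        rwa [h2]
      · change 0 < ((TorusComplex.ofTorus L τ x).1 v : ℂ).re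
        rw [ofTorus_notMem L x hτ]
        simp
  rw [this]
  refine isOpen_iInter_of_finite fun v => ?_
  by_cases hv : (v : V) ∉ s.1
  · simp only [hv, not_false_eq_true, forall_const]
    exact isOpen_lt continuous_const (Complex.continuous_re.comp
      (continuous_subtype_val.comp (continuous_apply v)))
  · simp only [hv, false_imp_iff]
    exact isOpen_const

theorem exists_mem_coverNhd (y : CyclicCover L) : ∃ s, y ∈ coverNhd L s := by
  obtain ⟨s, hs, h⟩ := y.1.1.2
  exact ⟨⟨s, hs⟩, fun v hv => by rw [h v hv]; simp⟩

theorem deform_one_mem (s : {s : Finset V // IsSimplex L s}) :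
    ∀ y ∈ coverNhd L s, deform L (1, y) ∈ coverTorus L s := fun y hy v hv => by
  change y.1.1.1 v * Circle.exp (-(1 * angle (y.1.1.1 v))) = 1
  rw [one_mul, Circle.exp_neg, exp_angle (hy v hv), mul_inv_cancel]

theorem deform_mem (s : {s : Finset V // IsSimplex L s}) :
    ∀ y ∈ coverTorus L s, ∀ r, deform L (r, y) ∈ coverTorus L s := fun y hy r v hv => by
  change y.1.1.1 v * Circle.exp (-(r * angle (y.1.1.1 v))) = 1
  rw [hy v hv, angle_one]
  simp

end deform

/-! ### From the universal abelian cover to the infinite cyclic cover -/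

theorem coboundary_coboundary {X : SSet.{u}} {R : Type w} [Ring R] {n : ℕ} (f : Cochain X R n) :
    coboundary X R (n + 1) (coboundary X R n f) = 0 := funext fun x => by
  rw [coboundary_apply]
  simp only [coboundary_apply, Finset.smul_sum]
  exact alternating_double_sum (fun i j => f (X.δ j (X.δ i x))) fun i j hij =>
    congrArg f (ConcreteCategory.congr_hom (X.δ_comp_δ hij) x)

section simplices
variable {Y Z : Type u} [TopologicalSpace Y] [TopologicalSpace Z] {n : ℕ}

/-- The singular simplex given by a continuous map. -/
def ofMap (y : C(stdSimplex ℝ (Fin (n + 1)), Y)) : singularSet Y _⦋n⦌ :=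
  (TopCat.toSSetObjEquiv (TopCat.of Y) (op ⦋n⦌)).symm y

theorem simplexMap_ofMap (y : C(stdSimplex ℝ (Fin (n + 1)), Y)) : simplexMap (ofMap y) = y :=
  (TopCat.toSSetObjEquiv (TopCat.of Y) (op ⦋n⦌)).apply_symm_apply y

theorem ofMap_simplexMap (s : singularSet Y _⦋n⦌) : ofMap (simplexMap s) = s :=
  (TopCat.toSSetObjEquiv (TopCat.of Y) (op ⦋n⦌)).symm_apply_apply s

theorem simplexMap_injective : Function.Injective (simplexMap (X := Y) (n := n)) :=
  (TopCat.toSSetObjEquiv (TopCat.of Y) (op ⦋n⦌)).injective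

theorem δ_ofMap (y : C(stdSimplex ℝ (Fin (n + 2)), Y)) (i : Fin (n + 2)) :
    (singularSet Y).δ i (ofMap y) = ofMap (y.comp (faceMap i)) :=
  simplexMap_injective <| ContinuousMap.ext fun z => by
    rw [simplexMap_δ, simplexMap_ofMap, simplexMap_ofMap]; rfl

/-- The map of singular sets induced by a continuous map. -/
abbrev singMap (f : C(Y, Z)) : singularSet Y ⟶ singularSet Z := TopCat.toSSet.map (TopCat.ofHom f)

theorem simplexMap_singMap (f : C(Y, Z)) (s : singularSet Y _⦋n⦌) :
    simplexMap ((singMap f).app (op ⦋n⦌) s) = f.comp (simplexMap s) := rfl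

variable {R : Type w} [Ring R]

theorem lin_singBd (f : Cochain (singularSet Y) R n) (y : C(stdSimplex ℝ (Fin (n + 2)), Y)) :
    Finsupp.linearCombination ℤ (fun x => f (ofMap x)) (singBd n y) =
      coboundary (singularSet Y) R n f (ofMap y) := by
  rw [lin_alternatingFaces, coboundary_apply]
  exact Finset.sum_congr rfl fun i _ => by rw [δ_ofMap]

end simplices

section relative
variable {V : Type u} (L : PreAbstractSimplicialComplex V) {R : Type w} [Ring R]

/-- Cocycles of positive degree that vanish on the simplices over the tori are coboundaries of
cochains that vanish there. -/
theorem exists_vanishing_primitive {n : ℕ} {f : Cochain (singularSet (CyclicCover L)) R (n + 1)}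
    (hf : f ∈ cocycles _ R (n + 1))
    (hv : ∀ y ∈ simplicesIn (coverTorus L) (n + 1), f (ofMap y) = 0) :
    ∃ e, coboundary _ R n e = f ∧ ∀ y ∈ simplicesIn (coverTorus L) n, e (ofMap y) = 0 := by
  obtain ⟨e, he, hv'⟩ := exists_cob_of_vanish (deform_zero L) (isOpen_coverNhd L)
    (exists_mem_coverNhd L) (deform_one_mem L) (deform_mem L)
    (fun y => (lin_singBd f y).trans (congrFun (show coboundary _ R _ f = 0 from hf) _)) hv
  refine ⟨fun s => e (simplexMap s), funext fun s => ?_, fun y hy => ?_⟩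
  · rw [← ofMap_simplexMap s, ← lin_singBd, ← he]
    simp only [simplexMap_ofMap]
  · change e (simplexMap (ofMap y)) = 0
    rw [simplexMap_ofMap, hv' y hy]

/-- Cocycles that vanish on the simplices over the tori are coboundaries. -/
theorem mem_coboundaries_of_vanish {n : ℕ} {f : Cochain (singularSet (CyclicCover L)) R n}
    (hf : f ∈ cocycles _ R n) (hv : ∀ y ∈ simplicesIn (coverTorus L) n, f (ofMap y) = 0) :
    f ∈ coboundaries _ R n := by
  cases n with
  | zero =>
    have := eq_zero_of_vanish (deform_zero L) (isOpen_coverNhd L) (exists_mem_coverNhd L)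
      (deform_one_mem L)
      (fun y => (lin_singBd f y).trans (congrFun (show coboundary _ R _ f = 0 from hf) _)) hv
    refine funext fun s => ?_
    rw [← ofMap_simplexMap s]
    exact congrFun this _
  | succ n =>
    obtain ⟨e, he, -⟩ := exists_vanishing_primitive L hf hv
    exact ⟨e, he⟩

end relative

section proj
variable {V : Type u} {L : PreAbstractSimplicialComplex V} {n : ℕ}

/-- The universal cover of the circle, with the full turn as unit of length. -/
def turn (x : ℝ) : Circle := Circle.exp (2 * Real.pi * x)

theorem turn_int (k : ℤ) : turn k = 1 := by
  rw [turn, ← Circle.exp_zero, Circle.exp_eq_exp]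
  exact ⟨k, by ring⟩

theorem turn_add (x y : ℝ) : turn (x + y) = turn x * turn y := by
  rw [turn, mul_add, Circle.exp_add]; rfl

theorem turn_sum {α : Type*} (s : Finset α) (f : α → ℝ) :
    turn (∑ a ∈ s, f a) = ∏ a ∈ s, turn (f a) := by
  rw [turn, Finset.mul_sum, circle_exp_sum]; rfl

theorem continuous_turn : Continuous turn :=
  Circle.exp.continuous.comp (continuous_const.mul continuous_id)

theorem exists_turn_lift (f : C(stdSimplex ℝ (Fin (n + 1)), Circle)) :
    ∃ θ : C(stdSimplex ℝ (Fin (n + 1)), ℝ), ∀ z, turn (θ z) = f z := by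
  obtain ⟨θ, hθ⟩ := exists_lift f
  refine ⟨⟨fun z => θ z / (2 * Real.pi), by fun_prop⟩, fun z => ?_⟩
  rw [← hθ z]
  change Circle.exp (2 * Real.pi * (θ z / (2 * Real.pi))) = _
  rw [mul_div_cancel₀]
  positivity

/-- Functions with the same values in the circle differ by an integer constant. -/
theorem exists_int_of_turn_eq {θ θ' : C(stdSimplex ℝ (Fin (n + 1)), ℝ)}
    (h : ∀ z, turn (θ z) = turn (θ' z)) : ∃ k : ℤ, ∀ z, θ' z = k + θ z := by
  have hpi : (0 : ℝ) < 2 * Real.pi := by positivity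
  obtain ⟨k, hk⟩ := Circle.exp_eq_exp.1 (h (stdSimplex.vertex 0)).symm
  refine ⟨k, fun z => ?_⟩
  have h1 := lift_sub_eq (θ := (⟨fun z => 2 * Real.pi * θ z, by fun_prop⟩ : C(_, ℝ)))
    (θ' := ⟨fun z => 2 * Real.pi * θ' z, by fun_prop⟩) h z (stdSimplex.vertex 0)
  simp only [ContinuousMap.coe_mk] at h1
  have h2 : (2 * Real.pi) * (θ' z) = (2 * Real.pi) * (k + θ z) := by linarith
  exact mul_left_cancel₀ hpi.ne' h2

namespace Lift

/-- The point of `T_L` below a point of the universal abelian cover. -/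
def point (x : Lift L n) (z : stdSimplex ℝ (Fin (n + 1))) : TorusComplex L :=
  ⟨fun v => turn (x.θ v z), by
    obtain ⟨F, hF⟩ := x.exists_flat
    exact ⟨F.s, F.isSimplex, fun v hv => (congrArg turn (hF.1 v hv z)).trans (turn_int _)⟩⟩

theorem continuous_point (x : Lift L n) : Continuous x.point := by
  obtain ⟨F, hF⟩ := x.exists_flat
  have : x.point = fun z =>
      TorusComplex.ofTorus L ⟨F.s, F.isSimplex⟩ fun v => turn (x.θ v z) := by
    funext z
    refine Subtype.ext (funext fun v => ?_)
    by_cases hv : v ∈ F.s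
    · exact (ofTorus_mem L (s := ⟨F.s, F.isSimplex⟩) (fun v => turn (x.θ v z)) ⟨v, hv⟩).symm
    · refine Eq.trans ?_ (ofTorus_notMem L (s := ⟨F.s, F.isSimplex⟩) _ hv).symm
      change turn (x.θ v z) = 1
      rw [hF.1 v hv, turn_int]
  rw [this]
  exact (continuous_ofTorus L _).comp
    (continuous_pi fun v => continuous_turn.comp (x.θ v).continuous)

theorem mu_point (x : Lift L n) (z : stdSimplex ℝ (Fin (n + 1))) :
    mu L (x.point z) = turn (x.h z) := by
  obtain ⟨F, hF⟩ := x.exists_flat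
  rw [hF.2, turn_add, turn_int, one_mul, turn_sum, mu_eq L (s := F.s) fun v hv => by
    change turn (x.θ v z) = 1
    rw [hF.1 v hv, turn_int]]
  refine Finset.prod_congr rfl fun v _ => ?_
  rw [sub_eq_add_neg, turn_add, ← Int.cast_neg, turn_int, mul_one]
  rfl

/-- The projection to the infinite cyclic cover. -/
def proj (x : Lift L n) : C(stdSimplex ℝ (Fin (n + 1)), CyclicCover L) where
  toFun z := ⟨(x.point z, 2 * Real.pi * x.h z), x.mu_point z⟩
  continuous_toFun := Continuous.subtype_mk
    (x.continuous_point.prodMk (continuous_const.mul x.h.continuous)) _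

theorem proj_vadd (g : (V → ℤ) × ℤ) (x : Lift L n) :
    (g +ᵥ x).proj = (deck L g.2).comp x.proj := by
  refine ContinuousMap.ext fun z => Subtype.ext (Prod.ext (Subtype.ext (funext fun v => ?_)) ?_)
  · change turn (g.1 v + x.θ v z) = turn (x.θ v z)
    rw [turn_add, turn_int, one_mul]
  · change 2 * Real.pi * (g.2 + x.h z) = 2 * Real.pi * x.h z + g.2 * (2 * Real.pi)
    ring

theorem proj_mem (x : Lift L n) : x.proj ∈ simplicesIn (coverTorus L) n := by
  obtain ⟨F, hF⟩ := x.exists_flat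
  refine ⟨⟨F.s, F.isSimplex⟩, fun z v hv => ?_⟩
  change turn (x.θ v z) = 1
  rw [hF.1 v hv, turn_int]

/-- Simplices over a torus lift to the universal abelian cover. -/
theorem exists_proj_eq {y : C(stdSimplex ℝ (Fin (n + 1)), CyclicCover L)}
    (hy : y ∈ simplicesIn (coverTorus L) n) : ∃ x : Lift L n, x.proj = y := by
  classical
  obtain ⟨s, hs⟩ := hy
  have hc : ∀ v, Continuous fun t : TorusComplex L => t.1 v := fun v => by
    refine (isQuotientMap_tori L).continuous_iff.2 (continuous_sigma fun s => ?_)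
    change Continuous fun x : s.1 → Circle => (TorusComplex.ofTorus L s x).1 v
    by_cases hv : v ∈ s.1
    · exact (continuous_apply (⟨v, hv⟩ : s.1)).congr fun x => (ofTorus_mem L x ⟨v, hv⟩).symm
    · exact continuous_const.congr fun x => (ofTorus_notMem L x hv).symm
  -- lift all coordinates; off `s` the lift is chosen to be `0`
  choose θ hθ using fun v => exists_turn_lift
    ⟨fun z => (y z).1.1.1 v, (hc v).comp (continuous_fst.comp
      (continuous_subtype_val.comp y.continuous))⟩
  let θ' : V → C(stdSimplex ℝ (Fin (n + 1)), ℝ) := fun v => if v ∈ s.1 then θ v else 0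
  have hθ' : ∀ v z, turn (θ' v z) = (y z).1.1.1 v := fun v z => by
    by_cases hv : v ∈ s.1
    · simp only [θ', if_pos hv]; exact hθ v z
    · simp only [θ', if_neg hv]
      rw [hs z v hv]
      simpa using turn_int 0
  have hpi : (2 * Real.pi) ≠ 0 := by positivity
  let h : C(stdSimplex ℝ (Fin (n + 1)), ℝ) := ⟨fun z => (y z).1.2 / (2 * Real.pi),
    (continuous_snd.comp (continuous_subtype_val.comp y.continuous)).div_const _⟩
  have hh : ∀ z, 2 * Real.pi * h z = (y z).1.2 := fun z => mul_div_cancel₀ _ hpi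
  -- the height agrees with the sum of the coordinates modulo full turns
  obtain ⟨m, hm⟩ := exists_int_of_turn_eq
    (θ := ⟨fun z => ∑ v ∈ s.1, θ' v z, by fun_prop⟩) (θ' := h) fun z => by
      change turn (∑ v ∈ s.1, θ' v z) = Circle.exp (2 * Real.pi * h z)
      rw [hh, ← (y z).2, mu_eq L (hs z), turn_sum]
      exact Finset.prod_congr rfl fun v _ => hθ' v z
  refine ⟨⟨θ', h, ⟨0, m, s.1, s.2⟩, fun v hv z => ?_, fun z => ?_⟩, ?_⟩
  · simp only [θ']
    rw [if_neg hv]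
    simp
  · rw [hm z]
    simp
  · exact ContinuousMap.ext fun z => Subtype.ext
      (Prod.ext (Subtype.ext (funext fun v => hθ' v z)) (hh z))

/-- The lifts of a simplex of the infinite cyclic cover form one orbit of the lattice. -/
theorem exists_vadd_of_proj_eq {x x' : Lift L n} (h : x.proj = x'.proj) :
    ∃ g : (V → ℤ) × ℤ, g.2 = 0 ∧ x' = g +ᵥ x := by
  have h1 : ∀ v z, turn (x.θ v z) = turn (x'.θ v z) := fun v z =>
    congrArg (fun y : C(stdSimplex ℝ (Fin (n + 1)), CyclicCover L) => (y z).1.1.1 v) h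
  have h2 : ∀ z, 2 * Real.pi * x.h z = 2 * Real.pi * x'.h z := fun z =>
    congrArg (fun y : C(stdSimplex ℝ (Fin (n + 1)), CyclicCover L) => (y z).1.2) h
  choose k hk using fun v => exists_int_of_turn_eq (h1 v)
  refine ⟨(k, 0), rfl, Lift.ext (funext fun v => ContinuousMap.ext fun z => hk v z)
    (ContinuousMap.ext fun z => ?_)⟩
  rw [vadd_h, Int.cast_zero, zero_add]
  exact (mul_left_cancel₀ (by positivity) (h2 z)).symm

end Lift

end proj

/-! ### Singular cochains of the cover and cubical cochains -/

section theta
open CarriedComplex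
variable {V : Type u} {L : PreAbstractSimplicialComplex V} {R : Type w} [Ring R] {n : ℕ}

variable (V) in
/-- The lattice of translations, the kernel of the projection to the group of deck
transformations. -/
def lattice : AddSubgroup ((V → ℤ) × ℤ) := (AddMonoidHom.snd (V → ℤ) ℤ).ker

/-- A cochain of the cyclic cover as a lattice invariant cochain upstairs. -/
def upstairs (f : Cochain (singularSet (CyclicCover L)) R n) : Lift L n → R := fun x =>
  f (ofMap x.proj)

theorem upstairs_coboundary (f : Cochain (singularSet (CyclicCover L)) R n) :
    upstairs (coboundary _ R n f) = (Lift.carried L).cob (upstairs f) := funext fun x => by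
  change coboundary _ R n f (ofMap x.proj) = Finsupp.linearCombination ℤ (upstairs f)
    (alternatingFaces fun i => x.face i)
  rw [← lin_singBd, lin_alternatingFaces, lin_alternatingFaces]
  rfl

theorem upstairs_vadd (f : Cochain (singularSet (CyclicCover L)) R n) (g : (V → ℤ) × ℤ)
    (x : Lift L n) :
    upstairs f (g +ᵥ x) = upstairs (cochainMap R (singMap (deck L g.2)) n f) x := by
  rw [upstairs, Lift.proj_vadd]; rfl

theorem deck_zero : deck L 0 = ContinuousMap.id _ :=
  ContinuousMap.ext fun y => Subtype.ext (Prod.ext rfl (by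
    change y.1.2 + ((0 : ℤ) : ℝ) * (2 * Real.pi) = y.1.2
    simp))

theorem cochainMap_deck_zero (f : Cochain (singularSet (CyclicCover L)) R n) :
    cochainMap R (singMap (deck L 0)) n f = f := by
  rw [deck_zero]; rfl

theorem upstairs_invariant (f : Cochain (singularSet (CyclicCover L)) R n) :
    (Lift.carried L).IsInvariant (lattice V) (upstairs f) := fun g hg x => by
  have hg' : g.2 = 0 := hg
  refine (upstairs_vadd f g x).trans ?_
  rw [hg', cochainMap_deck_zero]

/-- Lattice invariant cochains descend to the simplices over the tori, and extend by `0`. -/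
theorem exists_upstairs_eq {f : Lift L n → R} (hf : (Lift.carried L).IsInvariant (lattice V) f) :
    ∃ e : Cochain (singularSet (CyclicCover L)) R n, upstairs e = f := by
  have hfac : Function.FactorsThrough f (Lift.proj (L := L) (n := n)) := fun x x' h => by
    obtain ⟨g, hg, rfl⟩ := Lift.exists_vadd_of_proj_eq h
    exact (hf g hg x).symm
  refine ⟨fun s => Function.extend Lift.proj f 0 (simplexMap s), funext fun x => ?_⟩
  rw [upstairs, simplexMap_ofMap, hfac.extend_apply]

/-- A cocycle that is a coboundary upstairs is a coboundary. -/
theorem mem_coboundaries_of_upstairs {f : Cochain (singularSet (CyclicCover L)) R n}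
    (hf : f ∈ cocycles _ R n) (h : (Lift.carried L).IsCob (lattice V) n (upstairs f)) :
    f ∈ coboundaries _ R n := by
  have hv : ∀ f' : Cochain (singularSet (CyclicCover L)) R n, upstairs f' = 0 →
      ∀ y ∈ simplicesIn (coverTorus L) n, f' (ofMap y) = 0 := fun f' h' y hy => by
    obtain ⟨x, rfl⟩ := Lift.exists_proj_eq hy
    exact congrFun h' x
  cases n with
  | zero => exact mem_coboundaries_of_vanish L hf (hv f h)
  | succ n =>
    obtain ⟨e, he, hef⟩ := h
    obtain ⟨e, rfl⟩ := exists_upstairs_eq he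
    have hd : coboundary _ R n e ∈ cocycles (singularSet (CyclicCover L)) R (n + 1) :=
      coboundary_coboundary e
    have h1 := mem_coboundaries_of_vanish L (sub_mem hf hd) (hv _ (by
      rw [← upstairs_coboundary] at hef
      funext x
      change upstairs f x - upstairs (coboundary _ R n e) x = 0
      rw [hef, sub_self]))
    have h2 := add_mem h1 (show coboundary _ R n e ∈ coboundaries _ R (n + 1) from ⟨e, rfl⟩)
    rwa [sub_add_cancel] at h2

variable [LinearOrder V] (Ψ : CarriedMap (Cube.carried L) (Lift.carried L))

/-- The cubical cochain of a singular cochain of the cyclic cover, along the map of chains `Ψ`. -/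
def theta (n : ℕ) : Cochain (singularSet (CyclicCover L)) R n →ₗ[R] (Cube L n → R) where
  toFun f := Ψ.pull (upstairs f)
  map_add' f g := funext fun _ => BasedComplex.lin_add (upstairs f) (upstairs g) _
  map_smul' r f := funext fun _ => BasedComplex.lin_smul r (upstairs f) _

theorem theta_coboundary (f : Cochain (singularSet (CyclicCover L)) R n) :
    theta Ψ (n + 1) (coboundary _ R n f) = (Cube.carried L).cob (theta Ψ n f) := by
  change Ψ.pull (upstairs (coboundary _ R n f)) = _
  rw [upstairs_coboundary]
  exact Ψ.pull_cob _

theorem theta_vadd (f : Cochain (singularSet (CyclicCover L)) R n) (g : (V → ℤ) × ℤ)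
    (c : Cube L n) :
    theta Ψ n f (g +ᵥ c) = theta Ψ n (cochainMap R (singMap (deck L g.2)) n f) c := by
  have h1 := Ψ.equivariant n g c
  have h2 : Finsupp.linearCombination ℤ (upstairs f) (Ψ.f n (g +ᵥ c)) =
      Finsupp.linearCombination ℤ (fun x : Lift L n => upstairs f (g +ᵥ x)) (Ψ.f n c) :=
    (congrArg _ h1).trans (Finsupp.linearCombination_mapDomain _ _ _)
  refine h2.trans ?_
  simp only [upstairs_vadd]
  rfl

theorem theta_invariant (f : Cochain (singularSet (CyclicCover L)) R n) :
    (Cube.carried L).IsInvariant (lattice V) (theta Ψ n f) :=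
  Ψ.pull_invariant (upstairs_invariant f)

/-- The map `theta` is injective on cohomology. -/
theorem mem_coboundaries_of_theta {f : Cochain (singularSet (CyclicCover L)) R n}
    (hf : f ∈ cocycles _ R n) (h : (Cube.carried L).IsCob (lattice V) n (theta Ψ n f)) :
    f ∈ coboundaries _ R n := by
  refine mem_coboundaries_of_upstairs hf (Ψ.isCob_of_pull (upstairs_invariant f) ?_ h)
  rw [← upstairs_coboundary, show coboundary _ R n f = 0 from hf]
  rfl

/-- The map `theta` is surjective on cohomology. -/
theorem exists_isCob_theta_sub {e : Cube L n → R}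
    (he : (Cube.carried L).IsInvariant (lattice V) e) (hc : (Cube.carried L).cob e = 0) :
    ∃ f ∈ cocycles (singularSet (CyclicCover L)) R n,
      (Cube.carried L).IsCob (lattice V) n (theta Ψ n f - e) := by
  obtain ⟨f', hi, hc', hf'⟩ := Ψ.exists_isCob_pull_sub he hc
  obtain ⟨f, rfl⟩ := exists_upstairs_eq hi
  -- the coboundary of `f` vanishes over the tori, so that `f` can be corrected off them
  have hd : coboundary _ R n f ∈ cocycles (singularSet (CyclicCover L)) R (n + 1) :=
    coboundary_coboundary f
  have hv : upstairs (coboundary _ R n f) = 0 := by rw [upstairs_coboundary]; exact hc'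
  obtain ⟨e', he', hv'⟩ := exists_vanishing_primitive L hd fun y hy => by
    obtain ⟨x, rfl⟩ := Lift.exists_proj_eq hy
    exact congrFun hv x
  refine ⟨f - e', ?_, ?_⟩
  · change coboundary _ R n (f - e') = 0
    rw [map_sub, he', sub_self]
  · have : upstairs (f - e') = upstairs f := funext fun x => by
      change f _ - e' _ = f _
      rw [hv' _ x.proj_mem, sub_zero]
    rw [show theta Ψ n (f - e') = theta Ψ n f from congrArg Ψ.pull this]
    exact hf'

end theta

/-! ### Alternating cochains and ordered simplices -/

section alternating
variable {V : Type u} {L : PreAbstractSimplicialComplex V} {R : Type w} [Ring R] {n : ℕ}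

theorem spans_comp_perm (v : Fin n → V) (σ : Equiv.Perm (Fin n)) :
    Spans L (v ∘ σ) ↔ Spans L v := by
  refine ⟨fun h => ?_, fun h => h.comp σ⟩
  have := h.comp σ.symm
  rwa [Function.comp_assoc, Equiv.self_comp_symm, Function.comp_id] at this

/-- Alternating cochains change sign under all odd permutations. -/
theorem alternating_comp_perm {f : (Fin n → V) → R} (hf : f ∈ alternatingCochains L R n)
    (σ : Equiv.Perm (Fin n)) : ∀ v, f (v ∘ σ) = (Equiv.Perm.sign σ : ℤ) • f v := by
  cases n with
  | zero => intro v; rw [Subsingleton.elim σ 1]; simp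
  | succ n =>
    have hσ : σ ∈ Submonoid.closure (Set.range fun i : Fin n => Equiv.swap i.castSucc i.succ) := by
      rw [Equiv.Perm.mclosure_swap_castSucc_succ]; trivial
    induction hσ using Submonoid.closure_induction with
    | mem τ hτ =>
      obtain ⟨i, rfl⟩ := hτ
      intro v
      rw [hf.2.2 v i.castSucc i.succ (by simp), Equiv.Perm.sign_swap (Fin.castSucc_lt_succ).ne]
      simp
    | one => intro v; simp
    | mul σ τ _ _ h1 h2 =>
      intro v
      rw [Equiv.Perm.coe_mul, ← Function.comp_assoc, h2, h1, smul_smul, map_mul, mul_comm]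
      simp

variable [LinearOrder V]

variable (L) in
/-- The simplices of `L` with `n` vertices, listed in increasing order. -/
def OrdSimplex (n : ℕ) : Type u := {v : Fin n → V // StrictMono v ∧ Spans L v}

/-- The face opposite to the `i`-th vertex. -/
def OrdSimplex.face (i : Fin (n + 1)) (v : OrdSimplex L (n + 1)) : OrdSimplex L n :=
  ⟨v.1 ∘ i.succAbove, v.2.1.comp (Fin.strictMono_succAbove i), v.2.2.comp _⟩

variable (L R) in
/-- The simplicial coboundary on functions of ordered simplices. -/
def ordCob (n : ℕ) : (OrdSimplex L n → R) →ₗ[R] (OrdSimplex L (n + 1) → R) where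
  toFun u v := ∑ i : Fin (n + 1), ((-1 : ℤ) ^ (i : ℕ)) • u (v.face i)
  map_add' f g := by
    funext x
    simp only [Pi.add_apply, smul_add, Finset.sum_add_distrib]
  map_smul' r f := by
    funext x
    simp only [Pi.smul_apply, Finset.smul_sum, RingHom.id_apply]
    exact Finset.sum_congr rfl fun i _ => smul_comm _ _ _

theorem ordCob_apply (u : OrdSimplex L n → R) (v : OrdSimplex L (n + 1)) :
    ordCob L R n u v = ∑ i : Fin (n + 1), ((-1 : ℤ) ^ (i : ℕ)) • u (v.face i) := rfl

variable (L R n) in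
/-- The restriction of alternating cochains to ordered simplices. -/
def restrOrd : SimplicialCochain L R n →ₗ[R] (OrdSimplex L n → R) where
  toFun f v := f.1 v.1
  map_add' _ _ := rfl
  map_smul' _ _ := rfl

theorem restrOrd_coboundary (f : SimplicialCochain L R n) :
    restrOrd L R (n + 1) (simplicialCoboundary L R n f) = ordCob L R n (restrOrd L R n f) :=
  funext fun v => if_pos v.2.2

open Classical in
/-- The alternating extension of a function of ordered simplices. -/
def altExtend (u : OrdSimplex L n → R) (v : Fin n → V) : R :=
  if h : Function.Injective v ∧ Spans L v then
    (Equiv.Perm.sign (Tuple.sort v) : ℤ) • u ⟨v ∘ Tuple.sort v,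
      (Tuple.monotone_sort v).strictMono_of_injective (h.1.comp (Tuple.sort v).injective),
      (spans_comp_perm v _).2 h.2⟩
  else 0

theorem altExtend_comp_perm (u : OrdSimplex L n → R) (v : Fin n → V) (σ : Equiv.Perm (Fin n)) :
    altExtend u (v ∘ σ) = (Equiv.Perm.sign σ : ℤ) • altExtend u v := by
  by_cases h : Function.Injective v ∧ Spans L v
  · have h' : Function.Injective (v ∘ σ) ∧ Spans L (v ∘ σ) :=
      ⟨h.1.comp σ.injective, (spans_comp_perm v σ).2 h.2⟩
    have h1 : (v ∘ σ) ∘ Tuple.sort (v ∘ σ) = v ∘ Tuple.sort v :=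
      Tuple.comp_perm_comp_sort_eq_comp_sort
    have h2 : Tuple.sort v = σ * Tuple.sort (v ∘ σ) := Equiv.ext fun i =>
      h.1 (congrFun h1 i).symm
    have h3 : (Equiv.Perm.sign (Tuple.sort (v ∘ σ)) : ℤ) =
        Equiv.Perm.sign σ * Equiv.Perm.sign (Tuple.sort v) := by
      rw [h2, map_mul, Units.val_mul, ← mul_assoc, ← Units.val_mul, Int.units_mul_self]
      simp
    rw [altExtend, dif_pos h', altExtend, dif_pos h, smul_smul, h3]
    congr 2
    exact Subtype.ext h1
  · have h' : ¬ (Function.Injective (v ∘ σ) ∧ Spans L (v ∘ σ)) := fun h' =>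
      h ⟨(σ.injective_comp v).1 h'.1, (spans_comp_perm v σ).1 h'.2⟩
    rw [altExtend, dif_neg h', altExtend, dif_neg h, smul_zero]

theorem altExtend_mem (u : OrdSimplex L n → R) : altExtend u ∈ alternatingCochains L R n := by
  refine ⟨fun v h => dif_neg fun h' => h h'.2, fun v i j hij h => dif_neg fun h' =>
    hij.ne (h'.1 h), fun v i j hij => ?_⟩
  have hne : i ≠ j := fun h => by rw [h] at hij; omega
  rw [altExtend_comp_perm, Equiv.Perm.sign_swap hne]
  simp

/-- An alternating cochain is determined by its values on increasing tuples: sort the vertices. -/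
theorem restrOrd_bijective : Function.Bijective (restrOrd L R n) := by
  constructor
  · refine (injective_iff_map_eq_zero _).2 fun f hf => Subtype.ext (funext fun v => ?_)
    change f.1 v = 0
    by_cases h : Function.Injective v ∧ Spans L v
    · have h1 := alternating_comp_perm f.2 (Tuple.sort v) v
      have h2 : f.1 (v ∘ Tuple.sort v) = 0 := congrFun hf ⟨v ∘ Tuple.sort v,
        (Tuple.monotone_sort v).strictMono_of_injective (h.1.comp (Tuple.sort v).injective),
        (spans_comp_perm v _).2 h.2⟩
      rw [h2] at h1
      have h3 := congrArg (fun x => (Equiv.Perm.sign (Tuple.sort v) : ℤ) • x) h1.symm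
      simpa only [smul_smul, ← Units.val_mul, Int.units_mul_self, Units.val_one, one_smul,
        smul_zero] using h3
    · by_cases hs : Spans L v
      · have hi : ¬ Function.Injective v := fun hi => h ⟨hi, hs⟩
        simp only [Function.Injective, not_forall] at hi
        obtain ⟨i, j, hij, hne⟩ := hi
        rcases lt_or_gt_of_ne hne with hlt | hlt
        · exact f.2.2.1 v i j hlt hij
        · exact f.2.2.1 v j i hlt hij.symm
      · exact f.2.1 v hs
  · refine fun u => ⟨⟨altExtend u, altExtend_mem u⟩, funext fun v => ?_⟩
    change altExtend u v.1 = u v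
    have h1 : Tuple.sort v.1 = 1 := Tuple.sort_eq_refl_iff_monotone.2 v.2.1.monotone
    rw [altExtend, dif_pos ⟨v.2.1.injective, v.2.2⟩]
    simp only [h1, map_one, Units.val_one, one_smul]
    rfl

variable (L R n) in
/-- Alternating cochains are the functions of ordered simplices. -/
def restrOrdEquiv : SimplicialCochain L R n ≃ₗ[R] (OrdSimplex L n → R) :=
  LinearEquiv.ofBijective (restrOrd L R n) restrOrd_bijective

variable (L R n) in
/-- The reduced cohomology class of a cocycle on ordered simplices. -/
def ordClass : LinearMap.ker (ordCob L R n) →ₗ[R] ReducedCohomology L R n :=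
  (Submodule.mkQ ((simplicialCoboundaries L R n).submoduleOf (simplicialCocycles L R n))).comp
    (((restrOrdEquiv L R n).symm.toLinearMap.restrict (p := LinearMap.ker (ordCob L R n))
      (q := simplicialCocycles L R n)) fun u hu => by
        have hu' : ordCob L R n u = 0 := hu
        change simplicialCoboundary L R n ((restrOrdEquiv L R n).symm u) = 0
        refine restrOrd_bijective.1 ?_
        rw [restrOrd_coboundary, map_zero, ← hu']
        exact congrArg _ ((restrOrdEquiv L R n).apply_symm_apply u))

/-- Coboundaries on ordered simplices. -/
def IsOrdCob (n : ℕ) (u : OrdSimplex L n → R) : Prop :=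
  match n, u with
  | 0, u => u = 0
  | n + 1, u => ∃ w, ordCob L R n w = u

theorem ordClass_surjective : Function.Surjective (ordClass L R n) := by
  intro x
  obtain ⟨f, rfl⟩ := Submodule.mkQ_surjective
    ((simplicialCoboundaries L R n).submoduleOf (simplicialCocycles L R n)) x
  have hf : simplicialCoboundary L R n f.1 = 0 := f.2
  refine ⟨⟨restrOrdEquiv L R n f.1, ?_⟩, ?_⟩
  · change ordCob L R n (restrOrd L R n f.1) = 0
    rw [← restrOrd_coboundary, hf, map_zero]
  · refine congrArg (Submodule.mkQ _) (?_ : _ = f)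
    exact Subtype.ext ((restrOrdEquiv L R n).symm_apply_apply f.1)

theorem ordClass_eq_zero {u : LinearMap.ker (ordCob L R n)} :
    ordClass L R n u = 0 ↔ IsOrdCob n u.1 := by
  refine (Submodule.Quotient.mk_eq_zero _).trans ?_
  change (restrOrdEquiv L R n).symm u.1 ∈ simplicialCoboundaries L R n ↔ _
  cases n with
  | zero =>
    change (restrOrdEquiv L R 0).symm u.1 = 0 ↔ u.1 = 0
    exact LinearEquiv.map_eq_zero_iff _
  | succ n =>
    change (∃ w, simplicialCoboundary L R n w = _) ↔ ∃ w, ordCob L R n w = u.1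
    refine ⟨fun ⟨w, hw⟩ => ⟨restrOrd L R n w, ?_⟩, fun ⟨w, hw⟩ =>
      ⟨(restrOrdEquiv L R n).symm w, ?_⟩⟩
    · rw [← restrOrd_coboundary, hw]
      exact (restrOrdEquiv L R (n + 1)).apply_symm_apply u.1
    · refine restrOrd_bijective.1 ?_
      rw [restrOrd_coboundary]
      refine Eq.trans ?_ ((restrOrdEquiv L R (n + 1)).apply_symm_apply u.1).symm
      rw [← hw]
      exact congrArg _ ((restrOrdEquiv L R n).apply_symm_apply w)

end alternating

/-! ### The jumps of a cocycle of the cyclic cover -/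

section slices
open CarriedComplex
variable {V : Type u} {L : PreAbstractSimplicialComplex V} [LinearOrder V] {R : Type w} {n : ℕ}

/-- The values of a cubical cochain on the cubes of height `m`. -/
def slice (e : Cube L n → R) (m : ℤ) : OrdSimplex L n → R := fun v => e ⟨0, m, v.1, v.2.1, v.2.2⟩

/-- The lattice invariant cochain with given values on the cubes of each height. -/
def unslice (d : ℤ → OrdSimplex L n → R) : Cube L n → R := fun c => d c.m ⟨c.v, c.mono, c.spans⟩

theorem unslice_invariant (d : ℤ → OrdSimplex L n → R) :
    (Cube.carried L).IsInvariant (lattice V) (unslice d) := fun g hg (c : Cube L n) => by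
  have hg' : g.2 = 0 := hg
  change d (g.2 + c.m) _ = d c.m _
  rw [hg', zero_add]
  rfl

theorem invariant_eq {e : Cube L n → R} (he : (Cube.carried L).IsInvariant (lattice V) e)
    (a a' : V → ℤ) (m : ℤ) {v : Fin n → V} (h : StrictMono v) (h' : Spans L v) :
    e ⟨a, m, v, h, h'⟩ = e ⟨a', m, v, h, h'⟩ := by
  rw [← he (a - a', 0) rfl ⟨a', m, v, h, h'⟩]
  exact congrArg e (Cube.ext (sub_add_cancel _ _).symm (zero_add _).symm rfl)

theorem unslice_slice {e : Cube L n → R} (he : (Cube.carried L).IsInvariant (lattice V) e) :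
    unslice (slice e) = e := funext fun c => invariant_eq he 0 c.a c.m c.mono c.spans

theorem invariant_ext {e e' : Cube L n → R} (he : (Cube.carried L).IsInvariant (lattice V) e)
    (he' : (Cube.carried L).IsInvariant (lattice V) e') (h : ∀ m, slice e m = slice e' m) :
    e = e' := by
  rw [← unslice_slice he, ← unslice_slice he', funext h]

variable [Ring R]

/-- A cube of height `m` has the same faces at the heights `m + 1` and `m`, so that the cubical
coboundary is the simplicial coboundary of the jump. -/
theorem slice_cob {e : Cube L n → R} (he : (Cube.carried L).IsInvariant (lattice V) e) (m : ℤ) :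
    slice ((Cube.carried L).cob e) m = ordCob L R n (slice e (m + 1) - slice e m) :=
  funext fun v => by
    change Finsupp.linearCombination ℤ e (Cube.bd n ⟨0, m, v.1, v.2.1, v.2.2⟩) = _
    rw [Cube.bd, map_sum, ordCob_apply]
    refine Finset.sum_congr rfl fun i _ => ?_
    rw [map_smul, map_sub, Finsupp.linearCombination_single, Finsupp.linearCombination_single,
      one_smul, one_smul]
    congr 2
    exact invariant_eq he _ _ _ _ _

variable (Ψ : CarriedMap (Cube.carried L) (Lift.carried L))

variable (R n) in
/-- The jump of a cochain of the cyclic cover between the heights `k` and `k + 1`. -/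
def jump (k : ℤ) : Cochain (singularSet (CyclicCover L)) R n →ₗ[R] (OrdSimplex L n → R) where
  toFun f := slice (theta Ψ n f) (k + 1) - slice (theta Ψ n f) k
  map_add' f g := by
    funext v
    simp only [map_add, slice, Pi.add_apply, Pi.sub_apply]
    abel
  map_smul' r f := by
    funext v
    simp only [map_smul, slice, Pi.smul_apply, Pi.sub_apply, RingHom.id_apply, smul_sub]

theorem jump_apply (k : ℤ) (f : Cochain (singularSet (CyclicCover L)) R n) :
    jump R n Ψ k f = slice (theta Ψ n f) (k + 1) - slice (theta Ψ n f) k := rfl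

theorem slice_theta_coboundary (f : Cochain (singularSet (CyclicCover L)) R n) (k : ℤ) :
    slice (theta Ψ (n + 1) (coboundary _ R n f)) k = ordCob L R n (jump R n Ψ k f) := by
  rw [theta_coboundary, slice_cob (theta_invariant Ψ f)]
  rfl

theorem slice_theta_deck (f : Cochain (singularSet (CyclicCover L)) R n) (k : ℤ) :
    slice (theta Ψ n (cochainMap R (singMap (deck L 1)) n f)) k = slice (theta Ψ n f) (k + 1) :=
  funext fun v => by
    refine (theta_vadd Ψ f (0, 1) _).symm.trans ?_
    exact congrArg (theta Ψ n f) (Cube.ext (add_zero _) (add_comm _ _) rfl)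

theorem jump_mem_ker {f : Cochain (singularSet (CyclicCover L)) R n} (hf : f ∈ cocycles _ R n)
    (k : ℤ) : jump R n Ψ k f ∈ LinearMap.ker (ordCob L R n) := by
  rw [LinearMap.mem_ker, ← slice_theta_coboundary, show coboundary _ R n f = 0 from hf, map_zero]
  rfl

/-- The jumps of a coboundary are coboundaries. -/
theorem isOrdCob_jump {f : Cochain (singularSet (CyclicCover L)) R n} (hf : f ∈ coboundaries _ R n)
    (k : ℤ) : IsOrdCob n (jump R n Ψ k f) := by
  cases n with
  | zero =>
    rw [show f = 0 from hf, map_zero]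
    rfl
  | succ n =>
    obtain ⟨e, rfl⟩ := hf
    refine ⟨jump R n Ψ (k + 1) e - jump R n Ψ k e, ?_⟩
    rw [map_sub, ← slice_theta_coboundary, ← slice_theta_coboundary]
    rfl

variable (R n) in
/-- The classes of the jumps of a cocycle. -/
def kappaCocycle : cocycles (singularSet (CyclicCover L)) R n →ₗ[R]
    (ℤ → ReducedCohomology L R n) :=
  LinearMap.pi fun k => (ordClass L R n).comp
    ((jump R n Ψ k).restrict (q := LinearMap.ker (ordCob L R n)) fun _ hf => jump_mem_ker Ψ hf k)

variable (R n) in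
/-- The map from the cohomology of the cyclic cover to sequences of reduced cohomology classes
of `L` that measures how far a class is from being invariant. -/
def kappa : SingularCohomology (CyclicCover L) R n →ₗ[R] (ℤ → ReducedCohomology L R n) :=
  Submodule.liftQ _ (kappaCocycle R n Ψ) fun _ hf => funext fun k =>
    ordClass_eq_zero.2 (isOrdCob_jump Ψ hf k)

theorem kappa_mk_eq_zero {f : cocycles (singularSet (CyclicCover L)) R n} :
    kappa R n Ψ (Cohomology.mk f) = 0 ↔ ∀ k, IsOrdCob n (jump R n Ψ k f.1) :=
  funext_iff.trans (forall_congr' fun _ => ordClass_eq_zero)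

/-- Sequences are the jumps of their sums. -/
theorem exists_jump_eq {M : Type*} [AddCommGroup M] (w : ℤ → M) :
    ∃ d : ℤ → M, ∀ k, d (k + 1) - d k = w k :=
  ⟨fun k => intSum w 0 k, fun k => sub_eq_iff_eq_add'.2 (intSum_succ w 0 k)⟩

/-- Prescribed cocycles on `L` are the jumps of their sums, which form a cubical cocycle since its
coboundary measures the coboundaries of the jumps. -/
theorem kappa_surjective : Function.Surjective (kappa R n Ψ) := fun x => by
  choose u hu using fun k => ordClass_surjective (x k)
  obtain ⟨d, hd⟩ := exists_jump_eq fun k => (u k).1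
  have hs : ∀ k, slice (unslice d) k = d k := fun k => rfl
  have hc : (Cube.carried L).cob (unslice d) = 0 := by
    refine invariant_ext (unslice_invariant d).cob (fun _ _ _ => rfl) fun k => ?_
    rw [slice_cob (unslice_invariant d), hs, hs, hd]
    exact (u k).2
  obtain ⟨f, hf, h⟩ := exists_isCob_theta_sub Ψ (unslice_invariant d) hc
  refine ⟨Cohomology.mk ⟨f, hf⟩, funext fun k => ?_⟩
  rw [← hu k]
  refine sub_eq_zero.1 ((map_sub (ordClass L R n) _ _).symm.trans (ordClass_eq_zero.2 ?_))
  change IsOrdCob n (jump R n Ψ k f - (u k).1)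
  rw [jump_apply, ← hd k]
  cases n with
  | zero =>
    have h' : theta Ψ 0 f = unslice d := sub_eq_zero.1 h
    rw [h', hs, hs, sub_self]
    rfl
  | succ n =>
    obtain ⟨e, he, h'⟩ := h
    have h1 : ∀ k, slice (theta Ψ (n + 1) f) k - d k =
        ordCob L R n (slice e (k + 1) - slice e k) := fun k => by
      rw [← slice_cob he, h']
      rfl
    refine ⟨(slice e (k + 1 + 1) - slice e (k + 1)) - (slice e (k + 1) - slice e k), ?_⟩
    rw [map_sub, ← h1, ← h1]
    abel

theorem kappa_deck (x : SingularCohomology (CyclicCover L) R n) (k : ℤ) :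
    kappa R n Ψ (pullback R (deck L 1) n x) k = kappa R n Ψ x (k + 1) := by
  induction x using Cohomology.ind with | h f =>
  refine congrArg (ordClass L R n) (Subtype.ext ?_)
  change jump R n Ψ k (cochainMap R (singMap (deck L 1)) n f.1) = jump R n Ψ (k + 1) f.1
  rw [jump_apply, jump_apply, slice_theta_deck, slice_theta_deck]

/-- Classes without jumps are invariant. -/
theorem deck_eq_of_kappa_eq_zero {x : SingularCohomology (CyclicCover L) R n}
    (hx : kappa R n Ψ x = 0) : pullback R (deck L 1) n x = x := by
  induction x using Cohomology.ind with | h f =>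
  have hj := (kappa_mk_eq_zero Ψ).1 hx
  refine Cohomology.mk_eq.2 ?_
  refine mem_coboundaries_of_theta Ψ (sub_mem (cocycleMap R (singMap (deck L 1)) n f).2 f.2) ?_
  -- the slices of the difference `q` are the jumps of `f`
  set q := (cocycleMap R (singMap (deck L 1)) n f).1 - f.1
  have hq : ∀ k, slice (theta Ψ n q) k = jump R n Ψ k f.1 := fun k => by
    rw [jump_apply, ← slice_theta_deck, show q = cochainMap R (singMap (deck L 1)) n f.1 - f.1
      from rfl, map_sub]
    rfl
  cases n with
  | zero =>
    refine invariant_ext (theta_invariant Ψ q) (fun _ _ _ => rfl) fun k => ?_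
    rw [hq, show jump R 0 Ψ _ f.1 = 0 from hj _]
    rfl
  | succ n =>
    choose w hw using hj
    obtain ⟨d, hd⟩ := exists_jump_eq w
    refine ⟨unslice d, unslice_invariant d,
      invariant_ext (unslice_invariant d).cob (theta_invariant Ψ q) fun k => ?_⟩
    rw [slice_cob (unslice_invariant d), hq, ← hw, ← hd]
    rfl

/-- Invariant cocycles have no jumps. -/
theorem kappa_eq_zero_of_invariant {f : cocycles (singularSet (CyclicCover L)) R n}
    (hf : cochainMap R (singMap (deck L 1)) n f.1 = f.1) :
    kappa R n Ψ (Cohomology.mk f) = 0 := by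
  refine (kappa_mk_eq_zero Ψ).2 fun k => ?_
  rw [jump_apply, ← slice_theta_deck, hf, sub_self]
  cases n with
  | zero => exact rfl
  | succ n => exact ⟨0, map_zero _⟩

end slices

/-! ### Deck transformations and singular cochains -/

section torsor
variable {V : Type u} {L : PreAbstractSimplicialComplex V} {n : ℕ}

/-- The action of a deck transformation on singular simplices. -/
abbrev deckSimplex (k : ℤ) (y : singularSet (CyclicCover L) _⦋n⦌) :
    singularSet (CyclicCover L) _⦋n⦌ :=
  (singMap (deck L k)).app (op ⦋n⦌) y

/-- The singular simplex of `T_L` below a singular simplex of the cover. -/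
abbrev projSimplex (y : singularSet (CyclicCover L) _⦋n⦌) : singularSet (TorusComplex L) _⦋n⦌ :=
  (singMap (coverProj L)).app (op ⦋n⦌) y

theorem deckSimplex_deckSimplex (j k : ℤ) (y : singularSet (CyclicCover L) _⦋n⦌) :
    deckSimplex j (deckSimplex k y) = deckSimplex (k + j) y := by
  refine simplexMap_injective (ContinuousMap.ext fun z => Subtype.ext (Prod.ext rfl ?_))
  change (simplexMap y z).1.2 + k * (2 * Real.pi) + j * (2 * Real.pi) =
    (simplexMap y z).1.2 + ((k + j : ℤ) : ℝ) * (2 * Real.pi)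
  push_cast
  ring

theorem deckSimplex_zero (y : singularSet (CyclicCover L) _⦋n⦌) : deckSimplex 0 y = y := by
  refine simplexMap_injective (ContinuousMap.ext fun z => Subtype.ext (Prod.ext rfl ?_))
  change (simplexMap y z).1.2 + ((0 : ℤ) : ℝ) * (2 * Real.pi) = (simplexMap y z).1.2
  simp

theorem projSimplex_deckSimplex (k : ℤ) (y : singularSet (CyclicCover L) _⦋n⦌) :
    projSimplex (deckSimplex k y) = projSimplex y := rfl

theorem deckSimplex_left_injective {j k : ℤ} {y : singularSet (CyclicCover L) _⦋n⦌}
    (h : deckSimplex j y = deckSimplex k y) : j = k := by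
  have h1 : (simplexMap (deckSimplex j y) (stdSimplex.vertex 0)).1.2 =
      (simplexMap (deckSimplex k y) (stdSimplex.vertex 0)).1.2 := by rw [h]
  change (simplexMap y (stdSimplex.vertex 0)).1.2 + j * (2 * Real.pi) =
    (simplexMap y (stdSimplex.vertex 0)).1.2 + k * (2 * Real.pi) at h1
  have hpi : (2 * Real.pi) ≠ 0 := by positivity
  exact_mod_cast mul_right_cancel₀ hpi (add_left_cancel h1)

/-- Singular simplices lift to the cyclic cover. -/
theorem projSimplex_surjective :
    Function.Surjective (projSimplex : singularSet (CyclicCover L) _⦋n⦌ → _) := fun x => by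
  obtain ⟨θ, hθ⟩ := exists_lift ((mu L).comp (simplexMap x))
  let y : C(stdSimplex ℝ (Fin (n + 1)), CyclicCover L) :=
    ⟨fun z => ⟨(simplexMap x z, θ z), (hθ z).symm⟩,
      Continuous.subtype_mk ((simplexMap x).continuous.prodMk θ.continuous) _⟩
  refine ⟨ofMap y, simplexMap_injective ?_⟩
  rw [simplexMap_singMap, simplexMap_ofMap]
  rfl

/-- Two lifts of a singular simplex differ by a deck transformation. -/
theorem exists_deckSimplex_eq {y y' : singularSet (CyclicCover L) _⦋n⦌}
    (h : projSimplex y = projSimplex y') : ∃ k, deckSimplex k y = y' := by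
  have h1 : ∀ z, (simplexMap y z).1.1 = (simplexMap y' z).1.1 := fun z =>
    congrArg (fun x => simplexMap x z) h
  let ht : singularSet (CyclicCover L) _⦋n⦌ → C(stdSimplex ℝ (Fin (n + 1)), ℝ) := fun y =>
    ⟨fun z => (simplexMap y z).1.2,
      continuous_snd.comp (continuous_subtype_val.comp (simplexMap y).continuous)⟩
  have h2 : ∀ z, Circle.exp (ht y z) = Circle.exp (ht y' z) := fun z =>
    (simplexMap y z).2.symm.trans ((congrArg (mu L) (h1 z)).trans (simplexMap y' z).2)
  obtain ⟨k, hk⟩ := Circle.exp_eq_exp.1 (h2 (stdSimplex.vertex 0)).symm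
  refine ⟨k, simplexMap_injective (ContinuousMap.ext fun z =>
    Subtype.ext (Prod.ext (h1 z) ?_))⟩
  have h3 := lift_sub_eq h2 z (stdSimplex.vertex 0)
  change ht y z + k * (2 * Real.pi) = ht y' z
  linarith

/-- A chosen lift of a singular simplex of `T_L`. -/
def baseLift (x : singularSet (TorusComplex L) _⦋n⦌) : singularSet (CyclicCover L) _⦋n⦌ :=
  (projSimplex_surjective x).choose

theorem projSimplex_baseLift (x : singularSet (TorusComplex L) _⦋n⦌) :
    projSimplex (baseLift x) = x := (projSimplex_surjective x).choose_spec

/-- The sheet of the cover on which a singular simplex lies, relative to the chosen lifts. -/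
def sheet (y : singularSet (CyclicCover L) _⦋n⦌) : ℤ :=
  (exists_deckSimplex_eq (projSimplex_baseLift (projSimplex y))).choose

theorem deckSimplex_sheet (y : singularSet (CyclicCover L) _⦋n⦌) :
    deckSimplex (sheet y) (baseLift (projSimplex y)) = y :=
  (exists_deckSimplex_eq (projSimplex_baseLift (projSimplex y))).choose_spec

theorem sheet_deckSimplex (k : ℤ) (y : singularSet (CyclicCover L) _⦋n⦌) :
    sheet (deckSimplex k y) = sheet y + k := by
  refine deckSimplex_left_injective (y := baseLift (projSimplex y)) ?_
  rw [← deckSimplex_deckSimplex, deckSimplex_sheet]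
  exact deckSimplex_sheet (deckSimplex k y)

variable {R : Type w} [Ring R]

/-- The pull-back of cochains along the covering projection. -/
abbrev projPull (L : PreAbstractSimplicialComplex V) (R : Type w) [Ring R] (n : ℕ) : Cochain (singularSet (TorusComplex L)) R n →ₗ[R]
    Cochain (singularSet (CyclicCover L)) R n :=
  cochainMap R (singMap (coverProj L)) n

/-- The action of the generating deck transformation on cochains. -/
abbrev deckPull (L : PreAbstractSimplicialComplex V) (R : Type w) [Ring R] (n : ℕ) : Cochain (singularSet (CyclicCover L)) R n →ₗ[R]
    Cochain (singularSet (CyclicCover L)) R n :=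
  cochainMap R (singMap (deck L 1)) n

theorem projPull_injective : Function.Injective (projPull L R n) := fun c c' h => by
  funext x
  rw [← projSimplex_baseLift x]
  exact congrFun h (baseLift x)

theorem deckPull_projPull (c : Cochain (singularSet (TorusComplex L)) R n) :
    deckPull L R n (projPull L R n c) = projPull L R n c := rfl

/-- Invariant cochains come from `T_L`. -/
theorem exists_projPull_eq {f : Cochain (singularSet (CyclicCover L)) R n}
    (hf : deckPull L R n f = f) : ∃ c, projPull L R n c = f := by
  have h1 : ∀ (k : ℤ) y, f (deckSimplex k y) = f y := fun k => by
    have hs : ∀ y, f (deckSimplex 1 y) = f y := fun y => congrFun hf y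
    induction k using Int.induction_on with
    | zero => intro y; rw [deckSimplex_zero]
    | succ k ih => intro y; rw [← deckSimplex_deckSimplex, hs, ih]
    | pred k ih =>
      intro y
      rw [← hs, deckSimplex_deckSimplex, sub_add_cancel, ih]
  refine ⟨fun x => f (baseLift x), funext fun y => ?_⟩
  change f (baseLift (projSimplex y)) = f y
  rw [← h1 (sheet y), deckSimplex_sheet]

/-- The difference operator of the deck transformation is surjective on cochains. -/
theorem exists_deckPull_sub_eq (f : Cochain (singularSet (CyclicCover L)) R n) :
    ∃ g, deckPull L R n g - g = f := by
  refine ⟨fun y => intSum (fun j => f (deckSimplex j (baseLift (projSimplex y)))) 0 (sheet y),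
    funext fun y => ?_⟩
  change intSum (fun j => f (deckSimplex j (baseLift (projSimplex (deckSimplex 1 y))))) 0
    (sheet (deckSimplex 1 y)) - intSum (fun j => f (deckSimplex j (baseLift (projSimplex y)))) 0
      (sheet y) = f y
  rw [sheet_deckSimplex, projSimplex_deckSimplex, intSum_succ, add_sub_cancel_left,
    deckSimplex_sheet]

theorem mem_cocycles_of_projPull {c : Cochain (singularSet (TorusComplex L)) R n}
    (h : projPull L R n c ∈ cocycles _ R n) : c ∈ cocycles _ R n := by
  refine projPull_injective ?_
  rw [← coboundary_cochainMap, map_zero]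
  exact h

/-- Invariant classes come from `T_L`. -/
theorem exists_pullback_eq {x : SingularCohomology (CyclicCover L) R n}
    (hx : pullback R (deck L 1) n x = x) : ∃ c, pullback R (coverProj L) n c = x := by
  induction x using Cohomology.ind with | h f =>
  have h1 : deckPull L R n f.1 - f.1 ∈ coboundaries _ R n := Cohomology.mk_eq.1 hx
  cases n with
  | zero =>
    obtain ⟨c, hc⟩ := exists_projPull_eq (sub_eq_zero.1 h1)
    exact ⟨Cohomology.mk ⟨c, mem_cocycles_of_projPull (hc ▸ f.2)⟩,
      congrArg Cohomology.mk (Subtype.ext hc)⟩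
  | succ n =>
    -- correct the cocycle `f` by a coboundary to make it invariant
    obtain ⟨e, he⟩ := h1
    obtain ⟨g, hg⟩ := exists_deckPull_sub_eq e
    obtain ⟨c, hc⟩ := exists_projPull_eq (f := f.1 - coboundary _ R n g) (by
      rw [map_sub, ← coboundary_cochainMap, sub_eq_sub_iff_sub_eq_sub, ← map_sub, hg, he])
    have hd : coboundary _ R n g ∈ cocycles (singularSet (CyclicCover L)) R (n + 1) :=
      coboundary_coboundary g
    refine ⟨Cohomology.mk ⟨c, mem_cocycles_of_projPull (hc ▸ sub_mem f.2 hd)⟩,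
      Cohomology.mk_eq.2 ⟨-g, ?_⟩⟩
    change coboundary _ R n (-g) = projPull L R (n + 1) c - f.1
    rw [hc, map_neg, sub_sub_cancel_left]

theorem pullback_deck_pullback (k : ℤ) (c : SingularCohomology (TorusComplex L) R n) :
    pullback R (deck L k) n (pullback R (coverProj L) n c) = pullback R (coverProj L) n c := by
  induction c using Cohomology.ind with | h f => rfl

/-! ### The kernel of the projection -/

theorem exists_level (p : CyclicCover L) :
    ∃ m : ℤ, p.1.2 = Complex.arg (mu L p.1.1) + m * (2 * Real.pi) :=
  Circle.exp_eq_exp.1 (p.2.symm.trans (Circle.exp_arg _).symm)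

/-- The number of full turns in the height of a point of the cyclic cover. It is not continuous, but
only its values at the vertices of singular simplices matter. -/
def level (p : CyclicCover L) : ℤ := (exists_level p).choose

theorem level_spec (p : CyclicCover L) :
    p.1.2 = Complex.arg (mu L p.1.1) + level p * (2 * Real.pi) := (exists_level p).choose_spec

theorem level_deck (k : ℤ) (p : CyclicCover L) : level (deck L k p) = level p + k := by
  have h1 := level_spec (deck L k p)
  change p.1.2 + k * (2 * Real.pi) = Complex.arg (mu L p.1.1) + _ at h1
  rw [level_spec p, add_assoc, ← add_mul] at h1
  have hpi : (2 * Real.pi) ≠ 0 := by positivity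
  exact_mod_cast (mul_right_cancel₀ hpi (add_left_cancel h1)).symm

variable (L R) in
/-- The level as a cochain. -/
def levelCochain : Cochain (singularSet (CyclicCover L)) R 0 := fun y =>
  (level (simplexMap y (stdSimplex.vertex 0)) : R)

theorem deckPull_levelCochain :
    deckPull L R 0 (levelCochain L R) = levelCochain L R + unitCochain _ R := funext fun y => by
  change ((level (deck L 1 (simplexMap y (stdSimplex.vertex 0))) : ℤ) : R) = _
  rw [level_deck]
  push_cast
  rfl

/-- The level is a primitive of the class `β` on the cyclic cover. -/
theorem coboundary_levelCochain :
    coboundary _ R 0 (levelCochain L R) = projPull L R 1 (turningCochain R (mu L)) :=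
  funext fun y => by
    have h1 := turning_spec ((mu L).comp (simplexMap (projSimplex y)))
      ⟨fun z => (simplexMap y z).1.2,
        continuous_snd.comp (continuous_subtype_val.comp (simplexMap y).continuous)⟩
      fun z => (simplexMap y z).2.symm
    simp only [ContinuousMap.coe_mk] at h1
    rw [level_spec, level_spec (simplexMap y (stdSimplex.vertex 0))] at h1
    have h2 : (level (simplexMap y (stdSimplex.vertex 1)) : ℝ) -
        level (simplexMap y (stdSimplex.vertex 0)) =
          turning ((mu L).comp (simplexMap (projSimplex y))) := by
      have hpi : (2 * Real.pi) ≠ 0 := by positivity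
      refine mul_right_cancel₀ hpi ?_
      change Complex.arg (mu L (simplexMap y (stdSimplex.vertex 1)).1.1) + _ -
        (Complex.arg (mu L (simplexMap y (stdSimplex.vertex 0)).1.1) + _) =
        Complex.arg (mu L (simplexMap y (stdSimplex.vertex 1)).1.1) -
        Complex.arg (mu L (simplexMap y (stdSimplex.vertex 0)).1.1) + _ at h1
      linarith
    have h3 : level (simplexMap y (stdSimplex.vertex 1)) -
        level (simplexMap y (stdSimplex.vertex 0)) =
          turning ((mu L).comp (simplexMap (projSimplex y))) := by exact_mod_cast h2
    have h4 : simplexMap ((singularSet (CyclicCover L)).δ 0 y) (stdSimplex.vertex 0) =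
        simplexMap y (stdSimplex.vertex 1) := by
      rw [simplexMap_δ, stdSimplex.map_vertex]; rfl
    have h5 : simplexMap ((singularSet (CyclicCover L)).δ 1 y) (stdSimplex.vertex 0) =
        simplexMap y (stdSimplex.vertex 0) := by
      rw [simplexMap_δ, stdSimplex.map_vertex]; rfl
    rw [coboundary_apply, Fin.sum_univ_two]
    change _ = ((turning ((mu L).comp (simplexMap (projSimplex y))) : ℤ) : R)
    simp only [levelCochain, h4, h5, ← h3]
    push_cast
    simp [sub_eq_add_neg]

/-- A class of positive degree in the kernel of `π^*` is a multiple of `β`, provided every class of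
the cover is the sum of one from `T_L` and one in the image of the difference operator. -/
theorem exists_cup_eq (hsum : ∀ x : SingularCohomology (CyclicCover L) R n, ∃ b g,
      x = pullback R (coverProj L) n b + (pullback R (deck L 1) n g - g))
    {c : Cochain (singularSet (TorusComplex L)) R (n + 1)}
    (hc : projPull L R (n + 1) c ∈ coboundaries _ R (n + 1)) :
    ∃ b ∈ cocycles (singularSet (TorusComplex L)) R n,
      c - cup (Nat.add_comm 1 n) (turningCochain R (mu L)) b ∈ coboundaries _ R (n + 1) := by
  obtain ⟨e, he⟩ := hc
  have hq : deckPull L R n e - e ∈ cocycles _ R n := by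
    change coboundary _ R n _ = 0
    rw [map_sub, coboundary_cochainMap, he, deckPull_projPull, sub_self]
  obtain ⟨b, g, hbg⟩ := hsum (Cohomology.mk ⟨_, hq⟩)
  induction b using Cohomology.ind with | h b =>
  induction g using Cohomology.ind with | h g =>
  -- normalize the primitive `e` of `c` so that its difference comes from `T_L`
  obtain ⟨e', he', hb⟩ : ∃ e', coboundary _ R n e' = projPull L R (n + 1) c ∧
      deckPull L R n e' - e' = projPull L R n b.1 := by
    have h1 : (deckPull L R n e - e) - (projPull L R n b.1 + (deckPull L R n g.1 - g.1)) ∈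
        coboundaries _ R n := (Cohomology.mk_eq (z' := cocycleMap R _ n b +
          (cocycleMap R _ n g - g))).1 hbg
    have hg : coboundary _ R n g.1 = 0 := g.2
    cases n with
    | zero =>
      have h2 := sub_eq_zero.1 h1
      refine ⟨e - g.1, by rw [map_sub, hg, sub_zero, he], ?_⟩
      rw [map_sub, sub_sub_sub_comm, h2, add_sub_cancel_right]
    | succ n =>
      obtain ⟨s, hs⟩ := h1
      obtain ⟨s', hs'⟩ := exists_deckPull_sub_eq s
      refine ⟨e - g.1 - coboundary _ R n s', ?_, ?_⟩
      · rw [map_sub, map_sub, hg, he, coboundary_coboundary, sub_zero, sub_zero]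
      · rw [← hs', map_sub, coboundary_cochainMap] at hs
        rw [map_sub, map_sub]
        have h3 : ∀ a b c d p q r : Cochain (singularSet (CyclicCover L)) R (n + 1),
            a - b = c - d - (p + (q - r)) → c - q - a - (d - r - b) = p :=
          fun a b c d p q r h => by
            have : c - q - a - (d - r - b) = p + ((c - d - (p + (q - r))) - (a - b)) := by abel
            rw [this, h, sub_self, add_zero]
        exact h3 _ _ _ _ _ _ _ hs
  -- the deck transformation adds `1` to the level, so that `e' - level ∪ b` is invariant, and it
  -- is the pull-back of a primitive of `c - β ∪ b`
  have hbc : coboundary _ R n b.1 = 0 := b.2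
  have h2 : deckPull L R n (cup (Nat.zero_add n) (levelCochain L R) (projPull L R n b.1)) =
      cup (Nat.zero_add n) (levelCochain L R) (projPull L R n b.1) + projPull L R n b.1 := by
    rw [← cup_cochainMap, deckPull_levelCochain, deckPull_projPull, add_cup, one_cup]
  obtain ⟨a, ha⟩ := exists_projPull_eq
    (f := e' - cup (Nat.zero_add n) (levelCochain L R) (projPull L R n b.1)) (by
      rw [map_sub, h2, ← hb]; abel)
  refine ⟨b.1, b.2, a, projPull_injective ?_⟩
  have h3 := coboundary_cup (Nat.zero_add n) (levelCochain L R) (projPull L R n b.1)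
  rw [coboundary_cochainMap, hbc, map_zero, cup_zero, smul_zero, add_zero,
    coboundary_levelCochain, cup_cochainMap] at h3
  rw [← coboundary_cochainMap, ha, map_sub, he', h3, map_sub]

end torsor

/-! ### The cohomology of the cover in a fixed degree -/

section degree
variable {V : Type u} (L : PreAbstractSimplicialComplex V) (R : Type w) [Ring R] (n : ℕ)

/-- The map `kappa` for some order of the vertices: it is surjective, turns the deck transformation
into a shift, and its kernel, the invariant classes, is the image of `π^*`. -/
theorem exists_kappa : ∃ κ : SingularCohomology (CyclicCover L) R n →ₗ[R]
      (ℤ → ReducedCohomology L R n), Function.Surjective κ ∧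
    (∀ x k, κ (pullback R (deck L 1) n x) k = κ x (k + 1)) ∧
    LinearMap.ker κ = LinearMap.range (pullback R (coverProj L) n) := by
  classical
  let _ : LinearOrder V := linearOrderOfSTO WellOrderingRel
  obtain ⟨Ψ⟩ := CarriedComplex.exists_carriedMap (Cube.carried L) (Lift.carried L)
  refine ⟨kappa R n Ψ, kappa_surjective Ψ, kappa_deck Ψ, le_antisymm (fun x hx => ?_) ?_⟩
  · exact exists_pullback_eq (deck_eq_of_kappa_eq_zero Ψ hx)
  · rintro _ ⟨c, rfl⟩
    induction c using Cohomology.ind with | h c =>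
    exact kappa_eq_zero_of_invariant Ψ (f := cocycleMap R (singMap (coverProj L)) n c)
      (deckPull_projPull c.1)

theorem nonempty_coker_equiv : Nonempty
    ((SingularCohomology (CyclicCover L) R n ⧸ LinearMap.range (pullback R (coverProj L) n))
      ≃ₗ[R] (ℤ → ReducedCohomology L R n)) := by
  obtain ⟨κ, hs, -, hk⟩ := exists_kappa L R n
  exact ⟨(Submodule.quotEquivOfEq _ _ hk.symm).trans (κ.quotKerEquivOfSurjective hs)⟩

theorem range_pullback_eq_top :
    LinearMap.range (pullback R (coverProj L) n) = ⊤ ↔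
      Subsingleton (ReducedCohomology L R n) := by
  obtain ⟨e⟩ := nonempty_coker_equiv L R n
  rw [← Submodule.Quotient.subsingleton_iff, e.toEquiv.subsingleton_congr]
  exact ⟨fun _ => (Function.const_injective (α := ℤ)).subsingleton, fun _ => inferInstance⟩

variable {L R n}

/-- Every class of the cover is the sum of one from `T_L` and one in the image of the difference
operator: sequences are differences of sequences, and `κ` is surjective. -/
theorem exists_eq_pullback_add (x : SingularCohomology (CyclicCover L) R n) : ∃ b g,
    x = pullback R (coverProj L) n b + (pullback R (deck L 1) n g - g) := by
  obtain ⟨κ, hs, hd, hk⟩ := exists_kappa L R n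
  obtain ⟨d, hd'⟩ := exists_jump_eq (κ x)
  obtain ⟨g, rfl⟩ := hs d
  have h1 : x - (pullback R (deck L 1) n g - g) ∈ LinearMap.ker κ := by
    rw [LinearMap.mem_ker, map_sub, map_sub, sub_eq_zero]
    funext k
    rw [Pi.sub_apply, hd, hd']
  rw [hk] at h1
  obtain ⟨b, hb⟩ := h1
  exact ⟨b, g, by rw [hb, sub_add_cancel]⟩

/-- In degree `0`, where there are no coboundaries but `0`, the projection is injective on
cohomology since it is surjective on points. -/
theorem pullback_coverProj_zero_injective :
    Function.Injective (pullback R (coverProj L) 0) := by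
  refine (injective_iff_map_eq_zero _).2 fun c hc => ?_
  induction c using Cohomology.ind with | h c =>
  have h1 : projPull L R 0 c.1 - 0 = 0 := (Cohomology.mk_eq
    (z := cocycleMap R (singMap (coverProj L)) 0 c) (z' := 0)).1 hc
  rw [sub_zero] at h1
  refine Cohomology.mk_eq (z' := 0) |>.2 ?_
  change c.1 - 0 = 0
  rw [sub_zero]
  exact projPull_injective (h1.trans (map_zero _).symm)

/-- The kernel of `π^*` in positive degree consists of the multiples of `β`. -/
theorem exists_of_eq_beta_mul {c : SingularCohomology (TorusComplex L) R (n + 1)}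
    (hc : pullback R (coverProj L) (n + 1) c = 0) :
    ∃ b, DirectSum.of (SingularCohomology (TorusComplex L) R) (n + 1) c =
      beta L R * DirectSum.of (SingularCohomology (TorusComplex L) R) n b := by
  induction c using Cohomology.ind with | h c =>
  have h1 : projPull L R (n + 1) c.1 - 0 ∈ coboundaries _ R (n + 1) := (Cohomology.mk_eq
    (z := cocycleMap R (singMap (coverProj L)) (n + 1) c) (z' := 0)).1 hc
  rw [sub_zero] at h1
  obtain ⟨b, hb, hcb⟩ := exists_cup_eq exists_eq_pullback_add h1
  refine ⟨Cohomology.mk ⟨b, hb⟩, ?_⟩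
  have h2 : Cohomology.mk c = Cohomology.mk ⟨_, cup_mem_cocycles (Nat.add_comm 1 n)
    (turningCochain_mem R (mu L)) hb⟩ := Cohomology.mk_eq.2 hcb
  rw [beta, DirectSum.of_mul_of, h2]
  refine (DirectSum.of_eq_of_gradedMonoid_eq ?_).symm
  exact Cohomology.mk_sigma_eq (Nat.add_comm 1 n) fun x => cup_cast (Nat.add_comm 1 n) _ _ _ _ x

end degree

/-! ### The cohomology rings -/

section ring
variable {V : Type u} {L : PreAbstractSimplicialComplex V} {R : Type w} [Ring R]

theorem pullbackRing_apply {X Y : Type u} [TopologicalSpace X] [TopologicalSpace Y] (f : C(X, Y))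
    (x : SingularCohomologyRing Y R) (n : ℕ) :
    pullbackRing R f x n = pullback R f n (x n) := by
  induction x using DirectSum.induction_on with
  | zero => simp
  | of m a =>
    rw [pullbackRing_of]
    rcases eq_or_ne m n with rfl | h
    · rw [DirectSum.of_eq_same, DirectSum.of_eq_same]
    · rw [DirectSum.of_eq_of_ne _ _ _ h.symm, DirectSum.of_eq_of_ne _ _ _ h.symm, map_zero]
  | add x y hx hy => rw [map_add, DirectSum.add_apply, DirectSum.add_apply, map_add, hx, hy]

theorem mem_range_pullbackRing {X Y : Type u} [TopologicalSpace X] [TopologicalSpace Y]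
    {f : C(X, Y)} {y : SingularCohomologyRing X R} :
    y ∈ (pullbackRing R f).range ↔ ∀ n, y n ∈ LinearMap.range (pullback R f n) := by
  classical
  refine ⟨?_, fun h => ?_⟩
  · rintro ⟨x, rfl⟩ n
    exact ⟨x n, (pullbackRing_apply f x n).symm⟩
  · rw [← DirectSum.sum_support_of y]
    refine sum_mem fun n _ => ?_
    obtain ⟨a, ha⟩ := h n
    exact ⟨DirectSum.of _ n a, by rw [pullbackRing_of, ha]⟩

theorem range_pullbackRing_eq_fixedSubring :
    (pullbackRing R (coverProj L)).range = fixedSubring L R := by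
  refine le_antisymm ?_ fun y hy => mem_range_pullbackRing.2 fun n => ?_
  · rintro _ ⟨x, rfl⟩ k
    refine DFinsupp.ext fun n => ?_
    rw [pullbackRing_apply, pullbackRing_apply, pullback_deck_pullback]
  · have h1 : pullbackRing R (deck L 1) y n = y n := by rw [hy 1]
    rw [pullbackRing_apply] at h1
    exact exists_pullback_eq h1

theorem pullbackRing_beta : pullbackRing R (coverProj L) (beta L R) = 0 := by
  have h1 : pullback R (coverProj L) 1 (turningClass R (mu L)) = 0 :=
    (Cohomology.mk_eq (z := cocycleMap R (singMap (coverProj L)) 1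
      ⟨_, turningCochain_mem R (mu L)⟩) (z' := 0)).2
      ⟨levelCochain L R, coboundary_levelCochain.trans (sub_zero _).symm⟩
  rw [beta, pullbackRing_of, h1, map_zero]

theorem span_beta_eq_ker :
    TwoSidedIdeal.span {beta L R} = TwoSidedIdeal.ker (pullbackRing R (coverProj L)) := by
  classical
  refine le_antisymm (TwoSidedIdeal.span_le.2 ?_) fun x hx => ?_
  · rintro _ rfl
    exact (TwoSidedIdeal.mem_ker _).2 pullbackRing_beta
  · have h1 : ∀ n, pullback R (coverProj L) n (x n) = 0 := fun n => by
      rw [← pullbackRing_apply, (TwoSidedIdeal.mem_ker _).1 hx, DirectSum.zero_apply]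
    rw [← DirectSum.sum_support_of x]
    refine sum_mem fun n _ => ?_
    cases n with
    | zero =>
      rw [pullback_coverProj_zero_injective ((h1 0).trans (map_zero _).symm), map_zero]
      exact zero_mem _
    | succ n =>
      obtain ⟨b, hb⟩ := exists_of_eq_beta_mul (h1 (n + 1))
      rw [hb]
      exact TwoSidedIdeal.mul_mem_right _ _ _ (TwoSidedIdeal.subset_span rfl)

/-- The first isomorphism theorem. -/
theorem exists_quotient_ringEquiv_range {A B : Type*} [Ring A] [Ring B] {f : A →+* B}
    {I : TwoSidedIdeal A} (h : I = TwoSidedIdeal.ker f) :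
    ∃ φ : I.ringCon.Quotient ≃+* f.range, ∀ x, (φ (I.ringCon.mk' x) : B) = f x := by
  subst h
  exact ⟨RingCon.quotientKerEquivRange f, fun _ => rfl⟩

theorem range_pullbackRing_eq_top :
    (pullbackRing R (coverProj L)).range = ⊤ ↔ IsAcyclic L R := by
  refine Iff.trans ⟨fun h n => ?_, fun h => ?_⟩
    (forall_congr' fun n => range_pullback_eq_top L R n)
  · refine (Submodule.eq_top_iff').2 fun a => ?_
    have h1 := mem_range_pullbackRing.1 (h ▸ Subring.mem_top
      (DirectSum.of (SingularCohomology (CyclicCover L) R) n a)) n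
    rwa [DirectSum.of_eq_same] at h1
  · exact (Subring.eq_top_iff' _).2 fun y => mem_range_pullbackRing.2 fun n => by
      rw [h n]; trivial

end ring

end

end TorusCover

theorem mainTheorem4 {V : Type u} (L : PreAbstractSimplicialComplex V)
    (R : Type w) [Ring R] :
    (TorusCover.pullbackRing R (TorusCover.coverProj L)).range = TorusCover.fixedSubring L R ∧
    (∃ φ : (TwoSidedIdeal.span {TorusCover.beta L R}).ringCon.Quotient ≃+*
        (TorusCover.pullbackRing R (TorusCover.coverProj L)).range,
      (∀ x, (φ ((TwoSidedIdeal.span {TorusCover.beta L R}).ringCon.mk' x) :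
          TorusCover.SingularCohomologyRing (TorusCover.CyclicCover L) R) =
        TorusCover.pullbackRing R (TorusCover.coverProj L) x) ∧
      (Function.Bijective (fun y =>
          (φ y : TorusCover.SingularCohomologyRing (TorusCover.CyclicCover L) R)) ↔
        TorusCover.IsAcyclic L R)) ∧
    ∀ n : ℕ, Nonempty
      ((TorusCover.SingularCohomology (TorusCover.CyclicCover L) R n ⧸
          LinearMap.range (TorusCover.pullback R (TorusCover.coverProj L) n)) ≃ₗ[R]
        (ℤ → TorusCover.ReducedCohomology L R n)) := by
  obtain ⟨φ, hφ⟩ := TorusCover.exists_quotient_ringEquiv_range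
    (TorusCover.span_beta_eq_ker (L := L) (R := R))
  refine ⟨TorusCover.range_pullbackRing_eq_fixedSubring, ⟨φ, hφ, ?_⟩,
    TorusCover.nonempty_coker_equiv L R⟩
  rw [← TorusCover.range_pullbackRing_eq_top, Subring.eq_top_iff']
  refine ⟨fun h y => ?_, fun h => ⟨Subtype.val_injective.comp φ.injective, fun y => ?_⟩⟩
  · obtain ⟨q, rfl⟩ := h.2 y
    exact (φ q).2
  · exact ⟨φ.symm ⟨y, h y⟩, congrArg Subtype.val (φ.apply_symm_apply _)⟩
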